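/- Setting. Let $K:\mathbb R\to\mathbb R$ be a kernel: continuous, non-negative, bounded, with $\int K=1$ (hence $\int K^2<\infty$). Let $O_1,O_2,\dots$ be i.i.d. real random variables with law $P_0$ having Lebesgue density $p_0$, let $x\in\mathbb R$, and let $\Psi(P_0)=p_0(x)$. For a measure $P$ and a function $f$ write $Pf=\int f\,dP$. For $\delta>0$ put $K_\delta(o)=\delta^{-1}K((o-x)/\delta)$, $\Psi_\delta(P)=PK_\delta$, $D^*_\delta(P)=K_\delta-PK_\delta$, $R_\delta(P,P_0)=\Psi_\delta(P)-\Psi_\delta(P_0)+P_0D^*_\delta(P)$, $b_0(\delta)=\Psi_\delta(P_0)-\Psi(P_0)$, $D^*_{\delta,\infty}=D^*_\delta(P_0)$, $\sigma_\infty^2(\delta)=P_0(D^*_{\delta,\infty}-P_0D^*_{\delta,\infty})^2$, $H_{0,\delta}(P)=(D^*_\delta(P)-P_0D^*_\delta(P))^2$, $H_{0,\delta,\infty}=H_{0,\delta}(P_0)$. For $0<p_1<p_2<1$ let $l_{1,n}=\lfloor p_1n\rfloor$, $l_{2,n}=\lfloor p_2n\rfloor$, $l_{3,n}=n$, $m_{2}=l_{2,n}-l_{1,n}$,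 $m_{3}=n-l_{2,n}$, and let $P_{1,n},P_{2,n},P_{3,n}$ be the empirical distributions of $(O_i)_{i\le l_{1,n}}$, $(O_i)_{l_{1,n}<i\le l_{2,n}}$, $(O_i)_{l_{2,n}<i\le n}$. The initial estimators are $\widehat P_{i,n}=P_{i,n}$, $i=1,2$. Put $\sigma_{i,n}^2(\delta)=P_0(D^*_\delta(\widehat P_{i,n})-P_0D^*_\delta(\widehat P_{i,n}))^2$. Write $X_n\sim_P a_n$ for $X_n-a_n=o_P(a_n)$. "$\tilde\delta_n$ is slower than $n^{-r}$" means $\tilde\delta_n>0$ eventually, $\tilde\delta_n\to0$ and $n^{-r}=o(\tilde\delta_n)$. Assumptions. - A1: $\sigma_\infty$ and $b_0$ are twice differentiable at all small $\delta>0$, and there are constants $C_{b'},C_\sigma,C_{\sigma'},C_H\ne0$, $\beta_0\ge0$, $\gamma\ge0$, $\nu\in\mathbb R$, $\eta>0$, $k_0,k_1>0$ such that, as $\delta\downarrow0$, $\sigma_\infty(\delta)\sim C_\sigma\delta^{-\gamma}$, $\sigma_\infty'(\delta)\sim C_{\sigma'}\delta^{\nu}$, $b_0'(\delta)\sim C_{b'}\delta^{\beta_0-1}$,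 $P_0(H_{0,\delta,\infty}-P_0H_{0,\delta,\infty})^2\sim C_H\delta^{-\eta}$, $b_0''(\delta)=O(\delta^{-k_0})$, $\sigma_\infty''(\delta)=O(\delta^{-k_1})$. Put $r_0=(2\beta_0-1+\gamma-\nu)^{-1}$. - A2: for some positive $r,k_2,k_2',\kappa_2,\kappa_2'$ and every $\tilde\delta_n$ slower than $n^{-r}$: $\sigma_{1,n}(\tilde\delta_n)-\sigma_\infty(\tilde\delta_n)=O_P(\tilde\delta_n^{-k_2}m_2^{-\kappa_2})$, $\sigma'_{1,n}(\tilde\delta_n)-\sigma'_\infty(\tilde\delta_n)=O_P(\tilde\delta_n^{-k_2'}m_2^{-\kappa_2'})$, $\sigma''_{1,n}(\tilde\delta_n)\sim_P\sigma''_\infty(\tilde\delta_n)$ (the derivatives of $\sigma_{1,n}$ existing wherever those of $\sigma_\infty$ do). - A3: for some $r>0$ and every $\tilde\delta_n$ slower than $n^{-r}$: $R_{\tilde\delta_n}(\widehat P_{1,n},P_0)=o_P(\sigma_\infty(\tilde\delta_n))$. - A4: for some $r>0$ and every such $\tilde\delta_n$: $P_0(H_{0,\tilde\delta_n}(\widehat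 P_{1,n})-P_0H_{0,\tilde\delta_n}(\widehat P_{1,n}))^2\sim_P P_0(H_{0,\tilde\delta_n,\infty}-P_0H_{0,\tilde\delta_n,\infty})^2$. - A5: for some positive $k_3,\kappa_3,r$ and every such $\tilde\delta_n$: $\delta\mapsto R_\delta(\widehat P_{1,n},P_0)$ is differentiable at $\tilde\delta_n$ with derivative $O_P(\tilde\delta_n^{-k_3}m_2^{-\kappa_3})$. - A6: for $r$ in a neighbourhood of $r_0$: $\sigma_{2,n}(m_3^{-r})\sim_P\sigma_\infty(m_3^{-r})$. - A7: for $r$ in a neighbourhood of $r_0$, with $\delta=m_3^{-r}$: $R_\delta(\widehat P_{2,n},P_0)=o_P(m_3^{-1/2}\sigma_\infty(\delta)+b_0(\delta))$. - A8: for $r$ in a neighbourhood of $r_0$, with $\delta=m_3^{-r}$: $\partial_\delta R_\delta(\widehat P_{2,n},P_0)$ exists and is $o_P(m_3^{-1/2}\sigma'_\infty(\delta)+b_0'(\delta))$. Estimators. Let $\tilde\delta_{1,n},\tilde\delta_{2,n},\tilde\delta_{3,n}$ be deterministic sequences, and $\Delta_n=m_2^{-1/4}$. Put $\widehat\Psi_{2,n}(\delta)=\Psi_\delta(\widehat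 P_{1,n})+P_{2,n}D^*_\delta(\widehat P_{1,n})$, $\widehat{b'}_n(\delta)=(\widehat\Psi_{2,n}(\delta+\Delta_n)-\widehat\Psi_{2,n}(\delta))/\Delta_n$, $\widehat\sigma_n^2(\delta)=P_{2,n}(D^*_\delta(\widehat P_{1,n})-P_{2,n}D^*_\delta(\widehat P_{1,n}))^2$, $\widehat{\sigma'}_n(\delta)=(\widehat\sigma_n(\delta+\Delta_n)-\widehat\sigma_n(\delta))/\Delta_n$. With $\mathrm{sl}(f)=\frac{\log|f(\tilde\delta_{2,n})|-\log|f(\tilde\delta_{1,n})|}{\log\tilde\delta_{2,n}-\log\tilde\delta_{1,n}}$ let $\widehat\beta_n=1+\mathrm{sl}(\widehat{b'}_n)$, $\widehat\gamma_n=-\mathrm{sl}(\widehat\sigma_n)$, $\widehat\nu_n=\mathrm{sl}(\widehat{\sigma'}_n)$, $\widehat C_{b',n}=\widehat{b'}_n(\tilde\delta_{3,n})\tilde\delta_{3,n}^{-(\widehat\beta_n-1)}$, $\widehat C_{\sigma,n}=\widehat\sigma_n(\tilde\delta_{3,n})\tilde\delta_{3,n}^{\widehat\gamma_n}$, $\widehat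 C_{\sigma',n}=\widehat{\sigma'}_n(\tilde\delta_{3,n})\tilde\delta_{3,n}^{-\widehat\nu_n}$, $\widehat r_n=(2\widehat\beta_n-1+\widehat\gamma_n-\widehat\nu_n)^{-1}$, $\widehat C_n=\big(|\widehat C_{\sigma,n}\widehat C_{\sigma',n}\widehat\beta_n|/\widehat C_{b',n}^2\big)^{\widehat r_n}$, $\widehat\delta_{\epsilon,n}=\widehat C_nm_3^{-\widehat r_n-\epsilon}$, and $\widehat\Psi_n(\delta)=\Psi_\delta(\widehat P_{2,n})+P_{3,n}D^*_\delta(\widehat P_{2,n})$. Let $MSE_n(\delta)=E[(\widehat\Psi_n(\delta)-\Psi(P_0))^2]$, a deterministic function of $\delta$, and $MSE^{\rm full}_n(\delta)=n^{-1}\sigma_\infty^2(\delta)+b_0(\delta)^2$. A sequence $\delta_n^*$ is called stationary for criteria $Q_n$ if $\delta^*_n>0$ and $Q_n'(\delta_n^*)=0$ for all large $n$, and $\delta^*_n\to0$. Corollary. (i) For all $0<p_1<p_2<1$, $D^*_\delta(\widehat P_{i,n})\to D^*_{\delta,\infty}$ in $L_2(P_0)$, in probability ($i=1,2$, every $\delta>0$),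 and assumptions A2, A3, A4, A5, and (for every real number in the role of $r_0$) A6, A7, A8 hold. (ii) Assume moreover that $p_0(x)>0$, that $p_0$ is continuous at $x$, that $\Psi_\delta(P_0)\to\Psi(P_0)$ as $\delta\downarrow0$, and A1. Then there are $r^+>0$, $\epsilon_0>0$ and positive functions $K_*$, $K_{\rm full}$ on $(0,1)$, with $K_*$ non-increasing and $K_{\rm full}$ strictly decreasing, such that for all $0<p_1<p_2<1$ the following holds. For each of the criteria $MSE_n$ and $MSE^{\rm full}_n$ there is a stationary sequence that, for some $\bar\delta>0$ and all large $n$, minimizes the criterion over $(0,\bar\delta]$. Let further $\tilde\delta_{1,n},\tilde\delta_{2,n},\tilde\delta_{3,n}$ be slower than $n^{-r^+}$ and, for some $r^->0$, eventually at most $n^{-r^-}$, with $\log n=O(\log\tilde\delta_{2,n}-\log\tilde\delta_{1,n})$. Then: (a) for every $0<\epsilon\le\epsilon_0$, $$\widehat C_{\sigma,n}^{-1}\,\widehat\delta_{\epsilon,n}^{\,\widehat\gamma_n}\,(l_{3,n}-l_{2,n})^{1/2}\big(\widehat\Psi_n(\widehat\delta_{\epsilon,n})-\Psi(P_0)\big)\xrightarrow{d}\mathcal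 N(0,1);$$ (b) the selector $\widehat\delta_{0,n}$ is rate-optimal: $$\frac{MSE_n(\widehat\delta_{0,n})}{MSE_n(\delta^*_{0,n})}\xrightarrow{P}K(p_2),$$ with $K=K_*$ for every stationary sequence $\delta^*_{0,n}$ of $MSE_n$, and with $K=K_{\rm full}$ for every stationary sequence $\delta^*_{0,n}$ of $MSE_n^{\rm full}$; (c) for all $\alpha\in(0,1)$ and $\epsilon>0$, with $q_{1-\alpha/2}$ the standard normal quantile, the probability that $p_0(x)$ belongs to $$CI'_{\alpha,\epsilon,n}=\Big[\widehat\Psi_n(\widehat\delta_{0,n})\mp q_{1-\alpha/2}\,\frac{\widehat C_{\sigma,n}}{(l_{3,n}-l_{2,n})^{1/2-(\widehat r_n+\epsilon)\widehat\gamma_n}}\Big]$$ converges to one as $n\to\infty$. -/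

import Mathlib

open MeasureTheory ProbabilityTheory Filter Topology Asymptotics Set

namespace DensityPoint

noncomputable section

/-! ### Stochastic order symbols -/

/-- `X n = O_P(a n)` for random `X` and deterministic `a`. -/
def IsBigOP {Ω : Type*} [MeasurableSpace Ω] (μ : Measure Ω) (X : ℕ → Ω → ℝ) (a : ℕ → ℝ) : Prop :=
  ∀ η : ℝ, 0 < η → ∃ C : ℝ, ∀ᶠ n in atTop, μ {ω | C * |a n| < |X n ω|} ≤ ENNReal.ofReal η

/-- `X n = o_P(a n)` for random `X` and deterministic `a`. -/
def IsLittleOP {Ω : Type*} [MeasurableSpace Ω] (μ : Measure Ω) (X : ℕ → Ω → ℝ) (a : ℕ → ℝ) :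
    Prop :=
  ∀ c : ℝ, 0 < c → Tendsto (fun n => μ {ω | c * |a n| < |X n ω|}) atTop (𝓝 0)

/-- `X n ∼_P a n`, i.e. `X n - a n = o_P(a n)`. When `a n ≠ 0` this says that `X n / a n → 1` in
probability. -/
def IsEquivP {Ω : Type*} [MeasurableSpace Ω] (μ : Measure Ω) (X : ℕ → Ω → ℝ) (a : ℕ → ℝ) : Prop :=
  IsLittleOP μ (fun n ω => X n ω - a n) a

/-- An eventually positive sequence which converges to zero slower than `n ^ (-r)`. -/
structure SlowerThan (r : ℝ) (d : ℕ → ℝ) : Prop where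
  pos : ∀ᶠ n in atTop, 0 < d n
  tendsto_zero : Tendsto d atTop (𝓝 0)
  slow : (fun n : ℕ => (n : ℝ) ^ (-r)) =o[atTop] d

/-! ### Kernel, smoothed parameter, canonical gradient -/

/-- A smoothing kernel: non-negative, bounded, of integral one (hence also square integrable). -/
structure IsKernel (K : ℝ → ℝ) : Prop where
  continuous : Continuous K
  nonneg : ∀ u, 0 ≤ K u
  bounded : ∃ C, ∀ u, K u ≤ C
  integrable : Integrable K
  integral_eq_one : ∫ u, K u = 1

/-- The law on `ℝ` with Lebesgue density `p`. -/
def lawOf (p : ℝ → ℝ) : Measure ℝ := volume.withDensity fun o => ENNReal.ofReal (p o)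

/-- `p` is a probability density on `ℝ`. -/
structure IsDensity (p : ℝ → ℝ) : Prop where
  measurable : Measurable p
  nonneg : ∀ o, 0 ≤ p o
  isProbabilityMeasure : IsProbabilityMeasure (lawOf p)

/-- `K_{δ,x}(o) = δ⁻¹ K((o - x) / δ)`. -/
def kerAt (K : ℝ → ℝ) (x δ o : ℝ) : ℝ := δ⁻¹ * K ((o - x) / δ)

/-- The smoothed parameter `Ψ_δ(P) = P K_{δ,x}`. -/
def smoothed (K : ℝ → ℝ) (x δ : ℝ) (P : Measure ℝ) : ℝ := ∫ o, kerAt K x δ o ∂P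

/-- The canonical gradient `D*_δ(P) = K_{δ,x} - P K_{δ,x}`. -/
def grad (K : ℝ → ℝ) (x δ : ℝ) (P : Measure ℝ) (o : ℝ) : ℝ := kerAt K x δ o - smoothed K x δ P

/-- The remainder `R_δ(P, Q) = Ψ_δ(P) - Ψ_δ(Q) + Q D*_δ(P)` of the first order expansion. -/
def remainder (K : ℝ → ℝ) (x δ : ℝ) (P Q : Measure ℝ) : ℝ :=
  smoothed K x δ P - smoothed K x δ Q + ∫ o, grad K x δ P o ∂Q

/-- The standard deviation `(Q (D*_δ(P) - Q D*_δ(P))²)^{1/2}` under `Q` of `D*_δ(P)`. -/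
def sdGrad (K : ℝ → ℝ) (x δ : ℝ) (Q P : Measure ℝ) : ℝ :=
  √(∫ o, (grad K x δ P o - ∫ t, grad K x δ P t ∂Q) ^ 2 ∂Q)

/-- `H_{Q,δ}(P) = (D*_δ(P) - Q D*_δ(P))²`. -/
def sqGrad (K : ℝ → ℝ) (x δ : ℝ) (Q P : Measure ℝ) (o : ℝ) : ℝ :=
  (grad K x δ P o - ∫ t, grad K x δ P t ∂Q) ^ 2

/-- `Q (H_{Q,δ}(P) - Q H_{Q,δ}(P))²`. -/
def varSqGrad (K : ℝ → ℝ) (x δ : ℝ) (Q P : Measure ℝ) : ℝ :=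
  ∫ o, (sqGrad K x δ Q P o - ∫ t, sqGrad K x δ Q P t ∂Q) ^ 2 ∂Q

/-! ### Data and sample splitting -/

/-- The data of the problem: the kernel, the point, the unknown density, the observations
`O 0, O 1, …`. -/
structure Model (Ω : Type*) where
  K : ℝ → ℝ
  x : ℝ
  p₀ : ℝ → ℝ
  O : ℕ → Ω → ℝ

/-- The splitting proportions `0 < p₁ < p₂ < 1`. -/
structure Split where
  p₁ : ℝ
  p₂ : ℝ
  pos : 0 < p₁
  lt : p₁ < p₂
  lt_one : p₂ < 1

/-- `l_{1,n}`, the integer part of `p₁ n`. -/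
def Split.l₁ (S : Split) (n : ℕ) : ℕ := ⌊S.p₁ * n⌋₊

/-- `l_{2,n}`, the integer part of `p₂ n`. -/
def Split.l₂ (S : Split) (n : ℕ) : ℕ := ⌊S.p₂ * n⌋₊

/-- `l_{2,n} - l_{1,n}`, the size of the second subsample. -/
def Split.m₂ (S : Split) (n : ℕ) : ℝ := (S.l₂ n : ℝ) - (S.l₁ n : ℝ)

/-- `l_{3,n} - l_{2,n}` (with `l_{3,n} = n`), the size of the third subsample. -/
def Split.m₃ (S : Split) (n : ℕ) : ℝ := (n : ℝ) - (S.l₂ n : ℝ)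

/-- The increment `Δ_n = (l_{2,n} - l_{1,n})^{-1/4}` of the finite differences. -/
def Split.gap (S : Split) (n : ℕ) : ℝ := S.m₂ n ^ (-(1 / 4) : ℝ)

/-- The empirical distribution of `O a, …, O (b - 1)`. -/
def empirical {Ω : Type*} (O : ℕ → Ω → ℝ) (a b : ℕ) (ω : Ω) : Measure ℝ :=
  ((b - a : ℕ) : ENNReal)⁻¹ • ∑ i ∈ Finset.Ico a b, Measure.dirac (O i ω)

/-- The pilot bandwidths `δ̃_{1,n}`, `δ̃_{2,n}`, `δ̃_{3,n}`. -/
structure Pilot where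
  d₁ : ℕ → ℝ
  d₂ : ℕ → ℝ
  d₃ : ℕ → ℝ

/-- Each pilot bandwidth lies, asymptotically, strictly above `n^{-r}` and below some `n^{-s}`,
`s > 0`, and `log n = O(log δ̃_{2,n} - log δ̃_{1,n})`. -/
structure Pilot.Admissible (T : Pilot) (r : ℝ) : Prop where
  slow₁ : SlowerThan r T.d₁
  slow₂ : SlowerThan r T.d₂
  slow₃ : SlowerThan r T.d₃
  fast : ∃ s : ℝ, 0 < s ∧ ∀ᶠ n : ℕ in atTop,
    T.d₁ n ≤ (n : ℝ) ^ (-s) ∧ T.d₂ n ≤ (n : ℝ) ^ (-s) ∧ T.d₃ n ≤ (n : ℝ) ^ (-s)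
  separated : (fun n : ℕ => Real.log n) =O[atTop] fun n => Real.log (T.d₂ n) - Real.log (T.d₁ n)

namespace Model

variable {Ω : Type*} (M : Model Ω)

/-- The data-generating distribution `P₀`. -/
def P₀ : Measure ℝ := lawOf M.p₀

/-- The target parameter `Ψ(P₀) = p₀(x)`. -/
def target : ℝ := M.p₀ M.x

/-- The empirical distribution `P_{1,n}` of the first subsample. -/
def P₁ (S : Split) (n : ℕ) (ω : Ω) : Measure ℝ := empirical M.O 0 (S.l₁ n) ω

/-- The empirical distribution `P_{2,n}` of the second subsample. -/
def P₂ (S : Split) (n : ℕ) (ω : Ω) : Measure ℝ := empirical M.O (S.l₁ n) (S.l₂ n) ω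

/-- The empirical distribution `P_{3,n}` of the third subsample. -/
def P₃ (S : Split) (n : ℕ) (ω : Ω) : Measure ℝ := empirical M.O (S.l₂ n) n ω

/-- The initial estimator `P̂_{1,n}`: the empirical distribution `P_{1,n}`. -/
def init₁ (S : Split) (n : ℕ) (ω : Ω) : Measure ℝ := M.P₁ S n ω

/-- The initial estimator `P̂_{2,n}`: the empirical distribution `P_{2,n}`. -/
def init₂ (S : Split) (n : ℕ) (ω : Ω) : Measure ℝ := M.P₂ S n ω

/-- The bias `b₀(δ) = Ψ_δ(P₀) - Ψ(P₀)`. -/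
def bias (δ : ℝ) : ℝ := smoothed M.K M.x δ M.P₀ - M.target

/-- The limit gradient `D*_{δ,∞} = D*_δ(P₀)`. -/
def gradInf (δ : ℝ) : ℝ → ℝ := grad M.K M.x δ M.P₀

/-- `σ_∞(δ)`. -/
def sigmaInf (δ : ℝ) : ℝ := sdGrad M.K M.x δ M.P₀ M.P₀

/-- `σ_{1,n}(δ)`. -/
def sigma₁ (S : Split) (n : ℕ) (ω : Ω) (δ : ℝ) : ℝ := sdGrad M.K M.x δ M.P₀ (M.init₁ S n ω)

/-- `σ_{2,n}(δ)`. -/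
def sigma₂ (S : Split) (n : ℕ) (ω : Ω) (δ : ℝ) : ℝ := sdGrad M.K M.x δ M.P₀ (M.init₂ S n ω)

/-- `R_δ(P̂_{1,n}, P₀)`. -/
def rem₁ (S : Split) (n : ℕ) (ω : Ω) (δ : ℝ) : ℝ := remainder M.K M.x δ (M.init₁ S n ω) M.P₀

/-- `R_δ(P̂_{2,n}, P₀)`. -/
def rem₂ (S : Split) (n : ℕ) (ω : Ω) (δ : ℝ) : ℝ := remainder M.K M.x δ (M.init₂ S n ω) M.P₀

/-! ### Estimators -/

/-- `Ψ̂_{2,n}(δ)`. -/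
def psi₂ (S : Split) (n : ℕ) (ω : Ω) (δ : ℝ) : ℝ :=
  smoothed M.K M.x δ (M.init₁ S n ω) + ∫ o, grad M.K M.x δ (M.init₁ S n ω) o ∂(M.P₂ S n ω)

/-- `b̂'_{2,n}(δ, Δ_n)`. -/
def biasDer (S : Split) (n : ℕ) (ω : Ω) (δ : ℝ) : ℝ :=
  (M.psi₂ S n ω (δ + S.gap n) - M.psi₂ S n ω δ) / S.gap n

/-- `σ̂_{2,n}(δ)`. -/
def sigmaHat (S : Split) (n : ℕ) (ω : Ω) (δ : ℝ) : ℝ :=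
  sdGrad M.K M.x δ (M.P₂ S n ω) (M.init₁ S n ω)

/-- `σ̂'_{2,n}(δ, Δ_n)`. -/
def sigmaDer (S : Split) (n : ℕ) (ω : Ω) (δ : ℝ) : ℝ :=
  (M.sigmaHat S n ω (δ + S.gap n) - M.sigmaHat S n ω δ) / S.gap n

/-- The slope of `log |f|` against `log δ` between the first two pilot bandwidths. -/
def slope (T : Pilot) (n : ℕ) (f : ℝ → ℝ) : ℝ :=
  (Real.log |f (T.d₂ n)| - Real.log |f (T.d₁ n)|) / (Real.log (T.d₂ n) - Real.log (T.d₁ n))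

/-- `β̂_n`; the slope estimates the exponent `β₀ - 1` of `b₀'`. -/
def betaHat (S : Split) (T : Pilot) (n : ℕ) (ω : Ω) : ℝ := 1 + slope T n (M.biasDer S n ω)

/-- `γ̂_n`; the slope estimates the exponent `-γ` of `σ_∞`. -/
def gammaHat (S : Split) (T : Pilot) (n : ℕ) (ω : Ω) : ℝ := -slope T n (M.sigmaHat S n ω)

/-- `ν̂_n`; the slope estimates the exponent `ν` of `σ_∞'`. -/
def nuHat (S : Split) (T : Pilot) (n : ℕ) (ω : Ω) : ℝ := slope T n (M.sigmaDer S n ω)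

/-- `Ĉ_{b',n}`. -/
def cBias (S : Split) (T : Pilot) (n : ℕ) (ω : Ω) : ℝ :=
  M.biasDer S n ω (T.d₃ n) * T.d₃ n ^ (-(M.betaHat S T n ω - 1))

/-- `Ĉ_{σ,n}`. -/
def cSigma (S : Split) (T : Pilot) (n : ℕ) (ω : Ω) : ℝ :=
  M.sigmaHat S n ω (T.d₃ n) * T.d₃ n ^ M.gammaHat S T n ω

/-- `Ĉ_{σ',n}`. -/
def cSigmaDer (S : Split) (T : Pilot) (n : ℕ) (ω : Ω) : ℝ :=
  M.sigmaDer S n ω (T.d₃ n) * T.d₃ n ^ (-M.nuHat S T n ω)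

/-- `r̂_n = (2 β̂_n - 1 + γ̂_n - ν̂_n)⁻¹`. -/
def rHat (S : Split) (T : Pilot) (n : ℕ) (ω : Ω) : ℝ :=
  (2 * M.betaHat S T n ω - 1 + M.gammaHat S T n ω - M.nuHat S T n ω)⁻¹

/-- `Ĉ_n`. The absolute value is there since `Ĉ_{σ',n}` estimates a negative constant. -/
def cHat (S : Split) (T : Pilot) (n : ℕ) (ω : Ω) : ℝ :=
  (|M.cSigma S T n ω * M.cSigmaDer S T n ω * M.betaHat S T n ω| / M.cBias S T n ω ^ 2) ^
    M.rHat S T n ω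

/-- The selected bandwidth `δ̂_{ε,n} = Ĉ_n (l_{3,n} - l_{2,n})^{-r̂_n - ε}`. -/
def deltaHat (S : Split) (T : Pilot) (ε : ℝ) (n : ℕ) (ω : Ω) : ℝ :=
  M.cHat S T n ω * S.m₃ n ^ (-M.rHat S T n ω - ε)

/-- The cross-validated one-step estimator `Ψ̂_n(δ) = Ψ_δ(P̂_{2,n}) + P_{3,n} D*_δ(P̂_{2,n})`. -/
def psiHat (S : Split) (n : ℕ) (δ : ℝ) (ω : Ω) : ℝ :=
  smoothed M.K M.x δ (M.init₂ S n ω) + ∫ o, grad M.K M.x δ (M.init₂ S n ω) o ∂(M.P₃ S n ω)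

/-- The studentized estimator
`Ĉ_{σ,n}⁻¹ δ̂_{ε,n}^{γ̂_n} (l_{3,n} - l_{2,n})^{1/2} (Ψ̂_n(δ̂_{ε,n}) - Ψ(P₀))`. -/
def studentized (S : Split) (T : Pilot) (ε : ℝ) (n : ℕ) (ω : Ω) : ℝ :=
  (M.cSigma S T n ω)⁻¹ * M.deltaHat S T ε n ω ^ M.gammaHat S T n ω * √(S.m₃ n) *
    (M.psiHat S n (M.deltaHat S T ε n ω) ω - M.target)

/-- The `t`-quantile of the standard normal distribution. -/
def normalQuantile (t : ℝ) : ℝ := sInf {q : ℝ | t ≤ cdf (gaussianReal 0 1) q}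

/-- The half-width of the confidence interval. -/
def halfWidth (S : Split) (T : Pilot) (α ε : ℝ) (n : ℕ) (ω : Ω) : ℝ :=
  normalQuantile (1 - α / 2) *
    (M.cSigma S T n ω / S.m₃ n ^ (1 / 2 - (M.rHat S T n ω + ε) * M.gammaHat S T n ω))

/-- The confidence interval `CI'_{α,ε,n}`, centred at `Ψ̂_n(δ̂_{0,n})`. -/
def confInt (S : Split) (T : Pilot) (α ε : ℝ) (n : ℕ) (ω : Ω) : Set ℝ :=
  Icc (M.psiHat S n (M.deltaHat S T 0 n ω) ω - M.halfWidth S T α ε n ω)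
    (M.psiHat S n (M.deltaHat S T 0 n ω) ω + M.halfWidth S T α ε n ω)

/-! ### Mean squared error and optimal smoothing levels -/

/-- `MSE_n(δ) = E[(Ψ̂_n(δ) - Ψ(P₀))²]`, a deterministic function of `δ`. -/
def mse [MeasurableSpace Ω] (μ : Measure Ω) (S : Split) (n : ℕ) (δ : ℝ) : ℝ :=
  ∫ ω, (M.psiHat S n δ ω - M.target) ^ 2 ∂μ

/-- The full-sample approximation `n⁻¹ σ₀²(δ) + b₀(δ)²` of the mean squared error, where
`σ₀²(δ)` is the variance under `P₀` of `D*_δ(P₀)`. -/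
def fullMse (n : ℕ) (δ : ℝ) : ℝ := M.sigmaInf δ ^ 2 / n + M.bias δ ^ 2

end Model

/-- `d` is a positive sequence tending to zero along which the derivative of the criterion `Q n`
vanishes. -/
structure IsStationary (Q : ℕ → ℝ → ℝ) (d : ℕ → ℝ) : Prop where
  pos : ∀ᶠ n in atTop, 0 < d n
  tendsto_zero : Tendsto d atTop (𝓝 0)
  hasDerivAt : ∀ᶠ n in atTop, HasDerivAt (Q n) 0 (d n)

/-- `d` is a stationary sequence that minimizes the criterion over all small bandwidths. -/
def IsOptimal (Q : ℕ → ℝ → ℝ) (d : ℕ → ℝ) : Prop :=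
  IsStationary Q d ∧
    ∃ b : ℝ, 0 < b ∧ ∀ᶠ n in atTop, d n ∈ Ioc 0 b ∧ IsMinOn (Q n) (Ioc 0 b) (d n)

namespace Model

/-! ### The assumptions -/

variable {Ω : Type*} (M : Model Ω)

/-- Assumption A1: polynomial behaviour of `σ_∞`, `σ_∞'`, `b₀'` and of the variance of
`H_{0,δ,∞}` as `δ ↓ 0`. -/
def A1 : Prop :=
  (∀ᶠ δ in 𝓝[>] (0 : ℝ),
    DifferentiableAt ℝ M.sigmaInf δ ∧ DifferentiableAt ℝ (deriv M.sigmaInf) δ ∧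
    DifferentiableAt ℝ M.bias δ ∧ DifferentiableAt ℝ (deriv M.bias) δ) ∧
  (∃ Cb Cσ Cσ' CH β γ ν η : ℝ, Cb ≠ 0 ∧ Cσ ≠ 0 ∧ Cσ' ≠ 0 ∧ CH ≠ 0 ∧ 0 ≤ β ∧ 0 ≤ γ ∧ 0 < η ∧
    M.sigmaInf ~[𝓝[>] 0] (fun δ => Cσ * δ ^ (-γ)) ∧
    deriv M.sigmaInf ~[𝓝[>] 0] (fun δ => Cσ' * δ ^ ν) ∧
    deriv M.bias ~[𝓝[>] 0] (fun δ => Cb * δ ^ (β - 1)) ∧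
    (fun δ => varSqGrad M.K M.x δ M.P₀ M.P₀) ~[𝓝[>] 0] (fun δ => CH * δ ^ (-η))) ∧
  (∃ k₀ k₁ : ℝ, 0 < k₀ ∧ 0 < k₁ ∧
    deriv (deriv M.bias) =O[𝓝[>] 0] (fun δ => δ ^ (-k₀)) ∧
    deriv (deriv M.sigmaInf) =O[𝓝[>] 0] (fun δ => δ ^ (-k₁)))

variable [MeasurableSpace Ω] (μ : Measure Ω) (S : Split)

/-- Assumption A2. The last clause says that `σ_{1,n}` has a first and a second derivative at
`δ̃_n` whenever `σ_∞` has, so that the preceding ones are about genuine derivatives there. -/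
def A2 : Prop :=
  ∃ r k₂ k₂' κ₂ κ₂' : ℝ, 0 < r ∧ 0 < k₂ ∧ 0 < k₂' ∧ 0 < κ₂ ∧ 0 < κ₂' ∧
    ∀ d : ℕ → ℝ, SlowerThan r d →
      IsBigOP μ (fun n ω => M.sigma₁ S n ω (d n) - M.sigmaInf (d n))
        (fun n => d n ^ (-k₂) * S.m₂ n ^ (-κ₂)) ∧
      IsBigOP μ (fun n ω => deriv (M.sigma₁ S n ω) (d n) - deriv M.sigmaInf (d n))
        (fun n => d n ^ (-k₂') * S.m₂ n ^ (-κ₂')) ∧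
      IsEquivP μ (fun n ω => deriv (deriv (M.sigma₁ S n ω)) (d n))
        (fun n => deriv (deriv M.sigmaInf) (d n)) ∧
      ∀ᶠ n in atTop, ∀ᵐ ω ∂μ,
        (DifferentiableAt ℝ M.sigmaInf (d n) → DifferentiableAt ℝ (M.sigma₁ S n ω) (d n)) ∧
        (DifferentiableAt ℝ (deriv M.sigmaInf) (d n) →
          DifferentiableAt ℝ (deriv (M.sigma₁ S n ω)) (d n))

/-- Assumption A3. -/
def A3 : Prop :=
  ∃ r : ℝ, 0 < r ∧ ∀ d : ℕ → ℝ, SlowerThan r d →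
    IsLittleOP μ (fun n ω => M.rem₁ S n ω (d n)) (fun n => M.sigmaInf (d n))

/-- Assumption A4. -/
def A4 : Prop :=
  ∃ r : ℝ, 0 < r ∧ ∀ d : ℕ → ℝ, SlowerThan r d →
    IsEquivP μ (fun n ω => varSqGrad M.K M.x (d n) M.P₀ (M.init₁ S n ω))
      (fun n => varSqGrad M.K M.x (d n) M.P₀ M.P₀)

/-- Assumption A5. -/
def A5 : Prop :=
  ∃ k₃ κ₃ r : ℝ, 0 < k₃ ∧ 0 < κ₃ ∧ 0 < r ∧ ∀ d : ℕ → ℝ, SlowerThan r d →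
    (∀ᶠ n in atTop, ∀ᵐ ω ∂μ, DifferentiableAt ℝ (M.rem₁ S n ω) (d n)) ∧
    IsBigOP μ (fun n ω => deriv (M.rem₁ S n ω) (d n)) (fun n => d n ^ (-k₃) * S.m₂ n ^ (-κ₃))

/-- Assumption A6, for the rate `r₀`. -/
def A6 (r₀ : ℝ) : Prop :=
  ∀ᶠ r in 𝓝 r₀, IsEquivP μ (fun n ω => M.sigma₂ S n ω (S.m₃ n ^ (-r)))
    (fun n => M.sigmaInf (S.m₃ n ^ (-r)))

/-- Assumption A7, for the rate `r₀`. -/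
def A7 (r₀ : ℝ) : Prop :=
  ∀ᶠ r in 𝓝 r₀, IsLittleOP μ (fun n ω => M.rem₂ S n ω (S.m₃ n ^ (-r)))
    (fun n => (√(S.m₃ n))⁻¹ * M.sigmaInf (S.m₃ n ^ (-r)) + M.bias (S.m₃ n ^ (-r)))

/-- Assumption A8, for the rate `r₀`. -/
def A8 (r₀ : ℝ) : Prop :=
  ∀ᶠ r in 𝓝 r₀,
    (∀ᶠ n in atTop, ∀ᵐ ω ∂μ, DifferentiableAt ℝ (M.rem₂ S n ω) (S.m₃ n ^ (-r))) ∧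
    IsLittleOP μ (fun n ω => deriv (M.rem₂ S n ω) (S.m₃ n ^ (-r)))
      (fun n => (√(S.m₃ n))⁻¹ * deriv M.sigmaInf (S.m₃ n ^ (-r)) +
        deriv M.bias (S.m₃ n ^ (-r)))

/-- `D*_δ(P̂_{i,n}) → D*_{δ,∞}` in `L²(P₀)`, in probability, for `i = 1, 2` and every `δ > 0`. -/
def GradConverges : Prop :=
  ∀ δ : ℝ, 0 < δ →
    TendstoInMeasure μ
      (fun n ω => ∫ o, (grad M.K M.x δ (M.init₁ S n ω) o - M.gradInf δ o) ^ 2 ∂M.P₀)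
      atTop (fun _ => (0 : ℝ)) ∧
    TendstoInMeasure μ
      (fun n ω => ∫ o, (grad M.K M.x δ (M.init₂ S n ω) o - M.gradInf δ o) ^ 2 ∂M.P₀)
      atTop (fun _ => (0 : ℝ))

end Model

end

end DensityPoint

/-! The initial estimators enter only through additive constants. The gradient at `P` is the kernel
minus `P K_δ`, so centring it under another probability measure erases `P`. Hence the remainder
vanishes, `σ_{i,n} = σ_∞`, and A2–A8 are immediate (`IsKernel.grad_sub_integral`,
`IsKernel.remainder_eq_zero`). For the same reason `psiHat` is the kernel density estimator of the
third subsample, whose mean squared error is exactly `σ_∞²/m₃ + b₀²` (`mse_eq`).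

A1 then leaves little freedom (`exists_powerLaw`): continuity and positivity of the density at `x`
force `γ ≥ 1/2`, divergence of `σ_∞` forces `ν = -γ - 1`, and vanishing of the bias forces `β > 0`.
With `r = 1/(2(β+γ))`, the stationarity equation `σσ' + a b b' = 0` determines the limit of `a
d^{2(β+γ)}`, so every stationary bandwidth is equivalent to `c a^{-r}` with one explicit `c`
(`tendsto_of_isStationary`), and the rescaled risk converges (`tendsto_criterion`). For `a = m₃` the
limiting ratio is 1. For `a = n` the benchmark is off by the factor `(1-p₂)^r`, and the limiting
risk is strictly decreasing below `c`, whence a strictly decreasing ratio.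

The exponents are estimated by log-log slopes with error `o_P(1/log n)`: the numerator errs by
`o_P(1)` and the pilot bandwidths are separated by a multiple of `log n` on the log scale. Such
errors disappear in powers of bandwidths of polynomial size, so `δ̂_ε m₃^{r+ε} → c` in probability
(`tendsto_deltaHat`).

For the limit laws, bandwidth and scale depend on the first two subsamples only and can be frozen by
independence. The conditional characteristic function is then a power of that of one small bounded
summand, quantitatively close to a Gaussian one (`tendstoInDistribution_psiHat`). Undersmoothing by
`ε > 0` removes the bias in (a). In (c) the half-width exceeds the standard deviation by a factor of
order `m₃^{εγ}` up to `o_P(1)` corrections on the log scale, so the normalized error degenerates to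
0 and coverage tends to one. -/

namespace DensityPoint

/-! ### Convergence in probability as convergence along a filter, so that the usual limit calculus
applies. -/

section ProbFilter

variable {Ω : Type*} [MeasurableSpace Ω]

/-- The filter of the sequences of events whose probability tends to one. Convergence in
probability is convergence along this filter. -/
def probFilter (μ : Measure Ω) : Filter (ℕ × Ω) where
  sets := {E | Tendsto (fun n => μ {ω | (n, ω) ∉ E}) atTop (𝓝 0)}
  univ_sets := by simp
  sets_of_superset {E F} hE hEF :=
    tendsto_of_tendsto_of_tendsto_of_le_of_le tendsto_const_nhds hE (fun _ => zero_le)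
      fun n => measure_mono fun ω hω h => hω (hEF h)
  inter_sets {E F} hE hF := by
    have h : Tendsto (fun n => μ {ω | (n, ω) ∉ E} + μ {ω | (n, ω) ∉ F}) atTop (𝓝 (0 + 0)) :=
      Tendsto.add hE hF
    rw [add_zero] at h
    refine tendsto_of_tendsto_of_tendsto_of_le_of_le tendsto_const_nhds h (fun _ => zero_le)
      fun n => (measure_mono fun ω hω => ?_).trans (measure_union_le _ _)
    by_contra hc
    simp only [mem_union, mem_ofPred_eq, not_or, not_not] at hc
    exact hω ⟨hc.1, hc.2⟩

variable {μ : Measure Ω}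

theorem eventually_probFilter {p : ℕ → Ω → Prop} :
    (∀ᶠ q in probFilter μ, p q.1 q.2) ↔ Tendsto (fun n => μ {ω | ¬ p n ω}) atTop (𝓝 0) :=
  Iff.rfl

theorem tendsto_fst_probFilter : Tendsto Prod.fst (probFilter μ) atTop := by
  refine tendsto_atTop.2 fun N => ?_
  refine (eventually_probFilter (p := fun n _ => N ≤ n)).2 ?_
  refine tendsto_const_nhds.congr' ?_
  filter_upwards [eventually_ge_atTop N] with n hn
  simp [hn]

theorem tendsto_probFilter_iff {X : ℕ → Ω → ℝ} {c : ℝ} :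
    Tendsto (fun q : ℕ × Ω => X q.1 q.2) (probFilter μ) (𝓝 c) ↔
      TendstoInMeasure μ X atTop fun _ => c := by
  rw [tendstoInMeasure_iff_dist, Metric.tendsto_nhds]
  refine forall₂_congr fun ε _ => ?_
  rw [eventually_probFilter (p := fun n ω => dist (X n ω) c < ε)]
  simp only [not_lt]

/-- Bounded convergence in probability: every subsequence has an almost surely convergent further
subsequence, to which dominated convergence applies. Measurability is asked only for large `n`
because conditional characteristic functions are controlled only once the third subsample is
non-empty. -/
theorem tendsto_integral_probFilter [IsProbabilityMeasure μ] {Y : ℕ → Ω → ℂ} {c : ℂ} {B : ℝ}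
    (hm : ∀ᶠ n in atTop, AEStronglyMeasurable (Y n) μ) (hB : ∀ n ω, ‖Y n ω‖ ≤ B)
    (h : Tendsto (fun q : ℕ × Ω => Y q.1 q.2) (probFilter μ) (𝓝 c)) :
    Tendsto (fun n => ∫ ω, Y n ω ∂μ) atTop (𝓝 c) := by
  have hmeas : TendstoInMeasure μ Y atTop fun _ => c := by
    rw [tendstoInMeasure_iff_dist]
    intro ε hε
    have := (Metric.tendsto_nhds.1 h) ε hε
    rw [eventually_probFilter (p := fun n ω => dist (Y n ω) c < ε)] at this
    simpa only [not_lt] using this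
  refine tendsto_of_subseq_tendsto fun ns hns => ?_
  obtain ⟨ms, hmono, hms⟩ := (hmeas.comp hns).exists_seq_tendsto_ae
  refine ⟨ms, ?_⟩
  have := tendsto_integral_filter_of_dominated_convergence (μ := μ) (l := atTop)
    (F := fun k => Y (ns (ms k))) (f := fun _ => c) (fun _ => B)
    ((hns.comp hmono.tendsto_atTop).eventually hm)
    (Eventually.of_forall fun k => ae_of_all _ (hB _)) (integrable_const _) hms
  simpa using this

end ProbFilter

theorem integral_sq_sub_const {α : Type*} [MeasurableSpace α] {P : Measure α}
    [IsProbabilityMeasure P] {X : α → ℝ} (h1 : Integrable X P)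
    (h2 : Integrable (fun a => X a ^ 2) P) (t : ℝ) :
    ∫ a, (X a - t) ^ 2 ∂P = ∫ a, X a ^ 2 ∂P - 2 * t * ∫ a, X a ∂P + t ^ 2 := by
  have : ∀ a, (X a - t) ^ 2 = X a ^ 2 - 2 * t * X a + t ^ 2 := fun a => by ring
  simp only [this]
  rw [integral_add (f := fun a => X a ^ 2 - 2 * t * X a)
    (h2.sub (h1.const_mul _)) (integrable_const _), integral_sub h2 (h1.const_mul _),
    integral_const_mul]
  simp

/-! ### Kernel bounds and the cancellation of the initial estimator. -/

section Kernel

variable {K : ℝ → ℝ} {x δ : ℝ}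

theorem IsKernel.measurable_kerAt (hK : IsKernel K) (x : ℝ) :
    Measurable fun q : ℝ × ℝ => kerAt K x q.1 q.2 := by
  have := hK.continuous.measurable
  unfold kerAt
  fun_prop

theorem IsKernel.measurable_kerAt_right (hK : IsKernel K) (x δ : ℝ) :
    Measurable (kerAt K x δ) :=
  (hK.measurable_kerAt x).comp (measurable_const.prodMk measurable_id)

theorem IsKernel.exists_bound (hK : IsKernel K) :
    ∃ C : ℝ, 0 < C ∧ ∀ x δ o, |kerAt K x δ o| ≤ C / |δ| := by
  obtain ⟨C, hC⟩ := hK.bounded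
  refine ⟨max C 1, by positivity, fun x δ o => ?_⟩
  rw [kerAt, abs_mul, abs_inv, abs_of_nonneg (hK.nonneg _), inv_mul_eq_div]
  gcongr
  exact (hC _).trans (le_max_left _ _)

theorem IsKernel.integrable_kerAt (hK : IsKernel K) (x δ : ℝ) (P : Measure ℝ) [IsFiniteMeasure P] :
    Integrable (kerAt K x δ) P := by
  obtain ⟨C, -, hC⟩ := hK.exists_bound
  exact Integrable.of_bound (hK.measurable_kerAt_right x δ).aestronglyMeasurable (C / |δ|)
    (ae_of_all _ fun o => hC x δ o)

theorem IsKernel.integrable_kerAt_sq (hK : IsKernel K) (x δ : ℝ) (P : Measure ℝ)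
    [IsFiniteMeasure P] : Integrable (fun o => kerAt K x δ o ^ 2) P := by
  obtain ⟨C, -, hC⟩ := hK.exists_bound
  refine Integrable.of_bound ((hK.measurable_kerAt_right x δ).pow_const 2).aestronglyMeasurable
    ((C / |δ|) ^ 2) (ae_of_all _ fun o => ?_)
  rw [Real.norm_eq_abs, abs_pow]
  gcongr
  exact hC x δ o

/-- The source of all the simplifications: `P` contributes to the gradient a constant, which
centring removes. The right-hand side no longer depends on `P`. -/
theorem IsKernel.grad_sub_integral (hK : IsKernel K) (P Q : Measure ℝ) [IsProbabilityMeasure Q]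
    (o : ℝ) : grad K x δ P o - ∫ t, grad K x δ P t ∂Q = kerAt K x δ o - smoothed K x δ Q := by
  unfold grad
  rw [integral_sub (hK.integrable_kerAt x δ Q) (integrable_const _)]
  simp [smoothed]

theorem IsKernel.remainder_eq_zero (hK : IsKernel K) (P Q : Measure ℝ) [IsProbabilityMeasure Q] :
    remainder K x δ P Q = 0 := by
  unfold remainder grad
  rw [integral_sub (hK.integrable_kerAt x δ Q) (integrable_const _)]
  simp [smoothed]

theorem IsKernel.sdGrad_eq (hK : IsKernel K) (P Q : Measure ℝ) [IsProbabilityMeasure Q] :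
    sdGrad K x δ Q P = √(∫ o, (kerAt K x δ o - smoothed K x δ Q) ^ 2 ∂Q) := by
  simp only [sdGrad, hK.grad_sub_integral]

theorem IsKernel.sq_sdGrad (hK : IsKernel K) (P Q : Measure ℝ) [IsProbabilityMeasure Q] :
    sdGrad K x δ Q P ^ 2 = ∫ o, kerAt K x δ o ^ 2 ∂Q - smoothed K x δ Q ^ 2 := by
  rw [hK.sdGrad_eq, Real.sq_sqrt (integral_nonneg fun _ => sq_nonneg _)]
  rw [integral_sq_sub_const (hK.integrable_kerAt x δ Q) (hK.integrable_kerAt_sq x δ Q), smoothed]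
  ring

theorem IsKernel.varSqGrad_eq (hK : IsKernel K) (P P' Q : Measure ℝ) [IsProbabilityMeasure Q] :
    varSqGrad K x δ Q P = varSqGrad K x δ Q P' := by
  simp only [varSqGrad, sqGrad, hK.grad_sub_integral]

end Kernel

/-! ### Empirical measures of i.i.d. blocks: moments, Chebyshev, law of large numbers. -/

section Empirical

variable {Ω : Type*} {O : ℕ → Ω → ℝ} {a b : ℕ}

theorem integral_empirical (O : ℕ → Ω → ℝ) (a b : ℕ) (ω : Ω) (f : ℝ → ℝ) :
    ∫ o, f o ∂(empirical O a b ω) = ((b - a : ℕ) : ℝ)⁻¹ * ∑ i ∈ Finset.Ico a b, f (O i ω) := by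
  unfold empirical
  rw [integral_smul_measure, integral_finsetSum_measure]
  · simp only [integral_dirac, smul_eq_mul, ENNReal.toReal_inv, ENNReal.toReal_natCast]
  · intro i _
    exact integrable_dirac (by simp)

theorem isProbabilityMeasure_empirical (h : a < b) (ω : Ω) :
    IsProbabilityMeasure (empirical O a b ω) := by
  constructor
  simp only [empirical, Measure.smul_apply, Measure.finsetSum_apply, measure_univ,
    Finset.sum_const, Nat.card_Ico, smul_eq_mul, nsmul_eq_mul, mul_one]
  refine ENNReal.inv_mul_cancel ?_ (by simp)
  simp only [ne_eq, Nat.cast_eq_zero]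
  omega

end Empirical

/-- The observations form an i.i.d. sample from the law with the density of the model. -/
structure Model.IsSampled {Ω : Type*} [MeasurableSpace Ω] (M : Model Ω) (μ : Measure Ω) :
    Prop where
  isKernel : IsKernel M.K
  isDensity : IsDensity M.p₀
  measurable : ∀ i, Measurable (M.O i)
  indep : iIndepFun M.O μ
  map_eq : ∀ i, μ.map (M.O i) = M.P₀

namespace Model.IsSampled

variable {Ω : Type*} [MeasurableSpace Ω] {M : Model Ω} {μ : Measure Ω}

theorem isProb (hM : M.IsSampled μ) : IsProbabilityMeasure M.P₀ :=
  hM.isDensity.isProbabilityMeasure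

theorem integral_comp (hM : M.IsSampled μ) {f : ℝ → ℝ} (hf : Measurable f) (i : ℕ) :
    ∫ ω, f (M.O i ω) ∂μ = ∫ o, f o ∂M.P₀ := by
  rw [← hM.map_eq i, integral_map (hM.measurable i).aemeasurable hf.aestronglyMeasurable]

theorem memLp_comp [IsProbabilityMeasure μ] (hM : M.IsSampled μ) {f : ℝ → ℝ} (hf : Measurable f)
    {B : ℝ} (hB : ∀ o, |f o| ≤ B) (i : ℕ) : MemLp (fun ω => f (M.O i ω)) 2 μ :=
  MemLp.of_bound (hf.comp (hM.measurable i)).aestronglyMeasurable B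
    (ae_of_all _ fun _ => hB _)

theorem memLp_empirical [IsProbabilityMeasure μ] (hM : M.IsSampled μ) {f : ℝ → ℝ}
    (hf : Measurable f) {B : ℝ} (hB : ∀ o, |f o| ≤ B) (a b : ℕ) :
    MemLp (fun ω => ∫ o, f o ∂(empirical M.O a b ω)) 2 μ := by
  simp only [integral_empirical]
  exact (memLp_finsetSum _ fun i _ => hM.memLp_comp hf hB i).const_mul _

theorem integral_integral_empirical [IsProbabilityMeasure μ] (hM : M.IsSampled μ) {f : ℝ → ℝ}
    (hf : Measurable f) {B : ℝ} (hB : ∀ o, |f o| ≤ B) {a b : ℕ} (hab : a < b) :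
    ∫ ω, ∫ o, f o ∂(empirical M.O a b ω) ∂μ = ∫ o, f o ∂M.P₀ := by
  simp only [integral_empirical]
  rw [integral_const_mul, integral_finsetSum _ fun i _ =>
    (hM.memLp_comp hf hB i).integrable (by norm_num)]
  simp only [hM.integral_comp hf, Finset.sum_const, Nat.card_Ico, nsmul_eq_mul]
  rw [inv_mul_cancel_left₀]
  simp only [ne_eq, Nat.cast_eq_zero]
  omega

theorem variance_empirical [IsProbabilityMeasure μ] (hM : M.IsSampled μ) {f : ℝ → ℝ}
    (hf : Measurable f) {B : ℝ} (hB : ∀ o, |f o| ≤ B) {a b : ℕ} (hab : a < b) :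
    Var[fun ω => ∫ o, f o ∂(empirical M.O a b ω); μ] =
      (∫ o, f o ^ 2 ∂M.P₀ - (∫ o, f o ∂M.P₀) ^ 2) / (b - a : ℕ) := by
  simp only [integral_empirical]
  rw [variance_const_mul]
  have h1 : (fun ω => ∑ i ∈ Finset.Ico a b, f (M.O i ω)) =
      ∑ i ∈ Finset.Ico a b, fun ω => f (M.O i ω) := by
    ext ω; simp
  rw [h1, IndepFun.variance_sum (fun i _ => hM.memLp_comp hf hB i)]
  · have h2 : ∀ i, Var[fun ω => f (M.O i ω); μ] =
        ∫ o, f o ^ 2 ∂M.P₀ - (∫ o, f o ∂M.P₀) ^ 2 := by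
      intro i
      rw [variance_eq_sub (hM.memLp_comp hf hB i), hM.integral_comp hf,
        ← hM.integral_comp (hf.pow_const 2) i]
      rfl
    simp only [h2, Finset.sum_const, Nat.card_Ico, nsmul_eq_mul]
    have : ((b - a : ℕ) : ℝ) ≠ 0 := by
      simp only [ne_eq, Nat.cast_eq_zero]
      omega
    field_simp
  · intro i _ j _ hij
    exact (hM.indep.indepFun hij).comp hf hf

/-- Chebyshev's inequality for the empirical mean of a bounded function. -/
theorem measure_empirical_le [IsProbabilityMeasure μ] (hM : M.IsSampled μ) {f : ℝ → ℝ}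
    (hf : Measurable f) {B : ℝ} (hB : ∀ o, |f o| ≤ B) {a b : ℕ} (hab : a < b) {c : ℝ}
    (hc : 0 < c) :
    μ {ω | c ≤ |∫ o, f o ∂(empirical M.O a b ω) - ∫ o, f o ∂M.P₀|} ≤
      ENNReal.ofReal (B ^ 2 / (b - a : ℕ) / c ^ 2) := by
  have h := meas_ge_le_variance_div_sq (hM.memLp_empirical hf hB a b) hc
  rw [hM.integral_integral_empirical hf hB hab, hM.variance_empirical hf hB hab] at h
  refine h.trans (ENNReal.ofReal_le_ofReal ?_)
  have := hM.isProb
  gcongr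
  refine (sub_le_self _ (sq_nonneg _)).trans ?_
  have h2 : ∫ o, f o ^ 2 ∂M.P₀ ≤ ∫ _, B ^ 2 ∂M.P₀ := by
    refine integral_mono_of_nonneg (ae_of_all _ fun _ => sq_nonneg _) (integrable_const _)
      (ae_of_all _ fun o => ?_)
    exact sq_le_sq' (by linarith [neg_abs_le (f o), hB o]) ((le_abs_self _).trans (hB o))
  simpa using h2

/-- The law of large numbers for empirical means of varying bounded functions. -/
theorem tendsto_empirical [IsProbabilityMeasure μ] (hM : M.IsSampled μ) {f : ℕ → ℝ → ℝ}
    {B w : ℕ → ℝ} {a b : ℕ → ℕ} (hf : ∀ n, Measurable (f n)) (hB : ∀ n o, |f n o| ≤ B n)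
    (hab : ∀ᶠ n in atTop, a n < b n)
    (h : Tendsto (fun n => (w n * B n) ^ 2 / (b n - a n : ℕ)) atTop (𝓝 0)) :
    Tendsto (fun q : ℕ × Ω => w q.1 * (∫ o, f q.1 o ∂(empirical M.O (a q.1) (b q.1) q.2) -
      ∫ o, f q.1 o ∂M.P₀)) (probFilter μ) (𝓝 0) := by
  rw [tendsto_probFilter_iff (X := fun n ω => w n * (∫ o, f n o ∂(empirical M.O (a n) (b n) ω) -
      ∫ o, f n o ∂M.P₀)), tendstoInMeasure_iff_norm]
  intro ε hε
  have h0 : Tendsto (fun n => ENNReal.ofReal ((w n * B n) ^ 2 / (b n - a n : ℕ) / ε ^ 2)) atTop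
      (𝓝 0) := by
    simpa using ENNReal.tendsto_ofReal (h.div_const (ε ^ 2))
  refine tendsto_of_tendsto_of_tendsto_of_le_of_le' tendsto_const_nhds h0
    (Eventually.of_forall fun _ => zero_le) ?_
  filter_upwards [hab] with n hn
  -- Chebyshev is applied at level `ε / |w n|`, so a vanishing weight is treated apart.
  rcases eq_or_ne (w n) 0 with hw | hw
  · simp [hw, hε.not_ge]
  · have hw' : 0 < |w n| := abs_pos.2 hw
    refine le_trans (le_of_eq ?_) ((hM.measure_empirical_le (hf n) (hB n) hn
      (div_pos hε hw')).trans (ENNReal.ofReal_le_ofReal (le_of_eq ?_)))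
    · congr 1
      ext ω
      simp only [mem_ofPred_eq, sub_zero, Real.norm_eq_abs, abs_mul]
      rw [div_le_iff₀' hw']
    · rw [div_pow, sq_abs]
      field_simp

end Model.IsSampled

/-! ### Subsample sizes are proportional to `n`. -/

namespace Split

variable (S : Split)

theorem l₁_le_l₂ (n : ℕ) : S.l₁ n ≤ S.l₂ n :=
  Nat.floor_mono (mul_le_mul_of_nonneg_right S.lt.le n.cast_nonneg)

theorem l₂_le (n : ℕ) : S.l₂ n ≤ n := by
  refine Nat.floor_le_of_le ?_
  nlinarith [S.lt_one, (n.cast_nonneg : (0 : ℝ) ≤ n)]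

theorem m₂_eq (n : ℕ) : S.m₂ n = (S.l₂ n - S.l₁ n : ℕ) := by
  rw [m₂, Nat.cast_sub (S.l₁_le_l₂ n)]

theorem m₃_eq (n : ℕ) : S.m₃ n = (n - S.l₂ n : ℕ) := by
  rw [m₃, Nat.cast_sub (S.l₂_le n)]

theorem tendsto_m₂_div : Tendsto (fun n : ℕ => S.m₂ n / n) atTop (𝓝 (S.p₂ - S.p₁)) := by
  have h2 := (tendsto_nat_floor_mul_div_atTop (R := ℝ) (S.pos.trans S.lt).le).comp
    (tendsto_natCast_atTop_atTop (R := ℝ))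
  have h1 := (tendsto_nat_floor_mul_div_atTop (R := ℝ) S.pos.le).comp
    (tendsto_natCast_atTop_atTop (R := ℝ))
  refine (h2.sub h1).congr fun n => ?_
  simp [m₂, l₁, l₂, sub_div]

theorem tendsto_m₃_div : Tendsto (fun n : ℕ => S.m₃ n / n) atTop (𝓝 (1 - S.p₂)) := by
  have h2 := (tendsto_nat_floor_mul_div_atTop (R := ℝ) (S.pos.trans S.lt).le).comp
    (tendsto_natCast_atTop_atTop (R := ℝ))
  refine (tendsto_const_nhds.sub h2).congr' ?_
  filter_upwards [eventually_gt_atTop 0] with n hn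
  have : (n : ℝ) ≠ 0 := by positivity
  simp [m₃, l₂, sub_div, this]

theorem tendsto_m₂ : Tendsto S.m₂ atTop atTop := by
  have h := S.tendsto_m₂_div.pos_mul_atTop (sub_pos.2 S.lt) (tendsto_natCast_atTop_atTop (R := ℝ))
  refine h.congr' ?_
  filter_upwards [eventually_gt_atTop 0] with n hn
  field_simp

theorem tendsto_m₃ : Tendsto S.m₃ atTop atTop := by
  have h := S.tendsto_m₃_div.pos_mul_atTop (sub_pos.2 S.lt_one)
    (tendsto_natCast_atTop_atTop (R := ℝ))
  refine h.congr' ?_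
  filter_upwards [eventually_gt_atTop 0] with n hn
  field_simp

theorem eventually_l₁_lt_l₂ : ∀ᶠ n in atTop, S.l₁ n < S.l₂ n := by
  filter_upwards [S.tendsto_m₂.eventually_gt_atTop 0] with n hn
  exact_mod_cast sub_pos.1 hn

theorem eventually_l₂_lt : ∀ᶠ n in atTop, S.l₂ n < n := by
  filter_upwards [S.tendsto_m₃.eventually_gt_atTop 0] with n hn
  exact_mod_cast sub_pos.1 hn

end Split

/-- A one-step correction of a linear functional reproduces the plug-in at the averaging measure,
whatever the initial estimator. This identifies `psi₂` and `psiHat` with plain kernel density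
estimators. -/
theorem IsKernel.smoothed_add_integral_grad {K : ℝ → ℝ} {x δ : ℝ} (hK : IsKernel K)
    (P Q : Measure ℝ) [IsProbabilityMeasure Q] :
    smoothed K x δ P + ∫ o, grad K x δ P o ∂Q = smoothed K x δ Q := by
  have := hK.remainder_eq_zero (x := x) (δ := δ) P Q
  unfold remainder at this
  linarith

/-! ### Verification of A2–A8, convergence of the gradients, and the exact mean squared error. -/

namespace Model

variable {Ω : Type*} {M : Model Ω}

theorem isBigOP_zero [MeasurableSpace Ω] (μ : Measure Ω) (a : ℕ → ℝ) :
    IsBigOP μ (fun _ _ => 0) a := fun η _ => ⟨0, by simp⟩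

theorem isLittleOP_zero [MeasurableSpace Ω] (μ : Measure Ω) (a : ℕ → ℝ) :
    IsLittleOP μ (fun _ _ => 0) a := fun c hc => by
  have : ∀ n, ¬ c * |a n| < 0 := fun n => not_lt.2 (by positivity)
  simp [this]

namespace IsSampled

variable [MeasurableSpace Ω] {μ : Measure Ω}

theorem sdGrad_eq_sigmaInf (hM : M.IsSampled μ) (P : Measure ℝ) (δ : ℝ) :
    sdGrad M.K M.x δ M.P₀ P = M.sigmaInf δ := by
  have := hM.isProb
  rw [sigmaInf, hM.isKernel.sdGrad_eq, hM.isKernel.sdGrad_eq]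

theorem sigma₁_eq (hM : M.IsSampled μ) (S : Split) (n : ℕ) (ω : Ω) :
    M.sigma₁ S n ω = M.sigmaInf := funext fun _ => hM.sdGrad_eq_sigmaInf _ _

theorem sigma₂_eq (hM : M.IsSampled μ) (S : Split) (n : ℕ) (ω : Ω) :
    M.sigma₂ S n ω = M.sigmaInf := funext fun _ => hM.sdGrad_eq_sigmaInf _ _

theorem rem₁_eq (hM : M.IsSampled μ) (S : Split) (n : ℕ) (ω : Ω) : M.rem₁ S n ω = fun _ => 0 := by
  have := hM.isProb
  exact funext fun _ => hM.isKernel.remainder_eq_zero _ _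

theorem rem₂_eq (hM : M.IsSampled μ) (S : Split) (n : ℕ) (ω : Ω) : M.rem₂ S n ω = fun _ => 0 := by
  have := hM.isProb
  exact funext fun _ => hM.isKernel.remainder_eq_zero _ _

theorem a2 (hM : M.IsSampled μ) (S : Split) : M.A2 μ S := by
  refine ⟨1, 1, 1, 1, 1, one_pos, one_pos, one_pos, one_pos, one_pos, fun d _ => ?_⟩
  simp only [hM.sigma₁_eq, IsEquivP, sub_self]
  exact ⟨isBigOP_zero _ _, isBigOP_zero _ _, isLittleOP_zero _ _, by simp⟩

theorem a3 (hM : M.IsSampled μ) (S : Split) : M.A3 μ S := by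
  refine ⟨1, one_pos, fun d _ => ?_⟩
  simp only [hM.rem₁_eq]
  exact isLittleOP_zero _ _

theorem a4 (hM : M.IsSampled μ) (S : Split) : M.A4 μ S := by
  have := hM.isProb
  refine ⟨1, one_pos, fun d _ => ?_⟩
  have h : ∀ n ω, varSqGrad M.K M.x (d n) M.P₀ (M.init₁ S n ω) =
    varSqGrad M.K M.x (d n) M.P₀ M.P₀ := fun n ω => hM.isKernel.varSqGrad_eq _ _ _
  simp only [IsEquivP, h, sub_self]
  exact isLittleOP_zero _ _

theorem a5 (hM : M.IsSampled μ) (S : Split) : M.A5 μ S := by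
  refine ⟨1, 1, 1, one_pos, one_pos, one_pos, fun d _ => ?_⟩
  simp only [hM.rem₁_eq, deriv_const, differentiableAt_const]
  exact ⟨by simp, isBigOP_zero _ _⟩

theorem a6 (hM : M.IsSampled μ) (S : Split) (r₀ : ℝ) : M.A6 μ S r₀ := by
  refine Eventually.of_forall fun r => ?_
  simp only [hM.sigma₂_eq, IsEquivP, sub_self]
  exact isLittleOP_zero _ _

theorem a7 (hM : M.IsSampled μ) (S : Split) (r₀ : ℝ) : M.A7 μ S r₀ := by
  refine Eventually.of_forall fun r => ?_
  simp only [hM.rem₂_eq]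
  exact isLittleOP_zero _ _

theorem a8 (hM : M.IsSampled μ) (S : Split) (r₀ : ℝ) : M.A8 μ S r₀ := by
  refine Eventually.of_forall fun r => ?_
  simp only [hM.rem₂_eq, deriv_const, differentiableAt_const]
  exact ⟨by simp, isLittleOP_zero _ _⟩

/-- The two gradients differ by a constant in `o`, so the squared `L²(P₀)` distance is the square of
one centred empirical mean. -/
theorem tendsto_integral_sq_grad [IsProbabilityMeasure μ] (hM : M.IsSampled μ) (δ : ℝ)
    {a b : ℕ → ℕ} (hab : ∀ᶠ n in atTop, a n < b n)
    (h : Tendsto (fun n => ((b n - a n : ℕ) : ℝ)) atTop atTop) :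
    TendstoInMeasure μ
      (fun n ω => ∫ o, (grad M.K M.x δ (empirical M.O (a n) (b n) ω) o - M.gradInf δ o) ^ 2 ∂M.P₀)
      atTop (fun _ => (0 : ℝ)) := by
  have := hM.isProb
  obtain ⟨C, -, hC⟩ := hM.isKernel.exists_bound
  have h1 := (hM.tendsto_empirical (f := fun _ => kerAt M.K M.x δ) (B := fun _ => C / |δ|)
    (w := fun _ => 1) (fun _ => hM.isKernel.measurable_kerAt_right _ _) (fun _ => hC _ _) hab
    (tendsto_const_nhds.div_atTop h)).pow 2
  rw [← tendsto_probFilter_iff]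
  refine (zero_pow two_ne_zero (M₀ := ℝ) ▸ h1).congr fun q => ?_
  have h2 : ∀ o, grad M.K M.x δ (empirical M.O (a q.1) (b q.1) q.2) o - M.gradInf δ o =
      smoothed M.K M.x δ M.P₀ - smoothed M.K M.x δ (empirical M.O (a q.1) (b q.1) q.2) :=
    fun o => by simp only [gradInf, grad]; ring
  simp only [h2, integral_const, probReal_univ, one_smul, smoothed]
  ring

theorem gradConverges [IsProbabilityMeasure μ] (hM : M.IsSampled μ) (S : Split) :
    M.GradConverges μ S := by
  intro δ _
  constructor
  · refine hM.tendsto_integral_sq_grad δ (a := fun _ => 0) (b := S.l₁) ?_ ?_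
    · have := (tendsto_nat_floor_atTop (α := ℝ)).comp
        ((tendsto_natCast_atTop_atTop (R := ℝ)).const_mul_atTop S.pos)
      exact this.eventually_gt_atTop 0
    · simp only [tsub_zero]
      exact tendsto_natCast_atTop_atTop.comp ((tendsto_nat_floor_atTop (α := ℝ)).comp
        ((tendsto_natCast_atTop_atTop (R := ℝ)).const_mul_atTop S.pos))
  · refine hM.tendsto_integral_sq_grad δ (a := S.l₁) (b := S.l₂) S.eventually_l₁_lt_l₂ ?_
    exact S.tendsto_m₂.congr S.m₂_eq

theorem psi₂_eq (hM : M.IsSampled μ) {S : Split} {n : ℕ} (h : S.l₁ n < S.l₂ n) (ω : Ω) (δ : ℝ) :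
    M.psi₂ S n ω δ = smoothed M.K M.x δ (M.P₂ S n ω) := by
  have : IsProbabilityMeasure (M.P₂ S n ω) := isProbabilityMeasure_empirical h ω
  exact hM.isKernel.smoothed_add_integral_grad _ _

theorem psiHat_eq (hM : M.IsSampled μ) {S : Split} {n : ℕ} (h : S.l₂ n < n) (ω : Ω) (δ : ℝ) :
    M.psiHat S n δ ω = smoothed M.K M.x δ (M.P₃ S n ω) := by
  have : IsProbabilityMeasure (M.P₃ S n ω) := isProbabilityMeasure_empirical h ω
  exact hM.isKernel.smoothed_add_integral_grad _ _

theorem sq_sigmaHat (hM : M.IsSampled μ) {S : Split} {n : ℕ} (h : S.l₁ n < S.l₂ n) (ω : Ω)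
    (δ : ℝ) : M.sigmaHat S n ω δ ^ 2 =
      ∫ o, kerAt M.K M.x δ o ^ 2 ∂(M.P₂ S n ω) - smoothed M.K M.x δ (M.P₂ S n ω) ^ 2 := by
  have : IsProbabilityMeasure (M.P₂ S n ω) := isProbabilityMeasure_empirical h ω
  exact hM.isKernel.sq_sdGrad _ _

theorem sq_sigmaInf (hM : M.IsSampled μ) (δ : ℝ) : M.sigmaInf δ ^ 2 =
      ∫ o, kerAt M.K M.x δ o ^ 2 ∂M.P₀ - smoothed M.K M.x δ M.P₀ ^ 2 := by
  have := hM.isProb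
  exact hM.isKernel.sq_sdGrad _ _

/-- Bias-variance decomposition of a mean of i.i.d. bounded variables. The identity is exact, so the
optimization in `δ` is a deterministic problem. -/
theorem mse_eq [IsProbabilityMeasure μ] (hM : M.IsSampled μ) {S : Split} {n : ℕ} (h : S.l₂ n < n) :
    M.mse μ S n = fun δ => M.sigmaInf δ ^ 2 / S.m₃ n + M.bias δ ^ 2 := by
  ext δ
  obtain ⟨C, -, hC⟩ := hM.isKernel.exists_bound
  have hm := hM.isKernel.measurable_kerAt_right M.x δ
  have hL := hM.memLp_empirical hm (hC M.x δ) (S.l₂ n) n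
  have hE := hM.integral_integral_empirical hm (hC M.x δ) h
  have hV := hM.variance_empirical hm (hC M.x δ) h
  simp only [mse, hM.psiHat_eq h]
  rw [variance_eq_sub hL, hE] at hV
  have h1 := hL.integrable_sq
  have h2 := hL.integrable one_le_two
  rw [hM.sq_sigmaInf, S.m₃_eq, bias]
  simp only [P₃, smoothed] at *
  rw [← hV, integral_sq_sub_const h2 h1, hE]
  simp only [Pi.pow_apply]
  ring

end IsSampled

end Model

/-! ### Power laws at `0+` and what they force on derivatives. -/

theorem eventually_nhdsGT_pos : ∀ᶠ δ in 𝓝[>] (0 : ℝ), 0 < δ := self_mem_nhdsWithin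

theorem tendsto_rpow_nhdsGT_zero {s : ℝ} (hs : 0 < s) :
    Tendsto (fun δ : ℝ => δ ^ s) (𝓝[>] 0) (𝓝 0) := by
  have := (Real.continuousAt_rpow_const 0 s (Or.inr hs.le)).tendsto
  rw [Real.zero_rpow hs.ne'] at this
  exact this.mono_left nhdsWithin_le_nhds

theorem eq_zero_of_tendsto_rpow {s c : ℝ} (hc : c ≠ 0)
    (h : Tendsto (fun δ : ℝ => δ ^ s) (𝓝[>] 0) (𝓝 c)) : s = 0 := by
  rcases lt_trichotomy s 0 with hs | hs | hs
  · have h1 := h.mul (tendsto_rpow_nhdsGT_zero (neg_pos.2 hs))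
    rw [mul_zero] at h1
    have h2 : (fun δ : ℝ => δ ^ s * δ ^ (-s)) =ᶠ[𝓝[>] 0] fun _ => 1 := by
      filter_upwards [eventually_nhdsGT_pos] with δ hδ
      rw [← Real.rpow_add hδ]
      simp
    exact absurd (tendsto_nhds_unique (tendsto_const_nhds.congr' h2.symm) h1) one_ne_zero
  · exact hs
  · exact absurd (tendsto_nhds_unique h (tendsto_rpow_nhdsGT_zero hs)) hc

theorem tendsto_mul_rpow_of_isEquivalent {f : ℝ → ℝ} {C a : ℝ}
    (h : f ~[𝓝[>] 0] fun δ => C * δ ^ a) :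
    Tendsto (fun δ => f δ * δ ^ (-a)) (𝓝[>] 0) (𝓝 C) := by
  have h1 : (fun δ => f δ * δ ^ (-a)) ~[𝓝[>] 0] fun δ => C * δ ^ a * δ ^ (-a) :=
    h.mul IsEquivalent.refl
  have h2 : (fun δ : ℝ => C * δ ^ a * δ ^ (-a)) =ᶠ[𝓝[>] 0] fun _ => C := by
    filter_upwards [eventually_nhdsGT_pos] with δ hδ
    rw [mul_assoc, ← Real.rpow_add hδ]
    simp
  exact (h1.congr_right h2).symm.tendsto_nhds tendsto_const_nhds

/-- A function vanishing at `0+` whose derivative follows a power law follows a power law, and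
the exponent is positive. -/
theorem pos_of_tendsto_deriv_mul_rpow {b : ℝ → ℝ} {C s : ℝ} (hC : C ≠ 0)
    (hd : ∀ᶠ δ in 𝓝[>] (0 : ℝ), DifferentiableAt ℝ b δ) (h0 : Tendsto b (𝓝[>] 0) (𝓝 0))
    (h' : Tendsto (fun δ => deriv b δ * δ ^ (1 - s)) (𝓝[>] 0) (𝓝 C)) : 0 < s := by
  -- If `s ≤ 0`, then `|b'(ξ)| ξ` stays above `|C|/2` near 0, so by the mean value theorem the
  -- increment of `b` over `[δ, 2δ]` is at least `|C|/4`, contradicting `b → 0`.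
  by_contra! hs
  have h1 : ∀ᶠ δ in 𝓝[>] (0 : ℝ), |C| / 2 < |deriv b δ * δ ^ (1 - s)| :=
    h'.abs.eventually_const_lt (half_lt_self (abs_pos.2 hC))
  obtain ⟨τ, hτ, hI⟩ := mem_nhdsGT_iff_exists_Ioo_subset.1 (h1.and hd)
  have hτ0 : 0 < τ := hτ
  have h2 : Tendsto (fun δ : ℝ => 2 * δ) (𝓝[>] 0) (𝓝[>] 0) := by
    refine tendsto_nhdsWithin_iff.2 ⟨?_, ?_⟩
    · have : Tendsto (fun δ : ℝ => 2 * δ) (𝓝 0) (𝓝 (2 * 0)) := tendsto_id.const_mul 2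
      rw [mul_zero] at this
      exact this.mono_left nhdsWithin_le_nhds
    · filter_upwards [eventually_nhdsGT_pos] with δ hδ
      simpa using hδ
  have h3 := ((h0.comp h2).sub h0).abs
  simp only [Function.comp_apply, sub_zero, abs_zero] at h3
  have h4 := h3.eventually_lt_const (show 0 < |C| / 4 by positivity)
  have h5 : ∀ᶠ δ in 𝓝[>] (0 : ℝ), δ < min τ 1 / 2 :=
    (eventually_lt_nhds (show 0 < min τ 1 / 2 by positivity)).filter_mono nhdsWithin_le_nhds
  obtain ⟨δ, hδ4, hδ5, hδ⟩ := (h4.and (h5.and eventually_nhdsGT_pos)).exists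
  have hτδ : 2 * δ < τ := by have := min_le_left τ 1; linarith
  have h1δ : 2 * δ < 1 := by have := min_le_right τ 1; linarith
  have hmem : ∀ y ∈ Icc δ (2 * δ), y ∈ Ioo 0 τ := fun y hy =>
    ⟨hδ.trans_le hy.1, hy.2.trans_lt hτδ⟩
  obtain ⟨ξ, hξ, hξ'⟩ := exists_deriv_eq_slope b (show δ < 2 * δ by linarith)
    (fun y hy => (hI (hmem y hy)).2.continuousAt.continuousWithinAt)
    (fun y hy => (hI (hmem y (Ioo_subset_Icc_self hy))).2.differentiableWithinAt)
  have hξ0 : 0 < ξ := hδ.trans hξ.1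
  have h6 := (hI (hmem ξ (Ioo_subset_Icc_self hξ))).1
  have h7 : b (2 * δ) - b δ = δ * deriv b ξ := by
    rw [hξ']
    field_simp
    ring
  rw [h7, abs_mul, abs_of_pos hδ] at hδ4
  rw [abs_mul, abs_of_pos (Real.rpow_pos_of_pos hξ0 _)] at h6
  have h8 : ξ ^ (1 - s) ≤ ξ := by
    conv_rhs => rw [← Real.rpow_one ξ]
    exact Real.rpow_le_rpow_of_exponent_ge hξ0 (hξ.2.trans h1δ).le (by linarith)
  have h9 : |deriv b ξ| * ξ ^ (1 - s) ≤ |deriv b ξ| * (2 * δ) :=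
    mul_le_mul_of_nonneg_left (h8.trans hξ.2.le) (abs_nonneg _)
  linarith

/-- L'Hôpital's rule for `b` against `δ ^ s`; both vanish at `0+` because `s > 0`. -/
theorem tendsto_mul_rpow_of_tendsto_deriv {b : ℝ → ℝ} {C s : ℝ} (hs : 0 < s)
    (hd : ∀ᶠ δ in 𝓝[>] (0 : ℝ), DifferentiableAt ℝ b δ) (h0 : Tendsto b (𝓝[>] 0) (𝓝 0))
    (h' : Tendsto (fun δ => deriv b δ * δ ^ (1 - s)) (𝓝[>] 0) (𝓝 C)) :
    Tendsto (fun δ => b δ * δ ^ (-s)) (𝓝[>] 0) (𝓝 (C / s)) := by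
  have h := deriv.lhopital_zero_nhdsGT (f := b) (g := fun δ : ℝ => δ ^ s) (l := 𝓝 (C / s)) hd
    ?_ h0 (tendsto_rpow_nhdsGT_zero hs) ?_
  · refine h.congr' ?_
    filter_upwards [eventually_nhdsGT_pos] with δ hδ
    rw [Real.rpow_neg hδ.le, div_eq_mul_inv]
  · filter_upwards [eventually_nhdsGT_pos] with δ hδ
    rw [Real.deriv_rpow_const]
    have := Real.rpow_pos_of_pos hδ (s - 1)
    positivity
  · refine (h'.div_const s).congr' ?_
    filter_upwards [eventually_nhdsGT_pos] with δ hδ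
    rw [Real.deriv_rpow_const, ← neg_sub s 1, Real.rpow_neg hδ.le]
    have := Real.rpow_pos_of_pos hδ (s - 1)
    field_simp

/-- If a function and its derivative follow power laws and the function tends to infinity, then
the power law of the derivative is the derivative of that of the function. -/
theorem exponent_deriv_of_tendsto {σ : ℝ → ℝ} {C C' γ ν : ℝ} (hγ : 0 < γ) (hC : C ≠ 0)
    (hC' : C' ≠ 0) (hd : ∀ᶠ δ in 𝓝[>] (0 : ℝ), DifferentiableAt ℝ σ δ)
    (h : Tendsto (fun δ => σ δ * δ ^ γ) (𝓝[>] 0) (𝓝 C))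
    (h' : Tendsto (fun δ => deriv σ δ * δ ^ (-ν)) (𝓝[>] 0) (𝓝 C')) :
    ν = -γ - 1 ∧ C' = -γ * C := by
  have hne : ∀ᶠ δ in 𝓝[>] (0 : ℝ), σ δ ≠ 0 := by
    filter_upwards [h.eventually_ne hC] with δ hδ hz
    simp [hz] at hδ
  -- The argument runs on `1/σ`, which vanishes at 0 and has derivative `-σ'/σ²` of order `δ^(ν +
  -- 2γ) = δ^(s - 1)`. Integration gives `1/σ` the exponent `s`, inversion gives it `γ`; equating
  -- exponents and then constants yields both claims.
  set s := ν + 2 * γ + 1 with hs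
  have hg1 : Tendsto (fun δ => (σ δ)⁻¹ * δ ^ (-γ)) (𝓝[>] 0) (𝓝 C⁻¹) := by
    refine (h.inv₀ hC).congr' ?_
    filter_upwards [eventually_nhdsGT_pos] with δ hδ
    rw [Real.rpow_neg hδ.le, mul_inv]
  have hg0 : Tendsto (fun δ => (σ δ)⁻¹) (𝓝[>] 0) (𝓝 0) := by
    have := hg1.mul (tendsto_rpow_nhdsGT_zero hγ)
    rw [mul_zero] at this
    refine this.congr' ?_
    filter_upwards [eventually_nhdsGT_pos] with δ hδ
    rw [mul_assoc, ← Real.rpow_add hδ]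
    simp
  have hgd : ∀ᶠ δ in 𝓝[>] (0 : ℝ), DifferentiableAt ℝ (fun δ => (σ δ)⁻¹) δ := by
    filter_upwards [hd, hne] with δ h1 h2
    exact h1.inv h2
  have hg' : Tendsto (fun δ => deriv (fun δ => (σ δ)⁻¹) δ * δ ^ (1 - s)) (𝓝[>] 0)
      (𝓝 (-C' * (C⁻¹) ^ 2)) := by
    refine (h'.neg.mul (hg1.pow 2)).congr' ?_
    filter_upwards [eventually_nhdsGT_pos, hne, hd] with δ hδ h1 h2
    rw [deriv_fun_inv'' h2 h1, show 1 - s = -ν + (-γ + -γ) by rw [hs]; ring, Real.rpow_add hδ,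
      Real.rpow_add hδ]
    field_simp
  have hk : -C' * (C⁻¹) ^ 2 ≠ 0 := mul_ne_zero (neg_ne_zero.2 hC') (pow_ne_zero 2 (inv_ne_zero hC))
  have hs0 := pos_of_tendsto_deriv_mul_rpow hk hgd hg0 hg'
  have hg2 := tendsto_mul_rpow_of_tendsto_deriv hs0 hgd hg0 hg'
  have hdiv := hg1.div hg2 (div_ne_zero hk hs0.ne')
  have hz : s - γ = 0 := by
    refine eq_zero_of_tendsto_rpow (div_ne_zero (inv_ne_zero hC) (div_ne_zero hk hs0.ne'))
      (hdiv.congr' ?_)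
    filter_upwards [eventually_nhdsGT_pos, hne] with δ hδ h1
    have h2 := Real.rpow_pos_of_pos hδ (-s)
    have h3 : δ ^ (s - γ) = δ ^ (-γ) / δ ^ (-s) := by
      rw [← Real.rpow_sub hδ]
      ring_nf
    rw [Pi.div_apply, h3]
    field_simp
  have hsγ : s = γ := by linarith
  refine ⟨by rw [hs] at hsγ; linarith, ?_⟩
  rw [hsγ] at hg2
  have := tendsto_nhds_unique hg1 hg2
  field_simp at this
  linarith

/-! ### Deterministic analysis of the criterion: optimal rate, limiting risk, stationary points,
existence of minimizers. -/

/-- Power laws at `0+` for the standard deviation `σ` and the bias `b` and their derivatives. -/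
structure PowerLaw (σ b : ℝ → ℝ) (A B γ β : ℝ) : Prop where
  γ_ge : 1 / 2 ≤ γ
  β_pos : 0 < β
  A_pos : 0 < A
  B_ne : B ≠ 0
  diff_σ : ∀ᶠ δ in 𝓝[>] (0 : ℝ), DifferentiableAt ℝ σ δ
  diff_b : ∀ᶠ δ in 𝓝[>] (0 : ℝ), DifferentiableAt ℝ b δ
  σ_lim : Tendsto (fun δ => σ δ * δ ^ γ) (𝓝[>] 0) (𝓝 A)
  deriv_σ_lim : Tendsto (fun δ => deriv σ δ * δ ^ (γ + 1)) (𝓝[>] 0) (𝓝 (-γ * A))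
  b_lim : Tendsto (fun δ => b δ * δ ^ (-β)) (𝓝[>] 0) (𝓝 (B / β))
  deriv_b_lim : Tendsto (fun δ => deriv b δ * δ ^ (1 - β)) (𝓝[>] 0) (𝓝 B)

/-- If `δ m ^ r` has a positive limit, `r > 0` and `m → ∞`, then `δ → 0+`. -/
theorem tendsto_nhdsGT_of_mul_rpow {ι : Type*} {l : Filter ι} {m δ : ι → ℝ} {r c : ℝ}
    (hr : 0 < r) (hc : 0 < c) (hm : Tendsto m l atTop)
    (h : Tendsto (fun i => δ i * m i ^ r) l (𝓝 c)) : Tendsto δ l (𝓝[>] 0) := by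
  have hm0 := hm.eventually_gt_atTop 0
  refine tendsto_nhdsWithin_iff.2 ⟨?_, ?_⟩
  · have := h.mul ((tendsto_rpow_neg_atTop hr).comp hm)
    rw [mul_zero] at this
    refine this.congr' ?_
    filter_upwards [hm0] with i hi
    rw [Function.comp_apply, mul_assoc, ← Real.rpow_add hi]
    simp
  · filter_upwards [hm0, h.eventually_const_lt hc] with i hi h1
    exact pos_of_mul_pos_left h1 (Real.rpow_pos_of_pos hi r).le

namespace PowerLaw

variable {σ b : ℝ → ℝ} {A B γ β : ℝ}

/-- The exponent of the optimal bandwidth. -/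
noncomputable def rate (γ β : ℝ) : ℝ := (2 * (β + γ))⁻¹

/-- The constant of the optimal bandwidth. -/
noncomputable def optConst (A B γ β : ℝ) : ℝ := (γ * β * A ^ 2 / B ^ 2) ^ rate γ β

/-- The limit of the rescaled mean squared error. -/
noncomputable def risk (A B γ β c : ℝ) : ℝ := (A * c ^ (-γ)) ^ 2 + (B / β * c ^ β) ^ 2

theorem γ_pos (h : PowerLaw σ b A B γ β) : 0 < γ := by linarith [h.γ_ge]

theorem rate_pos (h : PowerLaw σ b A B γ β) : 0 < rate γ β :=
  inv_pos.2 (by linarith [h.γ_pos, h.β_pos])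

theorem rate_lt_one (h : PowerLaw σ b A B γ β) : rate γ β < 1 :=
  inv_lt_one_of_one_lt₀ (by linarith [h.γ_ge, h.β_pos])

theorem two_mul_mul_rate (h : PowerLaw σ b A B γ β) : 2 * (β + γ) * rate γ β = 1 :=
  mul_inv_cancel₀ (by linarith [h.γ_pos, h.β_pos])

theorem base_pos (h : PowerLaw σ b A B γ β) : 0 < γ * β * A ^ 2 / B ^ 2 := by
  have := h.γ_pos
  have := h.β_pos
  have := h.A_pos
  have := h.B_ne
  positivity

theorem optConst_pos (h : PowerLaw σ b A B γ β) : 0 < optConst A B γ β :=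
  Real.rpow_pos_of_pos h.base_pos _

theorem optConst_rpow (h : PowerLaw σ b A B γ β) :
    optConst A B γ β ^ (2 * (β + γ)) = γ * β * A ^ 2 / B ^ 2 := by
  rw [optConst, ← Real.rpow_mul h.base_pos.le, mul_comm (rate γ β), h.two_mul_mul_rate,
    Real.rpow_one]

theorem risk_pos (h : PowerLaw σ b A B γ β) {c : ℝ} (hc : 0 < c) : 0 < risk A B γ β c := by
  have := h.A_pos
  have := Real.rpow_pos_of_pos hc (-γ)
  unfold risk
  positivity

theorem eventually_σ_pos (h : PowerLaw σ b A B γ β) : ∀ᶠ δ in 𝓝[>] (0 : ℝ), 0 < σ δ := by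
  filter_upwards [h.σ_lim.eventually_const_lt h.A_pos, eventually_nhdsGT_pos] with δ h1 hδ
  exact pos_of_mul_pos_left h1 (Real.rpow_pos_of_pos hδ γ).le

/-- The derivative is a positive power of `c` times an expression increasing in `c^(2(β+γ))`, whose
zero is exactly `optConst`. -/
theorem strictAntiOn_risk (h : PowerLaw σ b A B γ β) :
    StrictAntiOn (risk A B γ β) (Ioc 0 (optConst A B γ β)) := by
  have hγ := h.γ_pos
  have hβ := h.β_pos
  have hA := h.A_pos
  have hB := h.B_ne
  have hd : ∀ c : ℝ, 0 < c → HasDerivAt (risk A B γ β)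
      (2 * c ^ (-(2 * γ) - 1) * (-γ * A ^ 2 + B ^ 2 / β * c ^ (2 * (β + γ)))) c := by
    intro c hc
    have h1 := (((Real.hasDerivAt_rpow_const (p := -γ) (Or.inl hc.ne')).const_mul A).pow 2).add
      (((Real.hasDerivAt_rpow_const (p := β) (Or.inl hc.ne')).const_mul (B / β)).pow 2)
    refine h1.congr_deriv ?_
    have e1 : c ^ (-(2 * γ) - 1) = c ^ (-γ) * c ^ (-γ - 1) := by
      rw [← Real.rpow_add hc]; ring_nf
    have e2 : c ^ (-γ) * c ^ (-γ - 1) * c ^ (2 * (β + γ)) = c ^ β * c ^ (β - 1) := by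
      rw [← Real.rpow_add hc, ← Real.rpow_add hc, ← Real.rpow_add hc]; ring_nf
    rw [e1, mul_add, mul_left_comm _ (B ^ 2 / β), mul_assoc 2 (_ * _) (c ^ (2 * (β + γ))), e2]
    simp only [Nat.cast_ofNat, Nat.add_one_sub_one, pow_one]
    field_simp
  refine strictAntiOn_of_deriv_neg (convex_Ioc _ _)
    (fun c hc => (hd c hc.1).continuousAt.continuousWithinAt) fun c hc => ?_
  rw [interior_Ioc] at hc
  rw [(hd c hc.1).deriv]
  have h1 := Real.rpow_pos_of_pos hc.1 (-(2 * γ) - 1)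
  have h2 : c ^ (2 * (β + γ)) < γ * β * A ^ 2 / B ^ 2 := by
    rw [← h.optConst_rpow]
    exact Real.rpow_lt_rpow hc.1.le hc.2 (by linarith)
  have h3 : B ^ 2 / β * c ^ (2 * (β + γ)) < B ^ 2 / β * (γ * β * A ^ 2 / B ^ 2) :=
    mul_lt_mul_of_pos_left h2 (by positivity)
  have h4 : B ^ 2 / β * (γ * β * A ^ 2 / B ^ 2) = γ * A ^ 2 := by field_simp
  nlinarith

/-- The asymptotic mean squared error along bandwidths of the optimal order. -/
theorem tendsto_criterion (h : PowerLaw σ b A B γ β) {ι : Type*} {l : Filter ι} {m δ : ι → ℝ}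
    {c : ℝ} (hc : 0 < c) (hm : Tendsto m l atTop)
    (hδ : Tendsto (fun i => δ i * m i ^ rate γ β) l (𝓝 c)) :
    Tendsto (fun i => (σ (δ i) ^ 2 / m i + b (δ i) ^ 2) * m i ^ (2 * β * rate γ β)) l
      (𝓝 (risk A B γ β c)) := by
  have h0 := tendsto_nhdsGT_of_mul_rpow h.rate_pos hc hm hδ
  -- Each term is written as a power-law limit times a power of `δ m^r`. The choice of `r` makes `1
  -- - 2γr = 2βr`, so variance and squared bias share the normalization `m^{2βr}`.
  have h1 := ((h.σ_lim.comp h0).mul (hδ.rpow_const (p := -γ) (Or.inl hc.ne'))).pow 2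
  have h2 := ((h.b_lim.comp h0).mul (hδ.rpow_const (p := β) (Or.inl hc.ne'))).pow 2
  refine (h1.add h2).congr' ?_
  filter_upwards [hm.eventually_gt_atTop 0, h0.eventually eventually_nhdsGT_pos] with i hi hδi
  simp only [Function.comp_apply]
  have e : ∀ s : ℝ, (m i ^ s) ^ 2 = m i ^ (2 * s) := fun s => by
    rw [sq, ← Real.rpow_add hi, two_mul]
  rw [Real.mul_rpow hδi.le (Real.rpow_pos_of_pos hi _).le,
    Real.mul_rpow hδi.le (Real.rpow_pos_of_pos hi _).le, ← Real.rpow_mul hi.le,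
    ← Real.rpow_mul hi.le, add_mul]
  congr 1
  · have e1 : σ (δ i) * δ i ^ γ * (δ i ^ (-γ) * m i ^ (rate γ β * -γ)) =
        σ (δ i) * m i ^ (rate γ β * -γ) := by
      rw [mul_assoc, ← mul_assoc (δ i ^ γ), ← Real.rpow_add hδi]
      simp
    rw [e1, mul_pow, e, show 2 * (rate γ β * -γ) = 2 * β * rate γ β - 1 by
      linarith [h.two_mul_mul_rate], Real.rpow_sub hi, Real.rpow_one]
    ring
  · have e1 : b (δ i) * δ i ^ (-β) * (δ i ^ β * m i ^ (rate γ β * β)) =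
        b (δ i) * m i ^ (rate γ β * β) := by
      rw [mul_assoc, ← mul_assoc (δ i ^ (-β)), ← Real.rpow_add hδi]
      simp
    rw [e1, mul_pow, e]
    ring_nf

/-- Stationary bandwidths are asymptotically equivalent to the optimal one. -/
theorem tendsto_of_isStationary (h : PowerLaw σ b A B γ β) {a d : ℕ → ℝ}
    (ha : Tendsto a atTop atTop) (hd : IsStationary (fun n δ => σ δ ^ 2 / a n + b δ ^ 2) d) :
    Tendsto (fun n => d n * a n ^ rate γ β) atTop (𝓝 (optConst A B γ β)) := by
  have hγ := h.γ_pos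
  have hβ := h.β_pos
  have h0 : Tendsto d atTop (𝓝[>] 0) := tendsto_nhdsWithin_iff.2 ⟨hd.tendsto_zero, hd.pos⟩
  have hnum := ((h.σ_lim.comp h0).mul (h.deriv_σ_lim.comp h0)).neg
  have hden := (h.b_lim.comp h0).mul (h.deriv_b_lim.comp h0)
  have hne : B / β * B ≠ 0 := mul_ne_zero (div_ne_zero h.B_ne hβ.ne') h.B_ne
  have hlim := (hnum.div hden hne).rpow_const (p := rate γ β) (Or.inr h.rate_pos.le)
  have hval : -(A * (-γ * A)) / (B / β * B) = γ * β * A ^ 2 / B ^ 2 := by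
    have := h.B_ne
    field_simp
  rw [hval] at hlim
  refine hlim.congr' ?_
  filter_upwards [ha.eventually_gt_atTop 0, hd.pos, hd.hasDerivAt, h0.eventually h.diff_σ,
    h0.eventually h.diff_b, hden.eventually_ne hne] with n han hdn hQ hσ hb hne
  simp only [Function.comp_apply, Pi.div_apply] at hne ⊢
  have hz := hQ.unique (((hσ.hasDerivAt.pow 2).div_const (a n)).add (hb.hasDerivAt.pow 2))
  simp only [Nat.cast_ofNat, Nat.add_one_sub_one, pow_one] at hz
  -- Inserting the power laws, the stationarity equation says that `a d^(2(β+γ))` is the quotient of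
  -- two convergent expressions. The power `rate γ β` of this limit is the constant sought.
  have hz' : -(σ (d n) * deriv σ (d n)) = a n * (b (d n) * deriv b (d n)) := by
    field_simp at hz
    linarith
  have e1 : -(σ (d n) * d n ^ γ * (deriv σ (d n) * d n ^ (γ + 1))) =
      a n * d n ^ (2 * (β + γ)) * (b (d n) * d n ^ (-β) * (deriv b (d n) * d n ^ (1 - β))) := by
    have e2 : d n ^ (2 * (β + γ)) * d n ^ (-β) * d n ^ (1 - β) = d n ^ γ * d n ^ (γ + 1) := by
      rw [← Real.rpow_add hdn, ← Real.rpow_add hdn, ← Real.rpow_add hdn]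
      ring_nf
    linear_combination (d n ^ γ * d n ^ (γ + 1)) * hz' -
      (a n * (b (d n) * deriv b (d n))) * e2
  rw [e1, mul_div_cancel_right₀ _ hne, Real.mul_rpow han.le (Real.rpow_pos_of_pos hdn _).le,
    ← Real.rpow_mul hdn.le, h.two_mul_mul_rate, Real.rpow_one, mul_comm]

/-- Optimal bandwidths exist. -/
theorem exists_isOptimal (h : PowerLaw σ b A B γ β) {a : ℕ → ℝ} (ha : Tendsto a atTop atTop) :
    ∃ d, IsOptimal (fun n δ => σ δ ^ 2 / a n + b δ ^ 2) d := by
  have hγ := h.γ_pos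
  have hβ := h.β_pos
  set k := |B / β| / 2 with hk
  have hk0 : 0 < k := half_pos (abs_pos.2 (div_ne_zero h.B_ne hβ.ne'))
  have hev : ∀ᶠ δ in 𝓝[>] (0 : ℝ), A / 2 < σ δ * δ ^ γ ∧ k < |b δ * δ ^ (-β)| ∧
      DifferentiableAt ℝ σ δ ∧ DifferentiableAt ℝ b δ :=
    (h.σ_lim.eventually_const_lt (half_lt_self h.A_pos)).and
      ((h.b_lim.abs.eventually_const_lt
        (half_lt_self (abs_pos.2 (div_ne_zero h.B_ne hβ.ne')))).and (h.diff_σ.and h.diff_b))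
  obtain ⟨τ, hτ, hI⟩ := mem_nhdsGT_iff_exists_Ioc_subset.1 hev
  have hτ0 : 0 < τ := hτ
  have hlow : ∀ δ ∈ Ioc 0 τ, k * δ ^ β ≤ |b δ| := by
    intro δ hδ
    have h1 := (hI hδ).2.1
    rw [abs_mul, abs_of_pos (Real.rpow_pos_of_pos hδ.1 _), Real.rpow_neg hδ.1.le,
      ← div_eq_mul_inv, lt_div_iff₀ (Real.rpow_pos_of_pos hδ.1 _)] at h1
    exact h1.le
  have hcont : ∀ n, ∀ δ ∈ Ioc 0 τ, ContinuousAt (fun δ => σ δ ^ 2 / a n + b δ ^ 2) δ :=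
    fun n δ hδ => (((hI hδ).2.2.1.continuousAt.pow 2).div_const _).add
      ((hI hδ).2.2.2.continuousAt.pow 2)
  -- existence of a minimizer, since the criterion is unbounded at `0`
  have hmin : ∀ n, 0 < a n → ∃ δ ∈ Ioc 0 τ,
      IsMinOn (fun δ => σ δ ^ 2 / a n + b δ ^ 2) (Ioc 0 τ) δ := by
    intro n hn
    have hinf : Tendsto (fun δ => σ δ ^ 2 / a n + b δ ^ 2) (𝓝[>] 0) atTop := by
      have h1 : Tendsto (fun δ : ℝ => δ ^ (-(2 * γ))) (𝓝[>] 0) atTop := by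
        have := (tendsto_rpow_nhdsGT_zero (s := 2 * γ) (by linarith))
        have h2 : Tendsto (fun δ : ℝ => δ ^ (2 * γ)) (𝓝[>] 0) (𝓝[>] 0) :=
          tendsto_nhdsWithin_iff.2 ⟨this, by
            filter_upwards [eventually_nhdsGT_pos] with δ hδ using Real.rpow_pos_of_pos hδ _⟩
        refine (tendsto_inv_nhdsGT_zero.comp h2).congr' ?_
        filter_upwards [eventually_nhdsGT_pos] with δ hδ
        rw [Real.rpow_neg hδ.le, Function.comp_apply]
      have h3 := h1.atTop_mul_pos (pow_pos h.A_pos 2) (h.σ_lim.pow 2)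
      have h4 : Tendsto (fun δ => σ δ ^ 2) (𝓝[>] 0) atTop := by
        refine h3.congr' ?_
        filter_upwards [eventually_nhdsGT_pos] with δ hδ
        rw [mul_pow, sq (δ ^ γ), ← Real.rpow_add hδ, mul_left_comm, ← Real.rpow_add hδ]
        ring_nf
        simp
      exact tendsto_atTop_mono (fun δ => le_add_of_nonneg_right (sq_nonneg _))
        (h4.atTop_div_const hn)
    -- Below `ρ` the criterion is at least its value at `τ`, so minimizing over the compact interval
    -- `[min (ρ/2) τ, τ]` suffices.
    obtain ⟨ρ, hρ, hρI⟩ := mem_nhdsGT_iff_exists_Ioo_subset.1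
      (hinf.eventually_ge_atTop (σ τ ^ 2 / a n + b τ ^ 2))
    have hρ0 : 0 < ρ := hρ
    have hρτ : 0 < min (ρ / 2) τ := by positivity
    obtain ⟨δ, hδ, hδmin⟩ := isCompact_Icc.exists_isMinOn
      (nonempty_Icc.2 (min_le_right (ρ / 2) τ)) (f := fun δ => σ δ ^ 2 / a n + b δ ^ 2)
      (fun y hy => (hcont n y ⟨hρτ.trans_le hy.1, hy.2⟩).continuousWithinAt)
    refine ⟨δ, ⟨hρτ.trans_le hδ.1, hδ.2⟩, fun y hy => ?_⟩
    rcases le_or_gt (min (ρ / 2) τ) y with hy1 | hy1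
    · exact hδmin ⟨hy1, hy.2⟩
    · have h1 : y < ρ := by linarith [hy1.trans_le (min_le_left (ρ / 2) τ)]
      have h2 := hδmin (show τ ∈ Icc (min (ρ / 2) τ) τ from ⟨min_le_right _ _, le_rfl⟩)
      have h3 := hρI ⟨hy.1, h1⟩
      rw [mem_ofPred_eq] at h3
      exact le_trans h2 h3
  choose! d hd hdmin using hmin
  have hpos := ha.eventually_gt_atTop 0
  -- the minimal value tends to zero, hence so does the minimizer
  have hval : Tendsto (fun n => σ (d n) ^ 2 / a n + b (d n) ^ 2) atTop (𝓝 0) := by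
    have h1 : Tendsto (fun n => a n ^ (-rate γ β) * a n ^ rate γ β) atTop (𝓝 1) := by
      refine tendsto_const_nhds.congr' ?_
      filter_upwards [hpos] with n hn
      rw [← Real.rpow_add hn]
      simp
    have h2 := (h.tendsto_criterion one_pos ha h1).mul ((tendsto_rpow_neg_atTop
      (show 0 < 2 * β * rate γ β by have := h.rate_pos; positivity)).comp ha)
    rw [mul_zero] at h2
    have h3 := (tendsto_nhdsGT_of_mul_rpow h.rate_pos one_pos ha h1).eventually
      (Ioc_mem_nhdsGT hτ0)
    refine tendsto_of_tendsto_of_tendsto_of_le_of_le' tendsto_const_nhds h2 ?_ ?_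
    · filter_upwards [hpos] with n hn
      positivity
    · filter_upwards [hpos, h3] with n hn hn'
      rw [Function.comp_apply, mul_assoc, ← Real.rpow_add hn]
      simpa using hdmin n hn hn'
  have hd0 : Tendsto d atTop (𝓝 0) := by
    have h1 := (hval.sqrt.div_const k).rpow_const (p := β⁻¹) (Or.inr (inv_pos.2 hβ).le)
    rw [Real.sqrt_zero, zero_div, Real.zero_rpow (inv_pos.2 hβ).ne'] at h1
    refine tendsto_of_tendsto_of_tendsto_of_le_of_le' tendsto_const_nhds h1 ?_ ?_
    · filter_upwards [hpos] with n hn using (hd n hn).1.le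
    · filter_upwards [hpos] with n hn
      have hdn := (hd n hn).1
      have h2 : |b (d n)| ≤ √(σ (d n) ^ 2 / a n + b (d n) ^ 2) :=
        Real.abs_le_sqrt (le_add_of_nonneg_left (by positivity))
      have h3 : d n ^ β ≤ √(σ (d n) ^ 2 / a n + b (d n) ^ 2) / k := by
        rw [le_div_iff₀' hk0]
        exact (hlow _ (hd n hn)).trans h2
      calc d n = (d n ^ β) ^ β⁻¹ := by
            rw [← Real.rpow_mul hdn.le, mul_inv_cancel₀ hβ.ne', Real.rpow_one]
        _ ≤ _ := Real.rpow_le_rpow (Real.rpow_pos_of_pos hdn _).le h3 (inv_pos.2 hβ).le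
  refine ⟨d, ⟨?_, hd0, ?_⟩, τ, hτ0, ?_⟩
  · filter_upwards [hpos] with n hn using (hd n hn).1
  -- Once `d n < τ` the minimizer is interior, and Fermat's rule gives a zero derivative.
  · filter_upwards [hpos, hd0.eventually_lt_const hτ0] with n hn hlt
    have hdn := hd n hn
    have hdiff : DifferentiableAt ℝ (fun δ => σ δ ^ 2 / a n + b δ ^ 2) (d n) :=
      (((hI hdn).2.2.1.pow 2).div_const _).add ((hI hdn).2.2.2.pow 2)
    have hloc : IsLocalMin (fun δ => σ δ ^ 2 / a n + b δ ^ 2) (d n) :=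
      (hdmin n hn).isLocalMin (Ioc_mem_nhds hdn.1 hlt)
    exact hloc.deriv_eq_zero ▸ hdiff.hasDerivAt
  · filter_upwards [hpos] with n hn using ⟨hd n hn, hdmin n hn⟩

end PowerLaw

/-! ### The variance of the kernel is at least of order `1/δ`, and A1 yields the power laws. -/

theorem IsKernel.exists_pos {K : ℝ → ℝ} (hK : IsKernel K) : ∃ u, 0 < K u := by
  by_contra! h
  have h0 : K = fun _ => 0 := funext fun u => le_antisymm (h u) (hK.nonneg u)
  have := hK.integral_eq_one
  simp [h0] at this

/-- The second moment of the rescaled kernel is at least of order `δ⁻¹`. -/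
theorem IsKernel.exists_le_integral_sq_kerAt {K p : ℝ → ℝ} {x : ℝ} (hK : IsKernel K)
    (hp : IsDensity p) (hpx : 0 < p x) (hcont : ContinuousAt p x) :
    ∃ c : ℝ, 0 < c ∧ ∀ᶠ δ in 𝓝[>] (0 : ℝ), c / δ ≤ ∫ o, kerAt K x δ o ^ 2 ∂(lawOf p) := by
  have hprob := hp.isProbabilityMeasure
  obtain ⟨u, hu⟩ := hK.exists_pos
  obtain ⟨h, hh, hKh⟩ := Metric.eventually_nhds_iff_ball.1
    (hK.continuous.continuousAt.eventually_const_lt (half_lt_self hu))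
  obtain ⟨τ, hτ, hpτ⟩ := Metric.eventually_nhds_iff_ball.1
    (hcont.eventually_const_lt (half_lt_self hpx))
  -- On an interval of length `2hδ` around `x + δu` the rescaled kernel is at least `K u / (2δ)` and
  -- the density at least `p x / 2`; Markov's inequality turns this into the bound.
  refine ⟨(K u / 2) ^ 2 * (p x / 2 * (2 * h)), by positivity, ?_⟩
  have hsmall : ∀ᶠ δ in 𝓝[>] (0 : ℝ), δ < τ / (|u| + h) :=
    (eventually_lt_nhds (show 0 < τ / (|u| + h) by positivity)).filter_mono nhdsWithin_le_nhds
  filter_upwards [eventually_nhdsGT_pos, hsmall] with δ hδ hδτ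
  rw [lt_div_iff₀ (by positivity)] at hδτ
  set I := Ioo (x + δ * (u - h)) (x + δ * (u + h))
  have hI : ∀ o ∈ I, |(o - x) / δ - u| < h := by
    intro o ho
    rw [abs_lt]
    constructor
    · have := ho.1
      rw [lt_sub_iff_add_lt, lt_div_iff₀ hδ]
      linarith
    · have := ho.2
      rw [sub_lt_iff_lt_add, div_lt_iff₀ hδ]
      linarith
  have h1 : ∀ o ∈ I, (δ⁻¹ * (K u / 2)) ^ 2 ≤ kerAt K x δ o ^ 2 := by
    intro o ho
    have := (hKh _ (mem_ball_iff_norm.2 (hI o ho))).le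
    unfold kerAt
    gcongr
  have h2 : ENNReal.ofReal (p x / 2 * (2 * h * δ)) ≤ lawOf p I := by
    rw [lawOf, withDensity_apply _ measurableSet_Ioo]
    calc ENNReal.ofReal (p x / 2 * (2 * h * δ)) = ∫⁻ _ in I, ENNReal.ofReal (p x / 2) := by
          rw [setLIntegral_const, Real.volume_Ioo, ← ENNReal.ofReal_mul (by positivity)]
          congr 1
          ring
      _ ≤ _ := by
          refine setLIntegral_mono' measurableSet_Ioo fun o ho => ENNReal.ofReal_le_ofReal ?_
          refine (hpτ o (mem_ball_iff_norm.2 ?_)).le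
          rw [Real.norm_eq_abs]
          have h3 : |(o - x) / δ| < |u| + h := by
            have := abs_sub_abs_le_abs_sub ((o - x) / δ) u
            linarith [hI o ho]
          rw [abs_div, abs_of_pos hδ, div_lt_iff₀ hδ] at h3
          linarith
  have h3 := mul_meas_ge_le_integral_of_nonneg (μ := lawOf p) (f := fun o => kerAt K x δ o ^ 2)
    (ae_of_all _ fun _ => sq_nonneg _) (hK.integrable_kerAt_sq x δ _) ((δ⁻¹ * (K u / 2)) ^ 2)
  refine le_trans ?_ h3
  have h4 : p x / 2 * (2 * h * δ) ≤
      (lawOf p).real {o | (δ⁻¹ * (K u / 2)) ^ 2 ≤ kerAt K x δ o ^ 2} := by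
    rw [measureReal_def, ← ENNReal.ofReal_le_iff_le_toReal (measure_ne_top _ _)]
    exact h2.trans (measure_mono h1)
  refine le_trans (le_of_eq ?_) (mul_le_mul_of_nonneg_left h4 (sq_nonneg _))
  field_simp

theorem Model.sigmaInf_nonneg {Ω : Type*} (M : Model Ω) (δ : ℝ) : 0 ≤ M.sigmaInf δ :=
  Real.sqrt_nonneg _

namespace Model.IsSampled

variable {Ω : Type*} [MeasurableSpace Ω] {M : Model Ω} {μ : Measure Ω}

/-- Under A1 the standard deviation and the bias follow power laws. -/
theorem exists_powerLaw (hM : M.IsSampled μ) (hx : 0 < M.p₀ M.x) (hc : ContinuousAt M.p₀ M.x)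
    (hb : Tendsto M.bias (𝓝[>] 0) (𝓝 0)) (hA1 : M.A1) :
    ∃ A B γ β, PowerLaw M.sigmaInf M.bias A B γ β := by
  obtain ⟨hdiff, ⟨B, A, A', CH, β, γ, ν, η, hB, hA, hA', -, -, -, -, hσ, hσ', hb', -⟩, -⟩ := hA1
  have hσl := tendsto_mul_rpow_of_isEquivalent hσ
  have hσl' := tendsto_mul_rpow_of_isEquivalent hσ'
  have hbl' := tendsto_mul_rpow_of_isEquivalent hb'
  rw [neg_neg] at hσl
  rw [neg_sub] at hbl'
  have hdσ := hdiff.mono fun _ h => h.1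
  have hdb := hdiff.mono fun _ h => h.2.2.1
  have hApos : 0 < A := by
    refine lt_of_le_of_ne (ge_of_tendsto hσl ?_) hA.symm
    filter_upwards [eventually_nhdsGT_pos] with δ hδ
    exact mul_nonneg (M.sigmaInf_nonneg δ) (Real.rpow_pos_of_pos hδ _).le
  have hγ : 1 / 2 ≤ γ := by
    -- If `γ < 1/2`, both `δ σ_∞²` and `δ (P₀ K_δ)²` tend to 0. Their sum is `δ P₀ K_δ²`, which
    -- stays above `c > 0`.
    by_contra! hγ
    obtain ⟨c, hc0, hlow⟩ := hM.isKernel.exists_le_integral_sq_kerAt hM.isDensity hx hc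
    have h1 := (hσl.pow 2).mul (tendsto_rpow_nhdsGT_zero (s := 1 - 2 * γ) (by linarith))
    have h2 : Tendsto (fun δ => δ * (M.bias δ + M.target) ^ 2) (𝓝[>] 0)
        (𝓝 (0 * (0 + M.target) ^ 2)) :=
      (tendsto_id.mono_left nhdsWithin_le_nhds).mul ((hb.add_const _).pow 2)
    have h3 := h1.add h2
    rw [mul_zero, zero_mul, add_zero] at h3
    refine absurd (ge_of_tendsto h3 ?_) hc0.not_ge
    filter_upwards [eventually_nhdsGT_pos, hlow] with δ hδ hl
    have h4 := hM.sq_sigmaInf δ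
    have e : (M.sigmaInf δ * δ ^ γ) ^ 2 * δ ^ (1 - 2 * γ) = δ * M.sigmaInf δ ^ 2 := by
      rw [mul_pow, mul_assoc, sq (δ ^ γ), ← Real.rpow_add hδ, ← Real.rpow_add hδ]
      ring_nf
      simp
    rw [e, h4, ← mul_add, bias]
    rw [div_le_iff₀' hδ] at hl
    convert hl using 2
    rw [P₀]
    ring
  -- The exponent and the constant of `σ_∞'` are not free parameters of A1: those of `σ_∞` determine
  -- them.
  obtain ⟨rfl, rfl⟩ := exponent_deriv_of_tendsto (by linarith) hA hA' hdσ hσl hσl'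
  have hβ := pos_of_tendsto_deriv_mul_rpow hB hdb hb hbl'
  refine ⟨A, B, γ, β, hγ, hβ, hApos, hB, hdσ, hdb, hσl, ?_,
    tendsto_mul_rpow_of_tendsto_deriv hβ hdb hb hbl', hbl'⟩
  convert hσl' using 4
  ring

end Model.IsSampled

/-! ### Finite differences and consistency of the estimated derivatives. -/

section FiniteDifference

variable {d Δ : ℕ → ℝ}

theorem tendsto_add_of_tendsto_div (hd : Tendsto d atTop (𝓝[>] 0)) (hΔ : ∀ᶠ n in atTop, 0 < Δ n)
    (h : Tendsto (fun n => Δ n / d n) atTop (𝓝 0)) :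
    Tendsto (fun n => d n + Δ n) atTop (𝓝[>] 0) := by
  have hd0 := hd.eventually eventually_nhdsGT_pos
  refine tendsto_nhdsWithin_iff.2 ⟨?_, ?_⟩
  · have hd' := hd.mono_right nhdsWithin_le_nhds
    have := hd'.add (h.mul hd')
    rw [mul_zero, add_zero] at this
    refine this.congr' ?_
    filter_upwards [hd0] with n hn
    field_simp
  · filter_upwards [hd0, hΔ] with n h1 h2
    exact add_pos h1 h2

theorem tendsto_div_of_mem_Icc {ξ : ℕ → ℝ} (hd : ∀ᶠ n in atTop, 0 < d n)
    (h : Tendsto (fun n => Δ n / d n) atTop (𝓝 0))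
    (hξ : ∀ᶠ n in atTop, ξ n ∈ Icc (d n) (d n + Δ n)) :
    Tendsto (fun n => d n / ξ n) atTop (𝓝 1) := by
  have h1 : Tendsto (fun n => ξ n / d n) atTop (𝓝 1) := by
    have h2 := h.const_add 1
    rw [add_zero] at h2
    refine tendsto_of_tendsto_of_tendsto_of_le_of_le' tendsto_const_nhds h2 ?_ ?_
    · filter_upwards [hd, hξ] with n h3 h4
      rw [le_div_iff₀ h3, one_mul]
      exact h4.1
    · filter_upwards [hd, hξ] with n h3 h4
      rw [div_le_iff₀ h3]
      have := h4.2
      field_simp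
      linarith
  simpa using h1.inv₀ one_ne_zero

/-- Finite differences of small relative increment follow the power law of the derivative. -/
theorem tendsto_finiteDifference {f : ℝ → ℝ} {s L : ℝ}
    (hf : ∀ᶠ δ in 𝓝[>] (0 : ℝ), DifferentiableAt ℝ f δ)
    (hL : Tendsto (fun δ => deriv f δ * δ ^ s) (𝓝[>] 0) (𝓝 L))
    (hd : Tendsto d atTop (𝓝[>] 0)) (hΔ : ∀ᶠ n in atTop, 0 < Δ n)
    (h : Tendsto (fun n => Δ n / d n) atTop (𝓝 0)) :
    Tendsto (fun n => (f (d n + Δ n) - f (d n)) / Δ n * d n ^ s) atTop (𝓝 L) := by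
  have hd0 := hd.eventually eventually_nhdsGT_pos
  have hd' := tendsto_add_of_tendsto_div hd hΔ h
  obtain ⟨τ, hτ, hI⟩ := mem_nhdsGT_iff_exists_Ioo_subset.1 hf
  have hlt := (hd'.mono_right nhdsWithin_le_nhds).eventually_lt_const hτ
  have hex : ∀ᶠ n in atTop, ∃ ξ ∈ Icc (d n) (d n + Δ n),
      deriv f ξ = (f (d n + Δ n) - f (d n)) / Δ n := by
    filter_upwards [hd0, hΔ, hlt] with n h1 h2 h3
    have hmem : ∀ y ∈ Icc (d n) (d n + Δ n), DifferentiableAt ℝ f y := fun y hy =>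
      hI ⟨h1.trans_le hy.1, hy.2.trans_lt h3⟩
    obtain ⟨ξ, hξ, hξ'⟩ := exists_deriv_eq_slope f (show d n < d n + Δ n by linarith)
      (fun y hy => (hmem y hy).continuousAt.continuousWithinAt)
      (fun y hy => (hmem y (Ioo_subset_Icc_self hy)).differentiableWithinAt)
    exact ⟨ξ, Ioo_subset_Icc_self hξ, by rw [hξ', add_sub_cancel_left]⟩
  -- The mean value points satisfy `d/ξ → 1`, so the power weight may be moved from `d` to `ξ`,
  -- where the derivative is evaluated.
  obtain ⟨ξ, hξ⟩ := hex.choice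
  have hξ0 : Tendsto ξ atTop (𝓝[>] 0) := by
    refine tendsto_nhdsWithin_iff.2 ⟨?_, ?_⟩
    · refine tendsto_of_tendsto_of_tendsto_of_le_of_le' (hd.mono_right nhdsWithin_le_nhds)
        (hd'.mono_right nhdsWithin_le_nhds) ?_ ?_
      · exact hξ.mono fun n h => h.1.1
      · exact hξ.mono fun n h => h.1.2
    · filter_upwards [hd0, hξ] with n h1 h2 using h1.trans_le h2.1.1
  have h1 := (hL.comp hξ0).mul ((tendsto_div_of_mem_Icc hd0 h
    (hξ.mono fun n h => h.1)).rpow_const (p := s) (Or.inl one_ne_zero))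
  rw [Real.one_rpow, mul_one] at h1
  refine h1.congr' ?_
  filter_upwards [hd0, hξ] with n h2 h3
  have h4 : 0 < ξ n := h2.trans_le h3.1.1
  have h5 := Real.rpow_pos_of_pos h4 s
  rw [Function.comp_apply, h3.2, Real.div_rpow h2.le h4.le]
  field_simp

end FiniteDifference

namespace Split

variable (S : Split)

theorem gap_pos : ∀ᶠ n in atTop, 0 < S.gap n := by
  filter_upwards [S.tendsto_m₂.eventually_gt_atTop 0] with n hn using Real.rpow_pos_of_pos hn _

theorem tendsto_gap : Tendsto S.gap atTop (𝓝 0) :=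
  (tendsto_rpow_neg_atTop (by norm_num)).comp S.tendsto_m₂

/-- Writing sample sizes as powers of the increment makes every Chebyshev bound below a comparison
of `gap` with powers of the bandwidth. -/
theorem inv_m₂_eq {n : ℕ} (h : S.l₁ n < S.l₂ n) : ((S.l₂ n - S.l₁ n : ℕ) : ℝ)⁻¹ = S.gap n ^ 4 := by
  have h0 : 0 < S.m₂ n := by
    rw [S.m₂_eq]
    exact_mod_cast Nat.sub_pos_of_lt h
  rw [← S.m₂_eq, gap, ← Real.rpow_natCast, ← Real.rpow_mul h0.le, ← Real.rpow_neg_one]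
  norm_num

/-- The finite difference increment is negligible against powers of admissible bandwidths. -/
theorem tendsto_gap_div_rpow {r s : ℝ} (hs : 0 < s) (hrs : r * s ≤ 1 / 4) {d : ℕ → ℝ}
    (hd : SlowerThan r d) : Tendsto (fun n => S.gap n / d n ^ s) atTop (𝓝 0) := by
  have h1 := S.tendsto_m₂_div.rpow_const (p := (-(1 / 4) : ℝ)) (Or.inl (sub_pos.2 S.lt).ne')
  have h2 := hd.slow.tendsto_div_nhds_zero.rpow_const (p := s) (Or.inr hs.le)
  have h3 := h1.mul h2
  rw [Real.zero_rpow hs.ne', mul_zero] at h3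
  refine tendsto_of_tendsto_of_tendsto_of_le_of_le' tendsto_const_nhds h3 ?_ ?_
  · filter_upwards [S.gap_pos, hd.pos] with n hn hdn
    have := Real.rpow_pos_of_pos hdn s
    positivity
  · filter_upwards [S.tendsto_m₂.eventually_gt_atTop 0, hd.pos, eventually_ge_atTop 1]
      with n hm hdn hn
    have hn1 : (1 : ℝ) ≤ n := by exact_mod_cast hn
    have hn0 : (0 : ℝ) < n := by linarith
    have hp := Real.rpow_pos_of_pos hdn s
    have h4 : (n : ℝ) ^ (-(1 / 4) : ℝ) ≤ (n : ℝ) ^ (-r * s) :=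
      Real.rpow_le_rpow_of_exponent_le hn1 (by linarith)
    rw [Real.div_rpow hm.le hn0.le, Real.div_rpow (Real.rpow_pos_of_pos hn0 _).le hdn.le,
      ← Real.rpow_mul hn0.le, gap]
    have h5 := Real.rpow_pos_of_pos hn0 (-(1 / 4))
    have h6 := Real.rpow_pos_of_pos hm (-(1 / 4))
    rw [div_mul_div_comm, div_le_div_iff₀ hp (by positivity)]
    calc _ = S.m₂ n ^ (-(1 / 4) : ℝ) * d n ^ s * (n : ℝ) ^ (-(1 / 4) : ℝ) := by ring
      _ ≤ S.m₂ n ^ (-(1 / 4) : ℝ) * d n ^ s * (n : ℝ) ^ (-r * s) := by gcongr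
      _ = _ := by ring

end Split

namespace Model.IsSampled

variable {Ω : Type*} [MeasurableSpace Ω] {M : Model Ω} {μ : Measure Ω} [IsProbabilityMeasure μ]
  {A B γ β : ℝ} {S : Split} {d : ℕ → ℝ}

/-- The factor `1 / gap` anticipates the division in the difference quotient. Since `K_δ²` is
bounded by `C²/δ²`, Chebyshev leaves `C⁴ δ^(4γ-2) gap²`, which vanishes because `γ ≥ 1/2`. -/
theorem tendsto_sq_sigmaHat_sub (hM : M.IsSampled μ) (hγ : 1 / 2 ≤ γ)
    (hd : Tendsto d atTop (𝓝[>] 0)) :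
    Tendsto (fun q : ℕ × Ω => d q.1 ^ (2 * γ + 1) / S.gap q.1 *
      (M.sigmaHat S q.1 q.2 (d q.1) ^ 2 - M.sigmaInf (d q.1) ^ 2)) (probFilter μ) (𝓝 0) := by
  obtain ⟨C, hC0, hC⟩ := hM.isKernel.exists_bound
  have hprob := hM.isProb
  have hd0 := hd.eventually eventually_nhdsGT_pos
  have hlt := S.eventually_l₁_lt_l₂
  have hbound : Tendsto (fun n => d n ^ (4 * γ - 2) * S.gap n ^ 2) atTop (𝓝 0) := by
    have h1 := S.tendsto_gap.pow 2
    rw [zero_pow two_ne_zero] at h1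
    refine tendsto_of_tendsto_of_tendsto_of_le_of_le' tendsto_const_nhds h1 ?_ ?_
    · filter_upwards [hd0] with n hn
      have := Real.rpow_pos_of_pos hn (4 * γ - 2)
      positivity
    · filter_upwards [hd0, (hd.mono_right nhdsWithin_le_nhds).eventually_lt_const one_pos]
        with n hn hn1
      exact mul_le_of_le_one_left (sq_nonneg _)
        (Real.rpow_le_one hn.le hn1.le (by linarith))
  have hpow : ∀ n, 0 < d n → (d n ^ (2 * γ + 1)) ^ 2 = d n ^ (4 * γ - 2) * d n ^ 4 := by
    intro n hn
    rw [← Real.rpow_natCast, ← Real.rpow_mul hn.le, ← Real.rpow_natCast (d n) 4,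
      ← Real.rpow_add hn]
    congr 1
    push_cast
    ring
  have h1 := hM.tendsto_empirical (f := fun n o => kerAt M.K M.x (d n) o ^ 2)
    (B := fun n => (C / |d n|) ^ 2) (w := fun n => d n ^ (2 * γ + 1) / S.gap n)
    (a := S.l₁) (b := S.l₂) (fun n => (hM.isKernel.measurable_kerAt_right _ _).pow_const 2)
    (fun n o => by rw [abs_pow]; gcongr; exact hC _ _ _) hlt (by
      have h2 := hbound.const_mul (C ^ 4)
      rw [mul_zero] at h2
      refine h2.congr' ?_
      filter_upwards [hd0, hlt, S.gap_pos] with n hn hl hg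
      rw [div_eq_mul_inv _ (Nat.cast _), S.inv_m₂_eq hl, abs_of_pos hn, mul_pow, div_pow,
        hpow n hn]
      field_simp)
  have h2 := hM.tendsto_empirical (f := fun n => kerAt M.K M.x (d n))
    (B := fun n => C / |d n|) (w := fun n => d n ^ (2 * γ + 1) / S.gap n / d n)
    (a := S.l₁) (b := S.l₂) (fun n => hM.isKernel.measurable_kerAt_right _ _)
    (fun n => hC _ _) hlt (by
      have h2 := hbound.const_mul (C ^ 2)
      rw [mul_zero] at h2
      refine h2.congr' ?_
      filter_upwards [hd0, hlt, S.gap_pos] with n hn hl hg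
      rw [div_eq_mul_inv _ (Nat.cast _), S.inv_m₂_eq hl, abs_of_pos hn, mul_pow, div_pow, div_pow,
        hpow n hn]
      field_simp)
  -- The squared means are compared through a difference of squares: the difference is handled by
  -- Chebyshev, and the sum times `δ` is at most `2C`.
  have h3 : Tendsto (fun q : ℕ × Ω => (d q.1 ^ (2 * γ + 1) / S.gap q.1 / d q.1 *
      (smoothed M.K M.x (d q.1) (M.P₂ S q.1 q.2) - smoothed M.K M.x (d q.1) M.P₀)) *
      (d q.1 * (smoothed M.K M.x (d q.1) (M.P₂ S q.1 q.2) + smoothed M.K M.x (d q.1) M.P₀)))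
      (probFilter μ) (𝓝 0) := by
    refine h2.zero_mul_isBoundedUnder_le ?_
    refine isBoundedUnder_of_eventually_le (a := 2 * C) ?_
    filter_upwards [tendsto_fst_probFilter.eventually (hd0.and hlt)] with q hq
    have : IsProbabilityMeasure (M.P₂ S q.1 q.2) := isProbabilityMeasure_empirical hq.2 q.2
    have hs : ∀ (P : Measure ℝ) [IsProbabilityMeasure P],
        |smoothed M.K M.x (d q.1) P| ≤ C / d q.1 := by
      intro P _
      have := norm_integral_le_of_norm_le_const (μ := P) (f := kerAt M.K M.x (d q.1))
        (ae_of_all _ fun o => hC M.x (d q.1) o)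
      simpa [smoothed, abs_of_pos hq.1] using this
    have h4 := (abs_add_le _ _).trans (add_le_add (hs (M.P₂ S q.1 q.2)) (hs M.P₀))
    simp only [Function.comp_apply, Real.norm_eq_abs, abs_mul, abs_of_pos hq.1]
    calc _ ≤ d q.1 * (C / d q.1 + C / d q.1) := mul_le_mul_of_nonneg_left h4 hq.1.le
      _ = 2 * C := by have := hq.1; field_simp; ring
  have h4 := h1.sub h3
  rw [sub_zero] at h4
  refine h4.congr' ?_
  filter_upwards [tendsto_fst_probFilter.eventually (hd0.and hlt)] with q hq
  rw [hM.sq_sigmaHat hq.2, hM.sq_sigmaInf]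
  have := hq.1
  have e : d q.1 ^ (2 * γ + 1) / S.gap q.1 / d q.1 * d q.1 = d q.1 ^ (2 * γ + 1) / S.gap q.1 := by
    field_simp
  have hdef : empirical M.O (S.l₁ q.1) (S.l₂ q.1) q.2 = M.P₂ S q.1 q.2 := rfl
  rw [hdef]
  simp only [smoothed] at e ⊢
  linear_combination -((∫ o, kerAt M.K M.x (d q.1) o ∂(M.P₂ S q.1 q.2)) ^ 2 -
    (∫ o, kerAt M.K M.x (d q.1) o ∂M.P₀) ^ 2) * e

/-- Consistency of the estimator of `σ_∞`, relative to its order. -/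
theorem tendsto_sigmaHat (hM : M.IsSampled μ) (h : PowerLaw M.sigmaInf M.bias A B γ β)
    (hd : Tendsto d atTop (𝓝[>] 0)) (hgap : Tendsto (fun n => S.gap n / d n) atTop (𝓝 0)) :
    Tendsto (fun q : ℕ × Ω => M.sigmaHat S q.1 q.2 (d q.1) * d q.1 ^ γ) (probFilter μ) (𝓝 A) := by
  have hd0 := hd.eventually eventually_nhdsGT_pos
  have h1 := ((hgap.comp tendsto_fst_probFilter).mul
    (hM.tendsto_sq_sigmaHat_sub (S := S) h.γ_ge hd)).add
    (((h.σ_lim.pow 2).comp hd).comp tendsto_fst_probFilter)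
  rw [zero_mul, zero_add] at h1
  have h2 := h1.sqrt
  rw [Real.sqrt_sq h.A_pos.le] at h2
  refine h2.congr' ?_
  filter_upwards [tendsto_fst_probFilter.eventually (hd0.and S.gap_pos)] with q hq
  have hp := Real.rpow_pos_of_pos hq.1 γ
  have hs : 0 ≤ M.sigmaHat S q.1 q.2 (d q.1) := Real.sqrt_nonneg _
  rw [← Real.sqrt_sq (mul_nonneg hs hp.le)]
  congr 1
  simp only [Function.comp_apply]
  have e : d q.1 ^ (2 * γ + 1) = (d q.1 ^ γ) ^ 2 * d q.1 := by
    rw [sq, ← Real.rpow_add hq.1, ← Real.rpow_add_one hq.1.ne']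
    ring_nf
  have h3 := hq.1
  have h4 := hq.2
  rw [e]
  field_simp
  ring

/-- `σ̂ - σ = (σ̂² - σ²) / (σ̂ + σ)`, and the denominator times `δ^γ` tends to `2A > 0`. -/
theorem tendsto_sigmaHat_sub (hM : M.IsSampled μ) (h : PowerLaw M.sigmaInf M.bias A B γ β)
    (hd : Tendsto d atTop (𝓝[>] 0)) (hgap : Tendsto (fun n => S.gap n / d n) atTop (𝓝 0)) :
    Tendsto (fun q : ℕ × Ω => (M.sigmaHat S q.1 q.2 (d q.1) - M.sigmaInf (d q.1)) / S.gap q.1 *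
      d q.1 ^ (γ + 1)) (probFilter μ) (𝓝 0) := by
  have hd0 := hd.eventually eventually_nhdsGT_pos
  have hA := h.A_pos
  have h1 := (hM.tendsto_sigmaHat h hd hgap).add ((h.σ_lim.comp hd).comp tendsto_fst_probFilter)
  have h2 := (hM.tendsto_sq_sigmaHat_sub (S := S) h.γ_ge hd).div h1 (by positivity)
  rw [zero_div] at h2
  refine h2.congr' ?_
  filter_upwards [tendsto_fst_probFilter.eventually (hd0.and S.gap_pos),
    tendsto_fst_probFilter.eventually (hd.eventually h.eventually_σ_pos)] with q hq hσ
  have hp := Real.rpow_pos_of_pos hq.1 γ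
  have hs : 0 ≤ M.sigmaHat S q.1 q.2 (d q.1) := Real.sqrt_nonneg _
  simp only [Function.comp_apply, Pi.div_apply]
  have e : d q.1 ^ (2 * γ + 1) = (d q.1 ^ γ) ^ 2 * d q.1 := by
    rw [sq, ← Real.rpow_add hq.1, ← Real.rpow_add_one hq.1.ne']
    ring_nf
  have h3 := hq.2
  have h4 : M.sigmaHat S q.1 q.2 (d q.1) + M.sigmaInf (d q.1) ≠ 0 := by positivity
  rw [e, Real.rpow_add_one hq.1.ne', ← add_mul]
  field_simp
  ring

/-- Consistency of the estimator of `σ_∞'`, relative to its order. -/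
theorem tendsto_sigmaDer (hM : M.IsSampled μ) (h : PowerLaw M.sigmaInf M.bias A B γ β)
    (hd : Tendsto d atTop (𝓝[>] 0)) (hgap : Tendsto (fun n => S.gap n / d n) atTop (𝓝 0)) :
    Tendsto (fun q : ℕ × Ω => M.sigmaDer S q.1 q.2 (d q.1) * d q.1 ^ (γ + 1)) (probFilter μ)
      (𝓝 (-γ * A)) := by
  have hd0 := hd.eventually eventually_nhdsGT_pos
  have hd' := tendsto_add_of_tendsto_div hd S.gap_pos hgap
  have hd0' := hd'.eventually eventually_nhdsGT_pos
  have hratio : Tendsto (fun n => d n / (d n + S.gap n)) atTop (𝓝 1) :=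
    tendsto_div_of_mem_Icc hd0 hgap (by
      filter_upwards [S.gap_pos] with n hn
      exact ⟨by linarith, le_rfl⟩)
  have hgap' : Tendsto (fun n => S.gap n / (d n + S.gap n)) atTop (𝓝 0) := by
    have := hgap.mul hratio
    rw [zero_mul] at this
    refine this.congr' ?_
    filter_upwards [hd0] with n hn
    rw [div_mul_div_cancel₀ hn.ne']
  -- The estimated quotient is the deterministic one plus the errors of `σ̂` at `d + gap` and at
  -- `d`, both negligible even after division by `gap`.
  have h1 := (tendsto_finiteDifference h.diff_σ h.deriv_σ_lim hd S.gap_pos hgap).comp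
    (tendsto_fst_probFilter (μ := μ))
  have h2 := hM.tendsto_sigmaHat_sub h hd hgap
  have h3 := (hM.tendsto_sigmaHat_sub h hd' hgap').mul
    ((hratio.rpow_const (p := γ + 1) (Or.inl one_ne_zero)).comp tendsto_fst_probFilter)
  have h4 := (h1.add h3).sub h2
  rw [zero_mul, add_zero, sub_zero] at h4
  refine h4.congr' ?_
  filter_upwards [tendsto_fst_probFilter.eventually (hd0.and hd0')] with q hq
  have h5 := Real.rpow_pos_of_pos hq.2 (γ + 1)
  simp only [Function.comp_apply, sigmaDer]
  rw [Real.div_rpow hq.1.le hq.2.le]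
  field_simp
  ring

/-- Consistency of the estimator of `b₀'`, relative to its order. -/
theorem tendsto_biasDer (hM : M.IsSampled μ) (h : PowerLaw M.sigmaInf M.bias A B γ β)
    (hd : Tendsto d atTop (𝓝[>] 0)) (hgap : Tendsto (fun n => S.gap n / d n) atTop (𝓝 0))
    (hgapβ : Tendsto (fun n => S.gap n / d n ^ β) atTop (𝓝 0)) :
    Tendsto (fun q : ℕ × Ω => M.biasDer S q.1 q.2 (d q.1) * d q.1 ^ (1 - β)) (probFilter μ)
      (𝓝 B) := by
  obtain ⟨C, hC0, hC⟩ := hM.isKernel.exists_bound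
  have hprob := hM.isProb
  have hd0 := hd.eventually eventually_nhdsGT_pos
  have hd' := tendsto_add_of_tendsto_div hd S.gap_pos hgap
  have hd0' := hd'.eventually eventually_nhdsGT_pos
  have hlt := S.eventually_l₁_lt_l₂
  have hratio : Tendsto (fun n => d n / (d n + S.gap n)) atTop (𝓝 1) :=
    tendsto_div_of_mem_Icc hd0 hgap (by
      filter_upwards [S.gap_pos] with n hn
      exact ⟨by linarith, le_rfl⟩)
  have h1 := (tendsto_finiteDifference h.diff_b h.deriv_b_lim hd S.gap_pos hgap).comp
    (tendsto_fst_probFilter (μ := μ))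
  -- The crude bound `C/(d + gap) + C/d` on the kernel difference is enough: Chebyshev leaves the
  -- square of a bounded multiple of `gap / d^β`, which is why that ratio must vanish.
  have h2 := hM.tendsto_empirical
    (f := fun n o => kerAt M.K M.x (d n + S.gap n) o - kerAt M.K M.x (d n) o)
    (B := fun n => C / |d n + S.gap n| + C / |d n|) (w := fun n => d n ^ (1 - β) / S.gap n)
    (a := S.l₁) (b := S.l₂) (fun n => (hM.isKernel.measurable_kerAt_right _ _).sub
      (hM.isKernel.measurable_kerAt_right _ _))
    (fun n o => (abs_sub _ _).trans (add_le_add (hC _ _ _) (hC _ _ _))) hlt (by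
      have h2 := (hgapβ.mul ((hratio.const_mul C).add_const C)).pow 2
      rw [zero_mul, zero_pow two_ne_zero] at h2
      refine h2.congr' ?_
      filter_upwards [hd0, hd0', hlt, S.gap_pos] with n hn hn' hl hg
      have hp := Real.rpow_pos_of_pos hn β
      rw [div_eq_mul_inv _ (Nat.cast _), S.inv_m₂_eq hl, abs_of_pos hn, abs_of_pos hn',
        Real.rpow_sub hn, Real.rpow_one]
      field_simp)
  have h3 := h2.add h1
  rw [zero_add] at h3
  refine h3.congr' ?_
  filter_upwards [tendsto_fst_probFilter.eventually (hd0.and hlt)] with q hq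
  have : IsProbabilityMeasure (M.P₂ S q.1 q.2) := isProbabilityMeasure_empirical hq.2 q.2
  have hdef : empirical M.O (S.l₁ q.1) (S.l₂ q.1) q.2 = M.P₂ S q.1 q.2 := rfl
  simp only [Function.comp_apply, biasDer, hM.psi₂_eq hq.2, bias, hdef]
  rw [integral_sub (hM.isKernel.integrable_kerAt _ _ _) (hM.isKernel.integrable_kerAt _ _ _),
    integral_sub (hM.isKernel.integrable_kerAt _ _ _) (hM.isKernel.integrable_kerAt _ _ _)]
  simp only [smoothed]
  ring

end Model.IsSampled

/-! ### Exponents estimated with error `o_P(1/log n)`, and consistency of all the plug-in constants.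
-/

section LogScale

variable {ι : Type*} {l : Filter ι}

/-- Transfers an `o(1/log n)` error to the scale of any bandwidth whose logarithm is `O(log n)`;
combined with `tendsto_rpow_of_mul_log`, raising such a bandwidth to the error gives a factor
tending to 1. -/
theorem tendsto_mul_log_of_le {x d L : ι → ℝ} {C : ℝ} (h : Tendsto (fun i => x i * L i) l (𝓝 0))
    (hd : ∀ᶠ i in l, |Real.log (d i)| ≤ C * |L i|) :
    Tendsto (fun i => x i * Real.log (d i)) l (𝓝 0) := by
  have h1 := h.abs.mul_const C
  rw [abs_zero, zero_mul] at h1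
  refine squeeze_zero_norm' ?_ h1
  filter_upwards [hd] with i hi
  rw [norm_mul, abs_mul, Real.norm_eq_abs, Real.norm_eq_abs, mul_assoc, mul_comm |L i|]
  gcongr

theorem tendsto_rpow_of_mul_log {x d : ι → ℝ} (hd : ∀ᶠ i in l, 0 < d i)
    (h : Tendsto (fun i => x i * Real.log (d i)) l (𝓝 0)) :
    Tendsto (fun i => d i ^ x i) l (𝓝 1) := by
  have h1 := (Real.continuous_exp.tendsto 0).comp h
  rw [Real.exp_zero] at h1
  refine h1.congr' ?_
  filter_upwards [hd] with i hi
  rw [Function.comp_apply, Real.rpow_def_of_pos hi, mul_comm]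

theorem tendsto_of_sub_mul {x L : ι → ℝ} {a : ℝ} (hL : Tendsto L l atTop)
    (h : Tendsto (fun i => (x i - a) * L i) l (𝓝 0)) : Tendsto x l (𝓝 a) := by
  have h1 := (h.mul hL.inv_tendsto_atTop).add_const a
  rw [mul_zero, zero_add] at h1
  refine h1.congr' ?_
  filter_upwards [hL.eventually_gt_atTop 0] with i hi
  simp only [Pi.inv_apply]
  field_simp
  ring

end LogScale

theorem tendsto_log_probFilter {Ω : Type*} [MeasurableSpace Ω] (μ : Measure Ω) :
    Tendsto (fun q : ℕ × Ω => Real.log q.1) (probFilter μ) atTop :=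
  (Real.tendsto_log_atTop.comp tendsto_natCast_atTop_atTop).comp tendsto_fst_probFilter

theorem SlowerThan.abs_log_le {r : ℝ} {d : ℕ → ℝ} (hd : SlowerThan r d) :
    ∀ᶠ n : ℕ in atTop, |Real.log (d n)| ≤ r * |Real.log n| := by
  filter_upwards [hd.pos, hd.tendsto_zero.eventually_lt_const one_pos,
    hd.slow.bound one_pos, eventually_ge_atTop 1] with n h1 h2 h3 hn
  have hn1 : (1 : ℝ) ≤ n := by exact_mod_cast hn
  have hn0 : (0 : ℝ) < n := by linarith
  have hp := Real.rpow_pos_of_pos hn0 (-r)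
  rw [Real.norm_of_nonneg hp.le, one_mul, Real.norm_of_nonneg h1.le] at h3
  have h4 := Real.log_le_log hp h3
  rw [Real.log_rpow hn0] at h4
  rw [abs_of_nonpos (Real.log_nonpos h1.le h2.le), abs_of_nonneg (Real.log_nonneg hn1)]
  linarith

theorem SlowerThan.tendsto_nhdsGT {r : ℝ} {d : ℕ → ℝ} (hd : SlowerThan r d) :
    Tendsto d atTop (𝓝[>] 0) := tendsto_nhdsWithin_iff.2 ⟨hd.tendsto_zero, hd.pos⟩

/-- A function following a power law at the first two pilot bandwidths has a log-log slope which
estimates the exponent at a rate faster than `1 / log n`. -/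
theorem tendsto_slope {Ω : Type*} [MeasurableSpace Ω] {μ : Measure Ω} {T : Pilot} {r a C : ℝ}
    (hT : T.Admissible r) (hC : C ≠ 0) {f : ℕ → Ω → ℝ → ℝ}
    (h1 : Tendsto (fun q : ℕ × Ω => f q.1 q.2 (T.d₁ q.1) * T.d₁ q.1 ^ (-a)) (probFilter μ) (𝓝 C))
    (h2 : Tendsto (fun q : ℕ × Ω => f q.1 q.2 (T.d₂ q.1) * T.d₂ q.1 ^ (-a)) (probFilter μ) (𝓝 C)) :
    Tendsto (fun q : ℕ × Ω => (Model.slope T q.1 (f q.1 q.2) - a) * Real.log q.1)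
      (probFilter μ) (𝓝 0) := by
  have hlog : ∀ {d : ℕ → ℝ}, SlowerThan r d →
      Tendsto (fun q : ℕ × Ω => f q.1 q.2 (d q.1) * d q.1 ^ (-a)) (probFilter μ) (𝓝 C) →
      Tendsto (fun q : ℕ × Ω => Real.log |f q.1 q.2 (d q.1)| - a * Real.log (d q.1))
        (probFilter μ) (𝓝 (Real.log |C|)) := by
    intro d hd h
    refine (h.abs.log (abs_pos.2 hC).ne').congr' ?_
    filter_upwards [tendsto_fst_probFilter.eventually hd.pos, h.eventually_ne hC] with q hq hne
    have hp := Real.rpow_pos_of_pos hq (-a)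
    rw [abs_mul, abs_of_pos hp, Real.log_mul (abs_ne_zero.2 (left_ne_zero_of_mul hne)) hp.ne',
      Real.log_rpow hq]
    ring
  -- The unknown constant `log |C|` cancels in the difference, leaving an `o_P(1)` numerator; the
  -- separation of the pilots bounds `log n` over the denominator.
  have h3 := (hlog hT.slow₂ h2).sub (hlog hT.slow₁ h1)
  rw [sub_self] at h3
  obtain ⟨c, hc⟩ := hT.separated.bound
  have hbd : IsBoundedUnder (· ≤ ·) (probFilter μ) (norm ∘ fun q : ℕ × Ω =>
      Real.log q.1 / (Real.log (T.d₂ q.1) - Real.log (T.d₁ q.1))) := by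
    refine isBoundedUnder_of_eventually_le (a := |c|) ?_
    filter_upwards [tendsto_fst_probFilter.eventually hc] with q hq
    rw [Function.comp_apply, norm_div]
    refine div_le_of_le_mul₀ (norm_nonneg _) (abs_nonneg _) (hq.trans ?_)
    gcongr
    exact le_abs_self c
  refine (h3.zero_mul_isBoundedUnder_le hbd).congr' ?_
  filter_upwards [tendsto_fst_probFilter.eventually hc,
    (tendsto_log_probFilter μ).eventually_gt_atTop 0] with q hq hn
  have hne : Real.log (T.d₂ q.1) - Real.log (T.d₁ q.1) ≠ 0 := by
    intro h0
    rw [h0, norm_zero, mul_zero, Real.norm_of_nonneg hn.le] at hq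
    linarith
  rw [Model.slope]
  field_simp
  ring

namespace Split

variable (S : Split)

theorem abs_log_m₃_le : ∀ᶠ n : ℕ in atTop, |Real.log (S.m₃ n)| ≤ 1 * |Real.log n| := by
  filter_upwards [S.tendsto_m₃.eventually_ge_atTop 1] with n hn
  have h1 : S.m₃ n ≤ n := sub_le_self _ (Nat.cast_nonneg _)
  rw [one_mul, abs_of_nonneg (Real.log_nonneg hn), abs_of_nonneg (Real.log_nonneg (hn.trans h1))]
  exact Real.log_le_log (by linarith) h1

end Split

/-- Replacing a known exponent by an estimate of rate `1 / log n` does not matter. -/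
theorem tendsto_mul_rpow_estimate {Ω : Type*} [MeasurableSpace Ω] {μ : Measure Ω} {r a C : ℝ}
    {d : ℕ → ℝ} {f x : ℕ × Ω → ℝ} (hd : SlowerThan r d)
    (hf : Tendsto (fun q : ℕ × Ω => f q * d q.1 ^ a) (probFilter μ) (𝓝 C))
    (hx : Tendsto (fun q : ℕ × Ω => (x q - a) * Real.log q.1) (probFilter μ) (𝓝 0)) :
    Tendsto (fun q : ℕ × Ω => f q * d q.1 ^ x q) (probFilter μ) (𝓝 C) := by
  have h1 := hf.mul (tendsto_rpow_of_mul_log (tendsto_fst_probFilter.eventually hd.pos)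
    (tendsto_mul_log_of_le hx (tendsto_fst_probFilter.eventually hd.abs_log_le)))
  rw [mul_one] at h1
  refine h1.congr' ?_
  filter_upwards [tendsto_fst_probFilter.eventually hd.pos] with q hq
  rw [mul_assoc, ← Real.rpow_add hq]
  ring_nf

namespace PowerLaw

variable {σ b : ℝ → ℝ} {A B γ β : ℝ} {S : Split}

/-- The exponent `1/(4(1+β))` serves two purposes: both it and its product with `β` are at most
`1/4`, the exponent of the increment. The second is used in `tendsto_gap_div_rpow_β`. -/
theorem tendsto_gap_div {d : ℕ → ℝ} (h : PowerLaw σ b A B γ β)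
    (hd : SlowerThan (1 / (4 * (1 + β))) d) :
    Tendsto (fun n => S.gap n / d n) atTop (𝓝 0) := by
  have hβ := h.β_pos
  have := S.tendsto_gap_div_rpow one_pos (by
    rw [mul_one, div_le_div_iff₀ (by positivity) (by norm_num)]; linarith) hd
  simpa using this

theorem tendsto_gap_div_rpow_β {d : ℕ → ℝ} (h : PowerLaw σ b A B γ β)
    (hd : SlowerThan (1 / (4 * (1 + β))) d) :
    Tendsto (fun n => S.gap n / d n ^ β) atTop (𝓝 0) := by
  have hβ := h.β_pos
  refine S.tendsto_gap_div_rpow hβ ?_ hd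
  rw [div_mul_eq_mul_div, div_le_div_iff₀ (by positivity) (by norm_num)]
  linarith

end PowerLaw

namespace Model.IsSampled

variable {Ω : Type*} [MeasurableSpace Ω] {M : Model Ω} {μ : Measure Ω} [IsProbabilityMeasure μ]
  {A B γ β : ℝ} {S : Split} {T : Pilot}

theorem tendsto_betaHat (hM : M.IsSampled μ) (h : PowerLaw M.sigmaInf M.bias A B γ β)
    (hT : T.Admissible (1 / (4 * (1 + β)))) :
    Tendsto (fun q : ℕ × Ω => (M.betaHat S T q.1 q.2 - β) * Real.log q.1) (probFilter μ)
      (𝓝 0) := by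
  have hlim : ∀ {d : ℕ → ℝ}, SlowerThan (1 / (4 * (1 + β))) d →
      Tendsto (fun q : ℕ × Ω => M.biasDer S q.1 q.2 (d q.1) * d q.1 ^ (-(β - 1)))
        (probFilter μ) (𝓝 B) := fun hd => by
    rw [neg_sub]
    exact hM.tendsto_biasDer h hd.tendsto_nhdsGT (h.tendsto_gap_div hd)
      (h.tendsto_gap_div_rpow_β hd)
  refine (tendsto_slope hT h.B_ne (hlim hT.slow₁) (hlim hT.slow₂)).congr fun q => ?_
  rw [betaHat]
  ring

theorem tendsto_gammaHat (hM : M.IsSampled μ) (h : PowerLaw M.sigmaInf M.bias A B γ β)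
    (hT : T.Admissible (1 / (4 * (1 + β)))) :
    Tendsto (fun q : ℕ × Ω => (M.gammaHat S T q.1 q.2 - γ) * Real.log q.1) (probFilter μ)
      (𝓝 0) := by
  have hlim : ∀ {d : ℕ → ℝ}, SlowerThan (1 / (4 * (1 + β))) d →
      Tendsto (fun q : ℕ × Ω => M.sigmaHat S q.1 q.2 (d q.1) * d q.1 ^ (-(-γ)))
        (probFilter μ) (𝓝 A) := fun hd => by
    rw [neg_neg]
    exact hM.tendsto_sigmaHat h hd.tendsto_nhdsGT (h.tendsto_gap_div hd)
  have h1 := (tendsto_slope hT h.A_pos.ne' (hlim hT.slow₁) (hlim hT.slow₂)).neg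
  rw [neg_zero] at h1
  refine h1.congr fun q => ?_
  rw [gammaHat]
  ring

theorem tendsto_nuHat (hM : M.IsSampled μ) (h : PowerLaw M.sigmaInf M.bias A B γ β)
    (hT : T.Admissible (1 / (4 * (1 + β)))) :
    Tendsto (fun q : ℕ × Ω => (M.nuHat S T q.1 q.2 - (-(γ + 1))) * Real.log q.1) (probFilter μ)
      (𝓝 0) := by
  have hlim : ∀ {d : ℕ → ℝ}, SlowerThan (1 / (4 * (1 + β))) d →
      Tendsto (fun q : ℕ × Ω => M.sigmaDer S q.1 q.2 (d q.1) * d q.1 ^ (-(-(γ + 1))))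
        (probFilter μ) (𝓝 (-γ * A)) := fun hd => by
    rw [neg_neg]
    exact hM.tendsto_sigmaDer h hd.tendsto_nhdsGT (h.tendsto_gap_div hd)
  have hne : -γ * A ≠ 0 := mul_ne_zero (neg_ne_zero.2 h.γ_pos.ne') h.A_pos.ne'
  exact tendsto_slope hT hne (hlim hT.slow₁) (hlim hT.slow₂)

theorem tendsto_cBias (hM : M.IsSampled μ) (h : PowerLaw M.sigmaInf M.bias A B γ β)
    (hT : T.Admissible (1 / (4 * (1 + β)))) :
    Tendsto (fun q : ℕ × Ω => M.cBias S T q.1 q.2) (probFilter μ) (𝓝 B) := by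
  refine tendsto_mul_rpow_estimate hT.slow₃ (hM.tendsto_biasDer h hT.slow₃.tendsto_nhdsGT
    (h.tendsto_gap_div hT.slow₃) (h.tendsto_gap_div_rpow_β hT.slow₃)) ?_
  refine (neg_zero (G := ℝ) ▸ (hM.tendsto_betaHat h hT (S := S)).neg).congr fun q => ?_
  ring

theorem tendsto_cSigma (hM : M.IsSampled μ) (h : PowerLaw M.sigmaInf M.bias A B γ β)
    (hT : T.Admissible (1 / (4 * (1 + β)))) :
    Tendsto (fun q : ℕ × Ω => M.cSigma S T q.1 q.2) (probFilter μ) (𝓝 A) :=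
  tendsto_mul_rpow_estimate hT.slow₃ (hM.tendsto_sigmaHat h hT.slow₃.tendsto_nhdsGT
    (h.tendsto_gap_div hT.slow₃)) (hM.tendsto_gammaHat h hT)

theorem tendsto_cSigmaDer (hM : M.IsSampled μ) (h : PowerLaw M.sigmaInf M.bias A B γ β)
    (hT : T.Admissible (1 / (4 * (1 + β)))) :
    Tendsto (fun q : ℕ × Ω => M.cSigmaDer S T q.1 q.2) (probFilter μ) (𝓝 (-γ * A)) := by
  refine tendsto_mul_rpow_estimate hT.slow₃ (hM.tendsto_sigmaDer h hT.slow₃.tendsto_nhdsGT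
    (h.tendsto_gap_div hT.slow₃)) ?_
  refine (neg_zero (G := ℝ) ▸ (hM.tendsto_nuHat h hT (S := S)).neg).congr fun q => ?_
  ring

/-- Since `ν̂` estimates `-(γ+1)`, the quantity inverted estimates `2(β+γ)`. Inversion away from
zero preserves the `o_P(1/log n)` error. -/
theorem tendsto_rHat (hM : M.IsSampled μ) (h : PowerLaw M.sigmaInf M.bias A B γ β)
    (hT : T.Admissible (1 / (4 * (1 + β)))) :
    Tendsto (fun q : ℕ × Ω => (M.rHat S T q.1 q.2 - PowerLaw.rate γ β) * Real.log q.1)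
      (probFilter μ) (𝓝 0) := by
  have hγ := h.γ_pos
  have hβ := h.β_pos
  have hu : Tendsto (fun q : ℕ × Ω => (2 * M.betaHat S T q.1 q.2 - 1 + M.gammaHat S T q.1 q.2 -
      M.nuHat S T q.1 q.2 - 2 * (β + γ)) * Real.log q.1) (probFilter μ) (𝓝 0) := by
    have h1 := (((hM.tendsto_betaHat h hT (S := S)).const_mul 2).add
      (hM.tendsto_gammaHat h hT (S := S))).sub (hM.tendsto_nuHat h hT (S := S))
    rw [mul_zero, add_zero, sub_zero] at h1
    refine h1.congr fun q => ?_
    ring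
  have hu' := tendsto_of_sub_mul (tendsto_log_probFilter μ) hu
  have hne : 2 * (β + γ) ≠ 0 := by positivity
  have h2 := ((hu.neg.mul (hu'.inv₀ hne)).mul_const (2 * (β + γ))⁻¹)
  rw [neg_zero, zero_mul, zero_mul] at h2
  refine h2.congr' ?_
  filter_upwards [hu'.eventually_ne hne] with q hq
  rw [rHat, PowerLaw.rate, inv_sub_inv hq hne]
  field_simp
  ring

theorem tendsto_cHat (hM : M.IsSampled μ) (h : PowerLaw M.sigmaInf M.bias A B γ β)
    (hT : T.Admissible (1 / (4 * (1 + β)))) :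
    Tendsto (fun q : ℕ × Ω => M.cHat S T q.1 q.2) (probFilter μ)
      (𝓝 (PowerLaw.optConst A B γ β)) := by
  have hγ := h.γ_pos
  have hβ := h.β_pos
  have hlog := tendsto_log_probFilter μ
  have h1 := ((((hM.tendsto_cSigma h hT (S := S)).mul (hM.tendsto_cSigmaDer h hT (S := S))).mul
    (tendsto_of_sub_mul hlog (hM.tendsto_betaHat h hT (S := S)))).abs).div
      ((hM.tendsto_cBias h hT (S := S)).pow 2) (pow_ne_zero 2 h.B_ne)
  have hval : |A * (-γ * A) * β| / B ^ 2 = γ * β * A ^ 2 / B ^ 2 := by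
    rw [show A * (-γ * A) * β = -(γ * β * A ^ 2) by ring, abs_neg, abs_of_nonneg (by positivity)]
  rw [hval] at h1
  exact h1.rpow (tendsto_of_sub_mul hlog (hM.tendsto_rHat h hT (S := S))) (Or.inl h.base_pos.ne')

/-- The selected bandwidth is of order `m₃ ^ (-(r₀ + ε))`. -/
theorem tendsto_deltaHat (hM : M.IsSampled μ) (h : PowerLaw M.sigmaInf M.bias A B γ β)
    (hT : T.Admissible (1 / (4 * (1 + β)))) (ε : ℝ) :
    Tendsto (fun q : ℕ × Ω => M.deltaHat S T ε q.1 q.2 * S.m₃ q.1 ^ (PowerLaw.rate γ β + ε))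
      (probFilter μ) (𝓝 (PowerLaw.optConst A B γ β)) := by
  have hm : ∀ᶠ q : ℕ × Ω in probFilter μ, 0 < S.m₃ q.1 :=
    tendsto_fst_probFilter.eventually (S.tendsto_m₃.eventually_gt_atTop 0)
  have h1 := (hM.tendsto_rHat h hT (S := S)).neg
  rw [neg_zero] at h1
  have h2 := tendsto_rpow_of_mul_log hm (tendsto_mul_log_of_le
    (h1.congr fun q => (neg_mul _ _).symm) (tendsto_fst_probFilter.eventually S.abs_log_m₃_le))
  have h3 := (hM.tendsto_cHat h hT (S := S)).mul h2
  rw [mul_one] at h3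
  refine h3.congr' ?_
  filter_upwards [hm] with q hq
  rw [deltaHat, mul_assoc, ← Real.rpow_add hq]
  ring_nf

end Model.IsSampled

/-! ### A quantitative central limit theorem through characteristic functions. -/

section CharFun

theorem norm_exp_mul_I_sub_le {y : ℝ} (hy : |y| ≤ 1) :
    ‖Complex.exp (y * Complex.I) - (1 + y * Complex.I - (y ^ 2 / 2 : ℝ))‖ ≤ |y| ^ 3 := by
  have hn : ‖(y : ℂ) * Complex.I‖ = |y| := by simp
  have h := Complex.exp_bound (x := y * Complex.I) (by rwa [hn]) (n := 3) (by norm_num)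
  rw [hn] at h
  have e : ∑ m ∈ Finset.range 3, ((y : ℂ) * Complex.I) ^ m / (m.factorial : ℂ) =
      1 + y * Complex.I - (y ^ 2 / 2 : ℝ) := by
    simp only [Finset.sum_range_succ, Finset.sum_range_zero, mul_pow, Complex.I_sq, Nat.factorial]
    push_cast
    ring
  rw [e] at h
  refine h.trans (mul_le_of_le_one_right (by positivity) ?_)
  norm_num [Nat.factorial]

/-- Passes from one summand to `m` independent ones: inside the unit disc, taking `m`-th powers
multiplies distances by at most `m`. -/
theorem norm_pow_sub_pow_le {z w : ℂ} (hz : ‖z‖ ≤ 1) (hw : ‖w‖ ≤ 1) (m : ℕ) :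
    ‖z ^ m - w ^ m‖ ≤ m * ‖z - w‖ := by
  induction m with
  | zero => simp
  | succ k ih =>
    have e : z ^ (k + 1) - w ^ (k + 1) = z ^ k * (z - w) + (z ^ k - w ^ k) * w := by ring
    rw [e]
    refine (norm_add_le _ _).trans ?_
    rw [norm_mul, norm_mul, norm_pow]
    have h1 : ‖z‖ ^ k * ‖z - w‖ ≤ 1 * ‖z - w‖ := by
      gcongr
      exact pow_le_one₀ (norm_nonneg _) hz
    have h2 : ‖z ^ k - w ^ k‖ * ‖w‖ ≤ k * ‖z - w‖ * 1 := by gcongr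
    push_cast
    linarith

variable {α : Type*} [MeasurableSpace α] {P : Measure α} [IsProbabilityMeasure P] {Y : α → ℝ}

theorem norm_integral_exp_mul_I_le (P : Measure α) [IsProbabilityMeasure P] (Y : α → ℝ) :
    ‖∫ a, Complex.exp (Y a * Complex.I) ∂P‖ ≤ 1 := by
  simpa using norm_integral_le_of_norm_le_const (μ := P)
    (ae_of_all _ fun a => (Complex.norm_exp_ofReal_mul_I (Y a)).le)

/-- The characteristic function of a small centred random variable is close to a Gaussian one. -/
theorem norm_integral_exp_sub_le {B v : ℝ} (hY : AEStronglyMeasurable Y P) (h0 : ∫ a, Y a ∂P = 0)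
    (hv : ∫ a, Y a ^ 2 ∂P = v) (hB : ∀ a, |Y a| ≤ B) (hB1 : B ≤ 1) :
    ‖∫ a, Complex.exp (Y a * Complex.I) ∂P - Real.exp (-v / 2)‖ ≤ B * v + v ^ 2 := by
  obtain ⟨a⟩ : Nonempty α := P.nonempty_of_neZero
  have hB0 : 0 ≤ B := (abs_nonneg _).trans (hB a)
  have hi : Integrable Y P := Integrable.of_bound hY B (ae_of_all _ hB)
  have hi2 : Integrable (fun a => Y a ^ 2) P := by
    refine Integrable.of_bound (hY.pow 2) (B ^ 2) (ae_of_all _ fun a => ?_)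
    rw [Real.norm_eq_abs, abs_pow]
    gcongr
    exact hB a
  have hv0 : 0 ≤ v := hv ▸ integral_nonneg fun _ => sq_nonneg _
  have hv1 : v ≤ 1 := by
    rw [← hv]
    have : ∫ a, Y a ^ 2 ∂P ≤ ∫ _, (1 : ℝ) ∂P := by
      refine integral_mono hi2 (integrable_const _) fun a => ?_
      have := (hB a).trans hB1
      rw [← sq_abs]
      exact pow_le_one₀ (abs_nonneg _) this
    simpa using this
  have hie : Integrable (fun a => Complex.exp (Y a * Complex.I)) P := by
    refine Integrable.of_bound ?_ 1 (ae_of_all _ fun a => (Complex.norm_exp_ofReal_mul_I _).le)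
    exact Complex.continuous_exp.comp_aestronglyMeasurable
      ((Complex.continuous_ofReal.comp_aestronglyMeasurable hY).mul_const _)
  have hi' : Integrable (fun a => (Y a : ℂ) * Complex.I) P := hi.ofReal.mul_const _
  have hi2' : Integrable (fun a => ((Y a ^ 2 / 2 : ℝ) : ℂ)) P := (hi2.div_const 2).ofReal
  have hip : Integrable (fun a => 1 + (Y a : ℂ) * Complex.I - (Y a ^ 2 / 2 : ℝ)) P :=
    ((integrable_const _).add hi').sub hi2'
  have hpoly : ∫ a, (1 + (Y a : ℂ) * Complex.I - (Y a ^ 2 / 2 : ℝ)) ∂P = (1 - v / 2 : ℝ) := by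
    rw [integral_sub (f := fun a => 1 + (Y a : ℂ) * Complex.I) ((integrable_const _).add hi') hi2',
      integral_add (integrable_const _) hi',
      integral_mul_const, integral_complex_ofReal, integral_complex_ofReal, h0, integral_div, hv]
    simp
  -- The cubic Taylor remainder is bounded by `B Y²`, so no third moment appears.
  have h1 : ‖∫ a, Complex.exp (Y a * Complex.I) ∂P - (1 - v / 2 : ℝ)‖ ≤ B * v := by
    rw [← hpoly, ← integral_sub hie hip]
    calc _ ≤ ∫ a, B * Y a ^ 2 ∂P := by
          refine norm_integral_le_of_norm_le (hi2.const_mul B) (ae_of_all _ fun a => ?_)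
          refine (norm_exp_mul_I_sub_le ((hB a).trans hB1)).trans ?_
          rw [pow_succ', ← sq_abs (Y a)]
          gcongr
          exact hB a
      _ = B * v := by rw [integral_const_mul, hv]
  have h2 : ‖((1 - v / 2 : ℝ) : ℂ) - Real.exp (-v / 2)‖ ≤ v ^ 2 := by
    rw [← Complex.ofReal_sub, Complex.norm_real, Real.norm_eq_abs, abs_sub_comm]
    have h3 := Real.abs_exp_sub_one_sub_id_le (x := -v / 2)
      (by rw [abs_div, abs_neg, abs_of_nonneg hv0, abs_of_pos two_pos]; linarith)
    rw [show Real.exp (-v / 2) - (1 - v / 2) = Real.exp (-v / 2) - 1 - -v / 2 by ring]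
    nlinarith
  calc _ ≤ _ := norm_sub_le_norm_sub_add_norm_sub _ ((1 - v / 2 : ℝ) : ℂ) _
    _ ≤ _ := add_le_add h1 h2

end CharFun

/-- Integration against independent variables, one at a time. -/
theorem integral_comp_of_indepFun {Ω E F : Type*} [MeasurableSpace Ω] {μ : Measure Ω}
    [IsProbabilityMeasure μ] [MeasurableSpace E] [MeasurableSpace F] {X : Ω → E} {Y : Ω → F}
    (hX : Measurable X) (hY : Measurable Y) (hXY : IndepFun X Y μ) {g : E × F → ℂ}
    (hg : StronglyMeasurable g) {c : ℝ} (hc : ∀ z, ‖g z‖ ≤ c) :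
    ∫ ω, g (X ω, Y ω) ∂μ = ∫ ω, ∫ ω', g (X ω, Y ω') ∂μ ∂μ := by
  have h1 : IsProbabilityMeasure (μ.map X) := Measure.isProbabilityMeasure_map hX.aemeasurable
  have h2 : IsProbabilityMeasure (μ.map Y) := Measure.isProbabilityMeasure_map hY.aemeasurable
  have hprod := (indepFun_iff_map_prod_eq_prod_map_map hX.aemeasurable hY.aemeasurable).1 hXY
  rw [← integral_map (φ := fun ω => (X ω, Y ω)) (hX.prodMk hY).aemeasurable
    hg.aestronglyMeasurable, hprod, integral_prod _ (Integrable.of_bound hg.aestronglyMeasurable c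
      (ae_of_all _ hc)), integral_map hX.aemeasurable
        hg.integral_prod_right'.aestronglyMeasurable]
  refine integral_congr_ae (ae_of_all _ fun ω => ?_)
  exact integral_map hY.aemeasurable
    (hg.comp_measurable measurable_prodMk_left).aestronglyMeasurable

namespace Model.IsSampled

variable {Ω : Type*} [MeasurableSpace Ω] {M : Model Ω} {μ : Measure Ω}

/-- A quantitative central limit theorem for the empirical mean of a bounded function. -/
theorem norm_integral_exp_empirical_sub_le (hM : M.IsSampled μ) {f : ℝ → ℝ} (hf : Measurable f)
    {B v θ : ℝ} (hB : ∀ o, |f o| ≤ B)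
    (hv : ∫ o, f o ^ 2 ∂M.P₀ - (∫ o, f o ∂M.P₀) ^ 2 = v) {a b : ℕ} (hab : a < b)
    (hη : |θ| * (2 * B) / (b - a : ℕ) ≤ 1) :
    ‖∫ ω, Complex.exp ((θ * (∫ o, f o ∂(empirical M.O a b ω) - ∫ o, f o ∂M.P₀) : ℝ) * Complex.I) ∂μ
      - Real.exp (-(θ ^ 2 * v / (b - a : ℕ)) / 2)‖ ≤
      |θ| * (2 * B) / (b - a : ℕ) * (θ ^ 2 * v / (b - a : ℕ)) +
        (θ ^ 2 * v / (b - a : ℕ)) ^ 2 / (b - a : ℕ) := by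
  have hprob := hM.isProb
  set m : ℕ := b - a with hm
  have hm0 : 0 < m := by omega
  have hmR : (0 : ℝ) < m := by exact_mod_cast hm0
  set e := ∫ o, f o ∂M.P₀ with he
  have hint : Integrable f M.P₀ := Integrable.of_bound hf.aestronglyMeasurable B (ae_of_all _ hB)
  have hint2 : Integrable (fun o => f o ^ 2) M.P₀ := by
    refine Integrable.of_bound (hf.pow_const 2).aestronglyMeasurable (B ^ 2)
      (ae_of_all _ fun o => ?_)
    rw [Real.norm_eq_abs, abs_pow]
    gcongr
    exact hB o
  have heB : |e| ≤ B := by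
    simpa using norm_integral_le_of_norm_le_const (μ := M.P₀) (f := f) (ae_of_all _ hB)
  set g : ℝ → ℝ := fun o => θ / m * (f o - e) with hgdef
  have hg : Measurable g := by fun_prop
  -- the statistic is a sum of independent variables
  have hsum : ∀ ω, θ * (∫ o, f o ∂(empirical M.O a b ω) - e) =
      ∑ i ∈ Finset.Ico a b, g (M.O i ω) := by
    intro ω
    simp only [integral_empirical, hgdef, ← Finset.mul_sum, Finset.sum_sub_distrib,
      Finset.sum_const, Nat.card_Ico, nsmul_eq_mul, ← hm]
    field_simp
  -- The scale `θ/m` is absorbed into `g`, so independence is needed only for characteristic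
  -- functions at the point 1.
  have hchar : ∫ ω, Complex.exp ((θ * (∫ o, f o ∂(empirical M.O a b ω) - e) : ℝ) * Complex.I) ∂μ =
      (∫ o, Complex.exp (g o * Complex.I) ∂M.P₀) ^ m := by
    have h1 := ((hM.indep.comp (fun _ => g) (fun _ => hg)).restrict (Finset.Ico a b)).charFun_map_fun_finsetSum_eq_prod
      (s := Finset.Ico a b) (fun i _ => (hg.comp (hM.measurable i)).aemeasurable)
    have h2 := congrFun h1 1
    have h3 : ∀ i, charFun (μ.map (g ∘ M.O i)) 1 = ∫ o, Complex.exp (g o * Complex.I) ∂M.P₀ := by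
      intro i
      rw [← Measure.map_map hg (hM.measurable i), hM.map_eq, charFun_apply_real,
        integral_map hg.aemeasurable (by fun_prop)]
      simp
    rw [Finset.prod_apply] at h2
    simp only [h3, Finset.prod_const, Nat.card_Ico, ← hm] at h2
    rw [← h2, charFun_apply_real, integral_map]
    · simp only [hsum, Function.comp_apply, Complex.ofReal_one, one_mul]
    · exact (Finset.measurable_fun_sum _ fun i _ => hg.comp (hM.measurable i)).aemeasurable
    · fun_prop
  have hone := norm_integral_exp_sub_le (P := M.P₀) (Y := g) (B := |θ| * (2 * B) / m)
    (v := θ ^ 2 * v / m ^ 2) hg.aestronglyMeasurable ?_ ?_ ?_ hη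
  · rw [hchar]
    -- The Gaussian factor is also an `m`-th power, so the comparison reduces to one summand.
    have hexp : (Real.exp (-(θ ^ 2 * v / m) / 2) : ℂ) =
        (Real.exp (-(θ ^ 2 * v / m ^ 2) / 2) : ℂ) ^ m := by
      rw [← Complex.ofReal_pow, ← Real.exp_nat_mul]
      congr 2
      field_simp
    rw [hexp]
    have hv0 : 0 ≤ v := by
      rw [← hv]
      have h1 := integral_sq_sub_const hint hint2 e
      have h2 : 0 ≤ ∫ o, (f o - e) ^ 2 ∂M.P₀ := integral_nonneg fun _ => sq_nonneg _
      rw [← he] at h1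
      linarith
    refine (norm_pow_sub_pow_le (norm_integral_exp_mul_I_le _ _) ?_ m).trans ?_
    · rw [Complex.norm_real, Real.norm_of_nonneg (Real.exp_pos _).le, Real.exp_le_one_iff]
      have : 0 ≤ θ ^ 2 * v / m ^ 2 := by positivity
      linarith
    · refine (mul_le_mul_of_nonneg_left hone hmR.le).trans (le_of_eq ?_)
      field_simp
  · rw [hgdef, integral_const_mul, integral_sub hint (integrable_const _)]
    simp [he]
  · simp only [hgdef, mul_pow]
    rw [integral_const_mul, integral_sq_sub_const hint hint2, ← he, ← hv]
    field_simp
    ring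
  · intro o
    simp only [hgdef]
    rw [abs_mul, abs_div, abs_of_pos hmR, div_mul_eq_mul_div]
    gcongr
    have := abs_sub (f o) e
    linarith [hB o]

end Model.IsSampled

/-! ### Measurability of the estimators with respect to the first two subsamples. -/

section Measurability

variable {Ω : Type*} [MeasurableSpace Ω]

theorem measurable_integral_empirical {O : ℕ → Ω → ℝ} {a b : ℕ}
    (hO : ∀ i ∈ Finset.Ico a b, Measurable (O i)) {g : Ω × ℝ → ℝ} (hg : Measurable g) :
    Measurable fun ω => ∫ o, g (ω, o) ∂(empirical O a b ω) := by
  simp only [fun ω => integral_empirical O a b ω fun o => g (ω, o)]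
  exact (Finset.measurable_fun_sum _ fun i hi =>
    hg.comp (measurable_id.prodMk (hO i hi))).const_mul _

theorem IsKernel.measurable_smoothed_empirical {K : ℝ → ℝ} {O : ℕ → Ω → ℝ} {a b : ℕ}
    (hK : IsKernel K) (x : ℝ) (hO : ∀ i ∈ Finset.Ico a b, Measurable (O i)) {D : Ω → ℝ}
    (hD : Measurable D) : Measurable fun ω => smoothed K x (D ω) (empirical O a b ω) :=
  measurable_integral_empirical hO (g := fun z => kerAt K x (D z.1) z.2)
    ((hK.measurable_kerAt x).comp ((hD.comp measurable_fst).prodMk measurable_snd))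

theorem IsKernel.measurable_grad_empirical {K : ℝ → ℝ} {O : ℕ → Ω → ℝ} {a b : ℕ}
    (hK : IsKernel K) (x : ℝ) (hO : ∀ i ∈ Finset.Ico a b, Measurable (O i)) {D : Ω → ℝ}
    (hD : Measurable D) :
    Measurable fun z : Ω × ℝ => grad K x (D z.1) (empirical O a b z.1) z.2 :=
  ((hK.measurable_kerAt x).comp ((hD.comp measurable_fst).prodMk measurable_snd)).sub
    ((hK.measurable_smoothed_empirical x hO hD).comp measurable_fst)

namespace Model

variable {M : Model Ω} {S : Split} {T : Pilot} {n : ℕ}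

theorem measurable_slope {f : Ω → ℝ → ℝ} (hf : ∀ δ, Measurable fun ω => f ω δ) :
    Measurable fun ω => slope T n (f ω) := by
  have h1 := hf (T.d₁ n)
  have h2 := hf (T.d₂ n)
  unfold slope
  fun_prop

theorem measurable_psiHat (hK : IsKernel M.K) (hO : ∀ i, Measurable (M.O i)) {D : Ω → ℝ}
    (hD : Measurable D) : Measurable fun ω => M.psiHat S n (D ω) ω :=
  (hK.measurable_smoothed_empirical M.x (fun i _ => hO i) hD).add
    (measurable_integral_empirical (fun i _ => hO i)
      (hK.measurable_grad_empirical M.x (fun i _ => hO i) hD))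

variable (hK : IsKernel M.K) (hO : ∀ i < S.l₂ n, Measurable (M.O i))

include hK hO

/-- Here and below only the first `l₂ n` observations are assumed measurable, and the σ-algebra is a
parameter. The lemmas therefore also apply with `past (l₂ n)` in place of the ambient σ-algebra,
which expresses that the selector does not use the third subsample. -/
theorem measurable_psi₂ (δ : ℝ) : Measurable fun ω => M.psi₂ S n ω δ := by
  have h1 : ∀ i ∈ Finset.Ico 0 (S.l₁ n), Measurable (M.O i) := fun i hi =>
    hO i ((Finset.mem_Ico.1 hi).2.trans_le (S.l₁_le_l₂ n))
  have h2 : ∀ i ∈ Finset.Ico (S.l₁ n) (S.l₂ n), Measurable (M.O i) := fun i hi =>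
    hO i (Finset.mem_Ico.1 hi).2
  exact (hK.measurable_smoothed_empirical M.x h1 measurable_const).add
    (measurable_integral_empirical h2 (hK.measurable_grad_empirical M.x h1 measurable_const))

theorem measurable_sigmaHat (δ : ℝ) : Measurable fun ω => M.sigmaHat S n ω δ := by
  have h1 : ∀ i ∈ Finset.Ico 0 (S.l₁ n), Measurable (M.O i) := fun i hi =>
    hO i ((Finset.mem_Ico.1 hi).2.trans_le (S.l₁_le_l₂ n))
  have h2 : ∀ i ∈ Finset.Ico (S.l₁ n) (S.l₂ n), Measurable (M.O i) := fun i hi =>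
    hO i (Finset.mem_Ico.1 hi).2
  have hg := hK.measurable_grad_empirical M.x h1 (measurable_const (a := δ))
  exact (measurable_integral_empirical h2 ((hg.sub
    ((measurable_integral_empirical h2 hg).comp measurable_fst)).pow_const 2)).sqrt

theorem measurable_biasDer (δ : ℝ) : Measurable fun ω => M.biasDer S n ω δ :=
  ((measurable_psi₂ hK hO _).sub (measurable_psi₂ hK hO _)).div_const _

theorem measurable_sigmaDer (δ : ℝ) : Measurable fun ω => M.sigmaDer S n ω δ :=
  ((measurable_sigmaHat hK hO _).sub (measurable_sigmaHat hK hO _)).div_const _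

theorem measurable_betaHat : Measurable (M.betaHat S T n) :=
  (measurable_slope (measurable_biasDer hK hO)).const_add _

theorem measurable_gammaHat : Measurable (M.gammaHat S T n) :=
  (measurable_slope (measurable_sigmaHat hK hO)).neg

theorem measurable_nuHat : Measurable (M.nuHat S T n) :=
  measurable_slope (measurable_sigmaDer hK hO)

theorem measurable_cBias : Measurable (M.cBias S T n) :=
  (measurable_biasDer hK hO _).mul
    (measurable_const.pow ((measurable_betaHat hK hO).sub_const 1).neg)

theorem measurable_cSigma : Measurable (M.cSigma S T n) :=
  (measurable_sigmaHat hK hO _).mul (measurable_const.pow (measurable_gammaHat hK hO))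

theorem measurable_cSigmaDer : Measurable (M.cSigmaDer S T n) :=
  (measurable_sigmaDer hK hO _).mul (measurable_const.pow (measurable_nuHat hK hO).neg)

theorem measurable_rHat : Measurable (M.rHat S T n) :=
  (((((measurable_betaHat hK hO).const_mul 2).sub_const 1).add (measurable_gammaHat hK hO)).sub
    (measurable_nuHat hK hO)).inv

theorem measurable_cHat : Measurable (M.cHat S T n) :=
  ((((measurable_cSigma hK hO).mul (measurable_cSigmaDer hK hO)).mul
    (measurable_betaHat hK hO)).abs.div ((measurable_cBias hK hO).pow_const 2)).pow
      (measurable_rHat hK hO)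

theorem measurable_deltaHat (ε : ℝ) : Measurable (M.deltaHat S T ε n) :=
  (measurable_cHat hK hO).mul (measurable_const.pow ((measurable_rHat hK hO).neg.sub_const ε))

end Model

end Measurability

/-! ### Conditioning on the first two subsamples and the central limit theorem at random bandwidths.
-/

/-- The σ-algebra of the first `N` observations. -/
@[reducible] def Model.past {Ω : Type*} (M : Model Ω) (N : ℕ) : MeasurableSpace Ω :=
  MeasurableSpace.comap (fun ω (i : Finset.range N) => M.O i ω) inferInstance

theorem Model.measurable_past {Ω : Type*} (M : Model Ω) {N i : ℕ} (h : i < N) :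
    Measurable[M.past N] (M.O i) := by
  have h1 : Measurable[M.past N] fun ω (i : Finset.range N) => M.O i ω := comap_measurable _
  exact (measurable_pi_apply (⟨i, Finset.mem_range.2 h⟩ : Finset.range N)).comp h1

namespace Model.IsSampled

variable {Ω : Type*} [mΩ : MeasurableSpace Ω] {M : Model Ω} {μ : Measure Ω}

theorem past_le (hM : M.IsSampled μ) (N : ℕ) : M.past N ≤ mΩ :=
  (measurable_pi_lambda _ fun i : Finset.range N => hM.measurable i).comap_le

theorem indepFun_past [IsProbabilityMeasure μ] (hM : M.IsSampled μ) {N n : ℕ} {E : Type*}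
    [MeasurableSpace E] {X : Ω → E} (hX : Measurable[M.past N] X) :
    IndepFun X (fun ω (i : Finset.Ico N n) => M.O i ω) μ := by
  have h1 := hM.indep.indepFun_finset (Finset.range N) (Finset.Ico N n)
    (Finset.disjoint_left.2 fun i hi hi' =>
      absurd (Finset.mem_range.1 hi) (Finset.mem_Ico.1 hi').1.not_gt) hM.measurable
  rw [IndepFun_iff_Indep] at h1 ⊢
  exact indep_of_indep_of_le_left h1 hX.comap_le

/-- Conditioning on the first two subsamples. -/
theorem integral_exp_psiHat [IsProbabilityMeasure μ] (hM : M.IsSampled μ) {S : Split} {n : ℕ}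
    (hn : S.l₂ n < n) {A D : Ω → ℝ} (hA : Measurable[M.past (S.l₂ n)] A)
    (hD : Measurable[M.past (S.l₂ n)] D) :
    StronglyMeasurable (fun ω => ∫ ω', Complex.exp
      ((A ω * (smoothed M.K M.x (D ω) (M.P₃ S n ω') - M.target) : ℝ) * Complex.I) ∂μ) ∧
    ∫ ω, Complex.exp ((A ω * (M.psiHat S n (D ω) ω - M.target) : ℝ) * Complex.I) ∂μ =
      ∫ ω, ∫ ω', Complex.exp
        ((A ω * (smoothed M.K M.x (D ω) (M.P₃ S n ω') - M.target) : ℝ) * Complex.I) ∂μ ∂μ := by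
  set X : Ω → ℝ × ℝ := fun ω => (A ω, D ω) with hXdef
  set Y : Ω → (Finset.Ico (S.l₂ n) n → ℝ) := fun ω i => M.O i ω with hYdef
  have hXp : Measurable[M.past (S.l₂ n)] X := hA.prodMk hD
  have hX : Measurable X := hXp.mono (hM.past_le _) le_rfl
  have hY : Measurable Y := measurable_pi_lambda _ fun i => hM.measurable i
  -- The statistic is a jointly measurable function of the past pair `(A, D)` and of the vector of
  -- third-block observations, so Fubini under independence applies.
  set Φ : ℝ → (Finset.Ico (S.l₂ n) n → ℝ) → ℝ := fun δ y =>
    ((n - S.l₂ n : ℕ) : ℝ)⁻¹ * ∑ i, kerAt M.K M.x δ (y i) with hΦ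
  have hsm : ∀ δ ω, smoothed M.K M.x δ (M.P₃ S n ω) = Φ δ (Y ω) := by
    intro δ ω
    rw [smoothed, P₃, integral_empirical]
    simp only [hΦ, hYdef]
    rw [Finset.sum_coe_sort (Finset.Ico (S.l₂ n) n) fun i => kerAt M.K M.x δ (M.O i ω)]
  set g : (ℝ × ℝ) × (Finset.Ico (S.l₂ n) n → ℝ) → ℂ := fun z =>
    Complex.exp ((z.1.1 * (Φ z.1.2 z.2 - M.target) : ℝ) * Complex.I) with hg
  have hΦm : Measurable fun z : (ℝ × ℝ) × (Finset.Ico (S.l₂ n) n → ℝ) => Φ z.1.2 z.2 := by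
    refine (Finset.measurable_fun_sum _ fun i _ => ?_).const_mul _
    exact (hM.isKernel.measurable_kerAt M.x).comp
      (measurable_fst.snd.prodMk ((measurable_pi_apply i).comp measurable_snd))
  have hgm : StronglyMeasurable g := by
    refine Measurable.stronglyMeasurable ?_
    exact Complex.measurable_exp.comp ((Complex.measurable_ofReal.comp
      (measurable_fst.fst.mul (hΦm.sub_const _))).mul_const _)
  have hg1 : ∀ z, ‖g z‖ ≤ 1 := fun z => (Complex.norm_exp_ofReal_mul_I _).le
  have h1 := integral_comp_of_indepFun hX hY (hM.indepFun_past hXp) hgm hg1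
  constructor
  · simp only [hsm]
    exact StronglyMeasurable.integral_prod_right' (f := fun z : Ω × Ω => g (X z.1, Y z.2))
      (hgm.comp_measurable ((hX.comp measurable_fst).prodMk (hY.comp measurable_snd)))
  · simp only [hM.psiHat_eq hn, hsm]
    exact h1

/-- The central limit theorem for the estimator at a bandwidth which depends on the first two
subsamples. -/
theorem tendstoInDistribution_psiHat [IsProbabilityMeasure μ] (hM : M.IsSampled μ) {S : Split}
    {A D : ℕ → Ω → ℝ} {v : NNReal} (hA : ∀ n, Measurable[M.past (S.l₂ n)] (A n))
    (hD : ∀ n, Measurable[M.past (S.l₂ n)] (D n))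
    (hvar : Tendsto (fun q : ℕ × Ω => A q.1 q.2 ^ 2 * M.sigmaInf (D q.1 q.2) ^ 2 / S.m₃ q.1)
      (probFilter μ) (𝓝 v))
    (hbias : Tendsto (fun q : ℕ × Ω => A q.1 q.2 * M.bias (D q.1 q.2)) (probFilter μ) (𝓝 0))
    (hlind : Tendsto (fun q : ℕ × Ω => A q.1 q.2 / D q.1 q.2 / S.m₃ q.1) (probFilter μ) (𝓝 0)) :
    TendstoInDistribution (fun n ω => A n ω * (M.psiHat S n (D n ω) ω - M.target)) atTop
      (id : ℝ → ℝ) (fun _ => μ) (gaussianReal 0 v) := by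
  obtain ⟨C, hC0, hC⟩ := hM.isKernel.exists_bound
  have hmeas : ∀ n, Measurable fun ω => A n ω * (M.psiHat S n (D n ω) ω - M.target) := fun n =>
    ((hA n).mono (hM.past_le _) le_rfl).mul ((measurable_psiHat hM.isKernel hM.measurable
      ((hD n).mono (hM.past_le _) le_rfl)).sub_const _)
  refine ⟨fun n => (hmeas n).aemeasurable, aemeasurable_id, ?_⟩
  refine ProbabilityMeasure.tendsto_iff_tendsto_charFun.2 fun t => ?_
  have hlim : charFun ((gaussianReal 0 v).map id) t = (Real.exp (-(t ^ 2 * v) / 2) : ℂ) := by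
    rw [Measure.map_id, charFun_gaussianReal]
    push_cast
    congr 1
    simp
    ring
  have hcf : ∀ n, charFun (μ.map fun ω => A n ω * (M.psiHat S n (D n ω) ω - M.target)) t =
      ∫ ω, Complex.exp ((t * A n ω * (M.psiHat S n (D n ω) ω - M.target) : ℝ) * Complex.I) ∂μ := by
    intro n
    rw [charFun_apply_real, integral_map (hmeas n).aemeasurable (by fun_prop)]
    congr 1 with ω
    push_cast
    ring_nf
  simp only [ProbabilityMeasure.coe_mk, hlim, hcf]
  -- the conditional characteristic function
  set F : ℕ → Ω → ℂ := fun n ω => ∫ ω', Complex.exp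
    ((t * A n ω * (smoothed M.K M.x (D n ω) (M.P₃ S n ω') - M.target) : ℝ) * Complex.I) ∂μ with hF
  have hmn : ∀ᶠ q : ℕ × Ω in probFilter μ, S.l₂ q.1 < q.1 :=
    tendsto_fst_probFilter.eventually S.eventually_l₂_lt
  have hmain : Tendsto (fun q : ℕ × Ω => F q.1 q.2) (probFilter μ)
      (𝓝 (Real.exp (-(t ^ 2 * v) / 2) : ℂ)) := by
    have hρ := hvar.const_mul (t ^ 2)
    have hη := (hlind.abs.const_mul (|t| * (2 * C)))
    rw [abs_zero, mul_zero] at hη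
    have hm := ((tendsto_inv_atTop_zero.comp S.tendsto_m₃).comp (tendsto_fst_probFilter (μ := μ)))
    have hbd := (hη.mul hρ).add ((hρ.pow 2).mul hm)
    rw [zero_mul, mul_zero, add_zero] at hbd
    have hexp : Tendsto (fun q : ℕ × Ω => (Real.exp (-(t ^ 2 * (A q.1 q.2 ^ 2 *
        M.sigmaInf (D q.1 q.2) ^ 2 / S.m₃ q.1)) / 2) : ℂ)) (probFilter μ)
        (𝓝 (Real.exp (-(t ^ 2 * v) / 2) : ℂ)) :=
      (Complex.continuous_ofReal.tendsto _).comp ((Real.continuous_exp.tendsto _).comp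
        (hρ.neg.div_const 2))
    -- Given the past, the characteristic function splits into a phase carrying the bias and the
    -- factor of a centred empirical mean.
    have hphase : Tendsto (fun q : ℕ × Ω => Complex.exp
        ((t * (A q.1 q.2 * M.bias (D q.1 q.2)) : ℝ) * Complex.I)) (probFilter μ) (𝓝 1) := by
      have h1 : Tendsto (fun q : ℕ × Ω => Complex.exp
          ((t * (A q.1 q.2 * M.bias (D q.1 q.2)) : ℝ) * Complex.I)) (probFilter μ)
          (𝓝 (Complex.exp ((t * 0 : ℝ) * Complex.I))) :=
        (Complex.continuous_exp.tendsto _).comp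
          (((Complex.continuous_ofReal.tendsto _).comp (hbias.const_mul t)).mul_const _)
      simpa using h1
    have hG : Tendsto (fun q : ℕ × Ω => ∫ ω', Complex.exp ((t * A q.1 q.2 *
        (smoothed M.K M.x (D q.1 q.2) (M.P₃ S q.1 ω') - smoothed M.K M.x (D q.1 q.2) M.P₀) : ℝ) *
        Complex.I) ∂μ) (probFilter μ) (𝓝 (Real.exp (-(t ^ 2 * v) / 2) : ℂ)) := by
      have h1 := squeeze_zero_norm' (f := fun q : ℕ × Ω => ∫ ω', Complex.exp ((t * A q.1 q.2 *
        (smoothed M.K M.x (D q.1 q.2) (M.P₃ S q.1 ω') - smoothed M.K M.x (D q.1 q.2) M.P₀) : ℝ) *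
        Complex.I) ∂μ - (Real.exp (-(t ^ 2 * (A q.1 q.2 ^ 2 *
        M.sigmaInf (D q.1 q.2) ^ 2 / S.m₃ q.1)) / 2) : ℂ)) ?_ hbd
      · simpa using h1.add hexp
      -- The quantitative bound applies for each fixed value of the past; its error terms are the
      -- Lindeberg ratio and `1/m₃`, multiplied by convergent variances.
      · filter_upwards [hmn, hη.eventually_le_const one_pos] with q hq hq1
        have hm0 : (0 : ℝ) ≤ S.m₃ q.1 := by rw [S.m₃_eq]; positivity
        have e1 : |t * A q.1 q.2| * (2 * (C / |D q.1 q.2|)) / (q.1 - S.l₂ q.1 : ℕ) =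
            |t| * (2 * C) * |A q.1 q.2 / D q.1 q.2 / S.m₃ q.1| := by
          rw [← S.m₃_eq, abs_mul, abs_div, abs_div, abs_of_nonneg hm0]
          ring
        have e2 : (t * A q.1 q.2) ^ 2 * M.sigmaInf (D q.1 q.2) ^ 2 / (q.1 - S.l₂ q.1 : ℕ) =
            t ^ 2 * (A q.1 q.2 ^ 2 * M.sigmaInf (D q.1 q.2) ^ 2 / S.m₃ q.1) := by
          rw [← S.m₃_eq]
          ring
        have h2 := hM.norm_integral_exp_empirical_sub_le
          (hM.isKernel.measurable_kerAt_right M.x (D q.1 q.2)) (hC M.x (D q.1 q.2))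
          (hM.sq_sigmaInf _).symm hq (θ := t * A q.1 q.2) (by rw [e1]; exact hq1)
        rw [e1, e2, ← S.m₃_eq, div_eq_mul_inv _ (S.m₃ q.1)] at h2
        exact h2
    have h2 := hphase.mul hG
    rw [one_mul] at h2
    refine h2.congr fun q => ?_
    rw [hF, ← integral_const_mul]
    congr 1 with ω'
    rw [← Complex.exp_add, bias]
    congr 1
    push_cast
    ring
  have hFm : ∀ᶠ n in atTop, AEStronglyMeasurable (F n) μ ∧
      ∫ ω, Complex.exp ((t * A n ω * (M.psiHat S n (D n ω) ω - M.target) : ℝ) * Complex.I) ∂μ =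
        ∫ ω, F n ω ∂μ := by
    filter_upwards [S.eventually_l₂_lt] with n hn
    have h1 := hM.integral_exp_psiHat hn (A := fun ω => t * A n ω) ((hA n).const_mul t) (hD n)
    exact ⟨h1.1.aestronglyMeasurable, h1.2⟩
  exact (tendsto_integral_probFilter (hFm.mono fun _ h => h.1)
    (fun n ω => norm_integral_exp_mul_I_le μ _) hmain).congr' (hFm.mono fun _ h => h.2.symm)

end Model.IsSampled

/-- By symmetry and absence of atoms the distribution function is `1/2 < t` at 0, and right
continuity keeps it below `t` slightly beyond 0; this makes the inequality strict. -/
theorem normalQuantile_pos {t : ℝ} (ht : 1 / 2 < t) (ht1 : t < 1) : 0 < Model.normalQuantile t := by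
  set P := gaussianReal 0 1
  have hna : NullSingletonClass P := nullSingletonClass_gaussianReal one_ne_zero
  have hsymm : P.real (Iic 0) = P.real (Ici 0) := by
    have h1 : P.map (fun y => -y) = P := by
      rw [gaussianReal_map_neg, neg_zero]
    conv_lhs => rw [← h1]
    rw [map_measureReal_apply measurable_neg measurableSet_Iic]
    congr 1
    ext y
    simp
  have hhalf : cdf P 0 = 1 / 2 := by
    rw [cdf_eq_real]
    have h1 := measureReal_compl (μ := P) (measurableSet_Iic (a := (0 : ℝ)))
    rw [compl_Iic, probReal_univ] at h1
    have h2 : P.real (Ioi 0) = P.real (Ici 0) := by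
      rw [measureReal_def, measureReal_def, measure_congr Ioi_ae_eq_Ici]
    linarith
  have h1 : ∀ᶠ y in 𝓝[≥] (0 : ℝ), cdf P y < t :=
    ((cdf P).right_continuous 0).eventually_lt_const (by rw [hhalf]; exact ht)
  obtain ⟨y, hy, hy0⟩ := ((h1.filter_mono (nhdsWithin_mono 0 Ioi_subset_Ici_self)).and
    eventually_nhdsGT_pos).exists
  obtain ⟨z, hz⟩ := ((tendsto_cdf_atTop P).eventually_const_lt ht1).exists
  refine hy0.trans_le (le_csInf ⟨z, hz.le⟩ fun u hu => ?_)
  by_contra! hlt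
  have h2 : t ≤ cdf P u := hu
  exact absurd (h2.trans (monotone_cdf P hlt.le)) hy.not_ge

theorem Split.tendsto_m₃_probFilter {Ω : Type*} [MeasurableSpace Ω] {μ : Measure Ω} (S : Split) :
    Tendsto (fun q : ℕ × Ω => S.m₃ q.1) (probFilter μ) atTop :=
  S.tendsto_m₃.comp tendsto_fst_probFilter

/-! ### Asymptotic normality at the selected undersmoothed bandwidth. -/

namespace Model.IsSampled

variable {Ω : Type*} [mΩ : MeasurableSpace Ω] {M : Model Ω} {μ : Measure Ω}
  [IsProbabilityMeasure μ] {A B γ β ε : ℝ} {S : Split} {T : Pilot}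

theorem tendsto_deltaHat_nhdsGT (hM : M.IsSampled μ) (h : PowerLaw M.sigmaInf M.bias A B γ β)
    (hT : T.Admissible (1 / (4 * (1 + β)))) (hε : 0 ≤ ε) :
    Tendsto (fun q : ℕ × Ω => M.deltaHat S T ε q.1 q.2) (probFilter μ) (𝓝[>] 0) :=
  tendsto_nhdsGT_of_mul_rpow (add_pos_of_pos_of_nonneg h.rate_pos hε) h.optConst_pos
    S.tendsto_m₃_probFilter (hM.tendsto_deltaHat h hT ε)

/-- Along the selected bandwidths the summands of the estimator satisfy Lindeberg's condition. -/
theorem tendsto_lindeberg (hM : M.IsSampled μ) (h : PowerLaw M.sigmaInf M.bias A B γ β)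
    (hT : T.Admissible (1 / (4 * (1 + β)))) (hε : 0 ≤ ε) (hε1 : PowerLaw.rate γ β + ε < 1) :
    Tendsto (fun q : ℕ × Ω => (M.sigmaInf (M.deltaHat S T ε q.1 q.2) * M.deltaHat S T ε q.1 q.2 *
      √(S.m₃ q.1))⁻¹) (probFilter μ) (𝓝 0) := by
  have hδ := hM.tendsto_deltaHat h hT (S := S) ε
  have hδ0 := hM.tendsto_deltaHat_nhdsGT h hT (S := S) hε
  have hm : Tendsto (fun q : ℕ × Ω => S.m₃ q.1) (probFilter μ) atTop := S.tendsto_m₃_probFilter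
  -- The effective sample size `δ̂ m₃` diverges because `r + ε < 1`.
  have hinf : Tendsto (fun q : ℕ × Ω => M.deltaHat S T ε q.1 q.2 * S.m₃ q.1) (probFilter μ)
      atTop := by
    have h1 := hδ.pos_mul_atTop h.optConst_pos ((tendsto_rpow_atTop
      (show 0 < 1 - (PowerLaw.rate γ β + ε) by linarith)).comp hm)
    refine h1.congr' ?_
    filter_upwards [hm.eventually_gt_atTop 0] with q hq
    rw [Function.comp_apply, mul_assoc, ← Real.rpow_add hq]
    simp
  have h1 := ((h.σ_lim.comp hδ0).inv₀ h.A_pos.ne').mul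
    (Real.tendsto_sqrt_atTop.comp hinf).inv_tendsto_atTop
  rw [mul_zero] at h1
  refine squeeze_zero_norm' ?_ h1
  filter_upwards [hδ0.eventually eventually_nhdsGT_pos, hδ0.eventually h.eventually_σ_pos,
    hm.eventually_gt_atTop 0, (hδ0.mono_right nhdsWithin_le_nhds).eventually_lt_const one_pos]
    with q hq hσ hmq hq1
  set δ := M.deltaHat S T ε q.1 q.2
  have hs := Real.sqrt_pos.2 hmq
  have hp := Real.rpow_pos_of_pos hq γ
  have hd := Real.sqrt_pos.2 hq
  simp only [Function.comp_apply, Pi.inv_apply]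
  rw [Real.norm_of_nonneg (by positivity), ← mul_inv, Real.sqrt_mul hq.le]
  gcongr ?_⁻¹
  -- Here `γ ≥ 1/2` bounds `σ δ √m₃` below by `σ δ^γ √(δ m₃)`, a factor converging to `A > 0` times
  -- a divergent one.
  have h2 : δ ^ γ ≤ √δ := by
    rw [Real.sqrt_eq_rpow]
    exact Real.rpow_le_rpow_of_exponent_ge hq hq1.le h.γ_ge
  calc _ = M.sigmaInf δ * √(S.m₃ q.1) * (δ ^ γ * √δ) := by ring
    _ ≤ M.sigmaInf δ * √(S.m₃ q.1) * (√δ * √δ) := by gcongr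
    _ = _ := by rw [Real.mul_self_sqrt hq.le]; ring

/-- Replacing `γ̂` by `γ` costs nothing even at the random bandwidth, since `|log δ̂|` is eventually
at most a constant times `log n` along `probFilter`. -/
theorem tendsto_deltaHat_rpow_gammaHat (hM : M.IsSampled μ)
    (h : PowerLaw M.sigmaInf M.bias A B γ β) (hT : T.Admissible (1 / (4 * (1 + β))))
    (hε : 0 ≤ ε) :
    Tendsto (fun q : ℕ × Ω => M.deltaHat S T ε q.1 q.2 ^ (M.gammaHat S T q.1 q.2 - γ))
      (probFilter μ) (𝓝 1) := by
  have hδ := hM.tendsto_deltaHat h hT (S := S) ε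
  have hδ0 := (hM.tendsto_deltaHat_nhdsGT h hT (S := S) hε).eventually eventually_nhdsGT_pos
  have hm : Tendsto (fun q : ℕ × Ω => S.m₃ q.1) (probFilter μ) atTop := S.tendsto_m₃_probFilter
  refine tendsto_rpow_of_mul_log hδ0 (tendsto_mul_log_of_le
    (C := |Real.log (PowerLaw.optConst A B γ β)| + 1 + |PowerLaw.rate γ β + ε|)
    (hM.tendsto_gammaHat h hT) ?_)
  have hc := (hδ.log h.optConst_pos.ne').abs.eventually_lt_const (lt_add_one _)
  filter_upwards [hδ0, hm.eventually_gt_atTop 0, hc,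
    (tendsto_log_probFilter μ).eventually_ge_atTop 1,
    tendsto_fst_probFilter.eventually S.abs_log_m₃_le] with q hq hmq hcq hlog hle
  have hp := Real.rpow_pos_of_pos hmq (PowerLaw.rate γ β + ε)
  rw [Real.log_mul hq.ne' hp.ne', Real.log_rpow hmq] at hcq
  set x := Real.log (M.deltaHat S T ε q.1 q.2)
  set y := (PowerLaw.rate γ β + ε) * Real.log (S.m₃ q.1) with hy
  have h1 : |x| ≤ |x + y| + |y| := by
    have := abs_sub (x + y) y
    rwa [add_sub_cancel_right] at this
  have h2 : |y| ≤ |PowerLaw.rate γ β + ε| * |Real.log q.1| := by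
    rw [hy, abs_mul]
    rw [one_mul] at hle
    gcongr
  have h3 : 1 ≤ |Real.log q.1| := hlog.trans (le_abs_self _)
  have h4 : 0 ≤ |Real.log (PowerLaw.optConst A B γ β)| := abs_nonneg _
  nlinarith

/-- Asymptotic normality of the studentized estimator at undersmoothed bandwidths. -/
theorem tendstoInDistribution_studentized (hM : M.IsSampled μ)
    (h : PowerLaw M.sigmaInf M.bias A B γ β) (hT : T.Admissible (1 / (4 * (1 + β))))
    (hε : 0 < ε) (hε1 : PowerLaw.rate γ β + ε < 1) :
    TendstoInDistribution (M.studentized S T ε) atTop (id : ℝ → ℝ) (fun _ => μ)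
      (gaussianReal 0 1) := by
  have hβ := h.β_pos
  have hγ := h.γ_pos
  have hδ := hM.tendsto_deltaHat h hT (S := S) ε
  have hδ0 := hM.tendsto_deltaHat_nhdsGT h hT (S := S) hε.le
  have hpos := hδ0.eventually eventually_nhdsGT_pos
  have hm : Tendsto (fun q : ℕ × Ω => S.m₃ q.1) (probFilter μ) atTop := S.tendsto_m₃_probFilter
  have hscale : Tendsto (fun q : ℕ × Ω => (M.cSigma S T q.1 q.2)⁻¹ *
      M.deltaHat S T ε q.1 q.2 ^ (M.gammaHat S T q.1 q.2 - γ)) (probFilter μ) (𝓝 A⁻¹) := by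
    simpa using ((hM.tendsto_cSigma h hT (S := S)).inv₀ h.A_pos.ne').mul
      (hM.tendsto_deltaHat_rpow_gammaHat h hT (S := S) hε.le)
  have hpow : ∀ q : ℕ × Ω, 0 < M.deltaHat S T ε q.1 q.2 →
      M.deltaHat S T ε q.1 q.2 ^ M.gammaHat S T q.1 q.2 =
        M.deltaHat S T ε q.1 q.2 ^ (M.gammaHat S T q.1 q.2 - γ) *
          M.deltaHat S T ε q.1 q.2 ^ γ := fun q hq => by
    rw [← Real.rpow_add hq, sub_add_cancel]
  have hone := hscale.mul (h.σ_lim.comp hδ0)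
  rw [inv_mul_cancel₀ h.A_pos.ne'] at hone
  have hO : ∀ n, ∀ i < S.l₂ n, Measurable[M.past (S.l₂ n)] (M.O i) := fun n i hi =>
    M.measurable_past hi
  have hcS : ∀ n, Measurable[M.past (S.l₂ n)] (M.cSigma S T n) := fun n =>
    @measurable_cSigma Ω (M.past (S.l₂ n)) M S T n hM.isKernel (hO n)
  have hdH : ∀ n, Measurable[M.past (S.l₂ n)] (M.deltaHat S T ε n) := fun n =>
    @measurable_deltaHat Ω (M.past (S.l₂ n)) M S T n hM.isKernel (hO n) ε
  have hgH : ∀ n, Measurable[M.past (S.l₂ n)] (M.gammaHat S T n) := fun n =>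
    @measurable_gammaHat Ω (M.past (S.l₂ n)) M S T n hM.isKernel (hO n)
  refine hM.tendstoInDistribution_psiHat (v := 1)
    (A := fun n ω => (M.cSigma S T n ω)⁻¹ * M.deltaHat S T ε n ω ^ M.gammaHat S T n ω * √(S.m₃ n))
    (D := M.deltaHat S T ε) (fun n => ((hcS n).inv.mul ((hdH n).pow (hgH n))).mul_const _) hdH
    ?_ ?_ ?_
  · have h1 := hone.pow 2
    rw [one_pow] at h1
    refine h1.congr' ?_
    filter_upwards [hpos, hm.eventually_gt_atTop 0] with q hq hmq
    rw [mul_pow _ (√_), Real.sq_sqrt hmq.le, hpow q hq, Function.comp_apply]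
    field_simp
  -- The normalized bias is of order `δ̂^(β+γ) √m₃`, hence `m₃^(-(β+γ)ε)`: undersmoothing is what
  -- makes it vanish.
  · have h1 := (hscale.mul (h.b_lim.comp hδ0)).mul ((hδ.rpow_const (p := β + γ)
      (Or.inr (by linarith))).mul ((tendsto_rpow_neg_atTop
        (show 0 < (β + γ) * ε by positivity)).comp hm))
    rw [mul_zero, mul_zero] at h1
    refine h1.congr' ?_
    filter_upwards [hpos, hm.eventually_gt_atTop 0] with q hq hmq
    have hp := Real.rpow_pos_of_pos hmq (PowerLaw.rate γ β + ε)
    have e1 : (M.deltaHat S T ε q.1 q.2 * S.m₃ q.1 ^ (PowerLaw.rate γ β + ε)) ^ (β + γ) *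
        S.m₃ q.1 ^ (-((β + γ) * ε)) = M.deltaHat S T ε q.1 q.2 ^ (β + γ) * √(S.m₃ q.1) := by
      rw [Real.mul_rpow hq.le hp.le, ← Real.rpow_mul hmq.le, mul_assoc, ← Real.rpow_add hmq,
        Real.sqrt_eq_rpow]
      congr 2
      linarith [h.two_mul_mul_rate]
    have e2 : M.deltaHat S T ε q.1 q.2 ^ (-β) * M.deltaHat S T ε q.1 q.2 ^ (β + γ) =
        M.deltaHat S T ε q.1 q.2 ^ γ := by
      rw [← Real.rpow_add hq, neg_add_cancel_left]
    simp only [Function.comp_apply]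
    rw [e1, hpow q hq, ← e2]
    ring
  · have h1 := hone.mul (hM.tendsto_lindeberg h hT (S := S) hε.le hε1)
    rw [mul_zero] at h1
    refine h1.congr' ?_
    filter_upwards [hpos, hm.eventually_gt_atTop 0, hδ0.eventually h.eventually_σ_pos]
      with q hq hmq hσ
    have hs := Real.sqrt_pos.2 hmq
    rw [hpow q hq, Function.comp_apply]
    field_simp
    rw [Real.sq_sqrt hmq.le]

end Model.IsSampled

/-! ### Ratios of mean squared errors and coverage of the confidence interval. -/

theorem IsStationary.congr {Q Q' : ℕ → ℝ → ℝ} {d : ℕ → ℝ} (h : IsStationary Q d)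
    (hQ : ∀ᶠ n in atTop, Q n = Q' n) : IsStationary Q' d :=
  ⟨h.pos, h.tendsto_zero, by filter_upwards [h.hasDerivAt, hQ] with n h1 h2 using h2 ▸ h1⟩

theorem IsOptimal.congr {Q Q' : ℕ → ℝ → ℝ} {d : ℕ → ℝ} (h : IsOptimal Q d)
    (hQ : ∀ᶠ n in atTop, Q n = Q' n) : IsOptimal Q' d := by
  obtain ⟨hs, b, hb, hmin⟩ := h
  exact ⟨hs.congr hQ, b, hb, by filter_upwards [hmin, hQ] with n h1 h2 using h2 ▸ h1⟩

/-- The limit ratio of the mean squared errors when the benchmark is the optimal bandwidth of the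
full sample. -/
noncomputable def PowerLaw.fullRatio (A B γ β p : ℝ) : ℝ :=
  risk A B γ β (optConst A B γ β) /
    risk A B γ β (optConst A B γ β * (1 - p) ^ rate γ β)

theorem PowerLaw.fullRatio_pos {σ b : ℝ → ℝ} {A B γ β p : ℝ} (h : PowerLaw σ b A B γ β)
    (hp : p < 1) : 0 < fullRatio A B γ β p :=
  div_pos (h.risk_pos h.optConst_pos)
    (h.risk_pos (mul_pos h.optConst_pos (Real.rpow_pos_of_pos (sub_pos.2 hp) _)))

/-- As `p` grows, the benchmark constant `c (1-p)^r` moves down inside `(0, c]`, where `risk` is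
strictly decreasing; the denominator increases strictly. -/
theorem PowerLaw.strictAntiOn_fullRatio {σ b : ℝ → ℝ} {A B γ β : ℝ} (h : PowerLaw σ b A B γ β) :
    StrictAntiOn (fullRatio A B γ β) (Ioo 0 1) := by
  intro p hp p' hp' hlt
  have hc := h.optConst_pos
  have hr := h.rate_pos
  have hmem : ∀ u ∈ Ioo (0 : ℝ) 1,
      optConst A B γ β * (1 - u) ^ rate γ β ∈ Ioc 0 (optConst A B γ β) := fun u hu =>
    ⟨mul_pos hc (Real.rpow_pos_of_pos (sub_pos.2 hu.2) _), mul_le_of_le_one_right hc.le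
      (Real.rpow_le_one (sub_pos.2 hu.2).le (by linarith [hu.1]) hr.le)⟩
  refine div_lt_div_of_pos_left (h.risk_pos hc) (h.risk_pos (hmem p hp).1)
    (h.strictAntiOn_risk (hmem p' hp') (hmem p hp) ?_)
  have := Real.rpow_lt_rpow (sub_pos.2 hp'.2).le (show 1 - p' < 1 - p by linarith) hr
  gcongr

namespace Model.IsSampled

variable {Ω : Type*} [mΩ : MeasurableSpace Ω] {M : Model Ω} {μ : Measure Ω}
  [IsProbabilityMeasure μ] {A B γ β ε α : ℝ} {S : Split} {T : Pilot}

theorem eventually_mse_eq (hM : M.IsSampled μ) (S : Split) : ∀ᶠ n in atTop,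
    M.mse μ S n = fun δ => M.sigmaInf δ ^ 2 / S.m₃ n + M.bias δ ^ 2 := by
  filter_upwards [S.eventually_l₂_lt] with n hn using hM.mse_eq hn

/-- The ratio of the mean squared error at the selected bandwidth to that at a deterministic
bandwidth of the optimal order. -/
theorem tendstoInMeasure_mse_div (hM : M.IsSampled μ) (h : PowerLaw M.sigmaInf M.bias A B γ β)
    (hT : T.Admissible (1 / (4 * (1 + β)))) {d : ℕ → ℝ} {c : ℝ} (hc : 0 < c)
    (hd : Tendsto (fun n => d n * S.m₃ n ^ PowerLaw.rate γ β) atTop (𝓝 c)) :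
    TendstoInMeasure μ (fun n ω => M.mse μ S n (M.deltaHat S T 0 n ω) / M.mse μ S n (d n)) atTop
      (fun _ => PowerLaw.risk A B γ β (PowerLaw.optConst A B γ β) / PowerLaw.risk A B γ β c) := by
  have hδ := hM.tendsto_deltaHat h hT (S := S) 0
  rw [add_zero] at hδ
  have h1 := h.tendsto_criterion h.optConst_pos S.tendsto_m₃_probFilter hδ
  have h2 := (h.tendsto_criterion hc S.tendsto_m₃ hd).comp (tendsto_fst_probFilter (μ := μ))
  rw [← tendsto_probFilter_iff]
  refine (h1.div h2 (h.risk_pos hc).ne').congr' ?_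
  filter_upwards [tendsto_fst_probFilter.eventually (hM.eventually_mse_eq S),
    S.tendsto_m₃_probFilter.eventually_gt_atTop 0] with q hq hm
  have hp := Real.rpow_pos_of_pos hm (2 * β * PowerLaw.rate γ β)
  rw [hq, Pi.div_apply, Function.comp_apply, mul_div_mul_right _ _ hp.ne']

/-- The confidence intervals cover the target with probability tending to one. -/
theorem tendsto_measure_confInt (hM : M.IsSampled μ) (h : PowerLaw M.sigmaInf M.bias A B γ β)
    (hT : T.Admissible (1 / (4 * (1 + β)))) (hα : 0 < α) (hα1 : α < 1) (hε : 0 < ε) :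
    Tendsto (fun n => μ {ω | M.target ∈ M.confInt S T α ε n ω}) atTop (𝓝 1) := by
  have hγ := h.γ_pos
  have hβ := h.β_pos
  have hz : 0 < normalQuantile (1 - α / 2) := normalQuantile_pos (by linarith) (by linarith)
  have hδ := hM.tendsto_deltaHat h hT (S := S) 0
  rw [add_zero] at hδ
  have hδ0 := hM.tendsto_deltaHat_nhdsGT h hT (S := S) le_rfl
  have hpos := hδ0.eventually eventually_nhdsGT_pos
  have hm : Tendsto (fun q : ℕ × Ω => S.m₃ q.1) (probFilter μ) atTop := S.tendsto_m₃_probFilter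
  have hm0 := hm.eventually_gt_atTop 0
  have hlog := tendsto_log_probFilter μ
  have hcS := hM.tendsto_cSigma h hT (S := S)
  -- the order of the half-width
  have hrate : Tendsto (fun q : ℕ × Ω => S.m₃ q.1 ^ (PowerLaw.rate γ β * γ -
      (M.rHat S T q.1 q.2 + ε) * M.gammaHat S T q.1 q.2)) (probFilter μ) (𝓝 0) := by
    have h1 : Tendsto (fun q : ℕ × Ω => ((PowerLaw.rate γ β + ε) * γ -
        (M.rHat S T q.1 q.2 + ε) * M.gammaHat S T q.1 q.2) * Real.log q.1) (probFilter μ)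
        (𝓝 0) := by
      have h2 := ((hM.tendsto_rHat h hT (S := S)).mul (tendsto_of_sub_mul hlog
        (hM.tendsto_gammaHat h hT (S := S)))).add
          ((hM.tendsto_gammaHat h hT (S := S)).const_mul (PowerLaw.rate γ β + ε))
      rw [zero_mul, mul_zero, add_zero] at h2
      have h3 := h2.neg
      rw [neg_zero] at h3
      refine h3.congr fun q => ?_
      ring
    have h2 := (tendsto_rpow_of_mul_log hm0 (tendsto_mul_log_of_le h1
      (tendsto_fst_probFilter.eventually S.abs_log_m₃_le))).mul
        ((tendsto_rpow_neg_atTop (show 0 < ε * γ by positivity)).comp hm)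
    rw [mul_zero] at h2
    refine h2.congr' ?_
    filter_upwards [hm0] with q hq
    rw [Function.comp_apply, ← Real.rpow_add hq]
    ring_nf
  have hscale : Tendsto (fun q : ℕ × Ω => (normalQuantile (1 - α / 2) * M.cSigma S T q.1 q.2)⁻¹)
      (probFilter μ) (𝓝 (normalQuantile (1 - α / 2) * A)⁻¹) :=
    (hcS.const_mul _).inv₀ (mul_pos hz h.A_pos).ne'
  have hsplit : ∀ q : ℕ × Ω, 0 < S.m₃ q.1 → (M.halfWidth S T α ε q.1 q.2)⁻¹ =
      (normalQuantile (1 - α / 2) * M.cSigma S T q.1 q.2)⁻¹ *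
        (√(S.m₃ q.1) * S.m₃ q.1 ^ (-((M.rHat S T q.1 q.2 + ε) * M.gammaHat S T q.1 q.2))) := by
    intro q hq
    rw [halfWidth, Real.sqrt_eq_rpow, ← Real.rpow_add hq, ← sub_eq_add_neg, ← mul_div_assoc,
      inv_div, div_eq_inv_mul]
  -- The standard deviation over the half-width is of order `m₃^(rγ - (r̂+ε)γ̂)`. The estimated
  -- exponents may be replaced by the true ones, leaving `m₃^(-εγ)`.
  have hvar : Tendsto (fun q : ℕ × Ω => (M.halfWidth S T α ε q.1 q.2)⁻¹ *
      M.sigmaInf (M.deltaHat S T 0 q.1 q.2) / √(S.m₃ q.1)) (probFilter μ) (𝓝 0) := by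
    have h1 := (hscale.mul (h.σ_lim.comp hδ0)).mul
      ((hδ.rpow_const (p := -γ) (Or.inl h.optConst_pos.ne')).mul hrate)
    rw [mul_zero, mul_zero] at h1
    refine h1.congr' ?_
    filter_upwards [hpos, hm0] with q hq hmq
    have hs := Real.sqrt_pos.2 hmq
    have hp := Real.rpow_pos_of_pos hmq (PowerLaw.rate γ β)
    have hp' := Real.rpow_pos_of_pos hmq (PowerLaw.rate γ β * γ)
    have hdγ := Real.rpow_pos_of_pos hq γ
    rw [hsplit q hmq, Real.mul_rpow hq.le hp.le, ← Real.rpow_mul hmq.le,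
      sub_eq_add_neg (PowerLaw.rate γ β * γ),
      Real.rpow_add hmq, mul_neg, Real.rpow_neg hq.le, Real.rpow_neg hmq.le (_ * γ),
      Function.comp_apply]
    field_simp
  -- At `ε = 0` in the bandwidth the bias has the order of the standard deviation, so the enlarged
  -- half-width dominates it by the same factor.
  have hbias : Tendsto (fun q : ℕ × Ω => (M.halfWidth S T α ε q.1 q.2)⁻¹ *
      M.bias (M.deltaHat S T 0 q.1 q.2)) (probFilter μ) (𝓝 0) := by
    have h1 := (hscale.mul (h.b_lim.comp hδ0)).mul
      ((hδ.rpow_const (p := β) (Or.inr hβ.le)).mul hrate)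
    rw [mul_zero, mul_zero] at h1
    refine h1.congr' ?_
    filter_upwards [hpos, hm0] with q hq hmq
    have hp := Real.rpow_pos_of_pos hmq (PowerLaw.rate γ β)
    have hdβ := Real.rpow_pos_of_pos hq β
    have e1 : √(S.m₃ q.1) = S.m₃ q.1 ^ (PowerLaw.rate γ β * β) *
        S.m₃ q.1 ^ (PowerLaw.rate γ β * γ) := by
      rw [Real.sqrt_eq_rpow, ← Real.rpow_add hmq]
      congr 1
      linarith [h.two_mul_mul_rate]
    rw [hsplit q hmq, Real.mul_rpow hq.le hp.le, ← Real.rpow_mul hmq.le,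
      sub_eq_add_neg (PowerLaw.rate γ β * γ),
      Real.rpow_add hmq, Function.comp_apply, Real.rpow_neg hq.le, e1]
    field_simp
  have hO : ∀ n, ∀ i < S.l₂ n, Measurable[M.past (S.l₂ n)] (M.O i) := fun n i hi =>
    M.measurable_past hi
  have hdH : ∀ n, Measurable[M.past (S.l₂ n)] (M.deltaHat S T 0 n) := fun n =>
    @measurable_deltaHat Ω (M.past (S.l₂ n)) M S T n hM.isKernel (hO n) 0
  have hhw : ∀ n, Measurable[M.past (S.l₂ n)] fun ω => (M.halfWidth S T α ε n ω)⁻¹ := fun n =>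
    (((@measurable_cSigma Ω (M.past (S.l₂ n)) M S T n hM.isKernel (hO n)).div
      (measurable_const.pow ((((@measurable_rHat Ω (M.past (S.l₂ n)) M S T n hM.isKernel
        (hO n)).add_const ε).mul (@measurable_gammaHat Ω (M.past (S.l₂ n)) M S T n hM.isKernel
          (hO n))).const_sub (1 / 2)))).const_mul _).inv
  -- Normalization by the half-width gives the degenerate Gaussian limit of variance 0.
  have hdist := hM.tendstoInDistribution_psiHat (v := 0) hhw hdH (by
      refine (zero_pow two_ne_zero (M₀ := ℝ) ▸ hvar.pow 2).congr' ?_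
      filter_upwards [hm0] with q hq
      rw [div_pow, mul_pow, Real.sq_sqrt hq.le]) hbias (by
      have h1 := hvar.mul (hM.tendsto_lindeberg h hT (S := S) le_rfl
        (by rw [add_zero]; exact h.rate_lt_one))
      rw [mul_zero] at h1
      refine h1.congr' ?_
      filter_upwards [hpos, hm0, hδ0.eventually h.eventually_σ_pos] with q hq hmq hσ
      have hs := Real.sqrt_pos.2 hmq
      field_simp
      rw [Real.sq_sqrt hmq.le])
  -- convergence in distribution to zero, hence in probability
  have hlarge : Tendsto (fun n => μ {ω | ¬|(M.halfWidth S T α ε n ω)⁻¹ *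
      (M.psiHat S n (M.deltaHat S T 0 n ω) ω - M.target)| ≤ 1}) atTop (𝓝 0) := by
    have hE : MeasurableSet {y : ℝ | ¬|y| ≤ 1} :=
      (measurableSet_le measurable_id.abs measurable_const).compl
    have hnot : (0 : ℝ) ∉ closure {y : ℝ | ¬|y| ≤ 1} := by
      rw [mem_closure_iff_nhds]
      intro h1
      obtain ⟨y, hy, hy'⟩ := h1 _ (Metric.ball_mem_nhds (0 : ℝ) one_pos)
      exact hy' (mem_ball_zero_iff.1 hy).le
    have h1 := ProbabilityMeasure.tendsto_measure_of_null_frontier_of_tendsto' hdist.tendsto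
      (E := {y : ℝ | ¬|y| ≤ 1}) (by
        simp only [ProbabilityMeasure.coe_mk, Measure.map_id, gaussianReal_zero_var]
        rw [Measure.dirac_apply' _ isClosed_frontier.measurableSet, indicator_of_notMem]
        exact fun hf => hnot hf.1)
    simp only [ProbabilityMeasure.coe_mk, Measure.map_id, gaussianReal_zero_var] at h1
    rw [Measure.dirac_apply' _ hE, indicator_of_notMem (by simp)] at h1
    refine h1.congr fun n => ?_
    rw [Measure.map_apply_of_aemeasurable (hdist.forall_aemeasurable n) hE]
    rfl
  have hev : ∀ᶠ q in probFilter μ, M.target ∈ M.confInt S T α ε q.1 q.2 := by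
    have h1 : ∀ᶠ q in probFilter μ, |(M.halfWidth S T α ε q.1 q.2)⁻¹ *
        (M.psiHat S q.1 (M.deltaHat S T 0 q.1 q.2) q.2 - M.target)| ≤ 1 :=
      (eventually_probFilter (p := fun n ω => |(M.halfWidth S T α ε n ω)⁻¹ *
        (M.psiHat S n (M.deltaHat S T 0 n ω) ω - M.target)| ≤ 1)).2 hlarge
    filter_upwards [h1, hm0, hcS.eventually_const_lt h.A_pos] with q hq hmq hcq
    have hhw0 : 0 < M.halfWidth S T α ε q.1 q.2 :=
      mul_pos hz (div_pos hcq (Real.rpow_pos_of_pos hmq _))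
    rw [abs_mul, abs_inv, abs_of_pos hhw0, inv_mul_le_iff₀ hhw0, mul_one, abs_le] at hq
    exact ⟨by linarith [hq.2], by linarith [hq.1]⟩
  have hcompl := (eventually_probFilter (p := fun n ω => M.target ∈ M.confInt S T α ε n ω)).1 hev
  -- Coverage is bounded below by subadditivity, `1 ≤ μ E + μ Eᶜ`, which needs no measurability of
  -- the coverage event.
  have hsub := ENNReal.Tendsto.sub (tendsto_const_nhds (x := (1 : ENNReal))) hcompl
    (Or.inl ENNReal.one_ne_top)
  rw [tsub_zero] at hsub
  refine tendsto_of_tendsto_of_tendsto_of_le_of_le hsub tendsto_const_nhds (fun n => ?_)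
    fun n => prob_le_one
  rw [tsub_le_iff_right, ← measure_univ (μ := μ),
    ← union_compl_self {ω | M.target ∈ M.confInt S T α ε n ω}]
  exact measure_union_le _ _

end Model.IsSampled

end DensityPoint

theorem mainTheorem5 {Ω : Type*} [MeasurableSpace Ω] (μ : Measure Ω) [IsProbabilityMeasure μ]
    (M : DensityPoint.Model Ω)
    (hK : DensityPoint.IsKernel M.K)
    (hp : DensityPoint.IsDensity M.p₀)
    (hOmeas : ∀ i, Measurable (M.O i))
    (hOindep : iIndepFun M.O μ)
    (hOlaw : ∀ i, μ.map (M.O i) = M.P₀) :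
    (∀ S : DensityPoint.Split,
      M.GradConverges μ S ∧ M.A2 μ S ∧ M.A3 μ S ∧ M.A4 μ S ∧ M.A5 μ S ∧
        ∀ r₀ : ℝ, M.A6 μ S r₀ ∧ M.A7 μ S r₀ ∧ M.A8 μ S r₀) ∧
    (0 < M.p₀ M.x → ContinuousAt M.p₀ M.x → Tendsto M.bias (𝓝[>] 0) (𝓝 0) → M.A1 →
      ∃ (rmax ε₀ : ℝ) (κ κfull : ℝ → ℝ), 0 < rmax ∧ 0 < ε₀ ∧
        (∀ p ∈ Ioo (0 : ℝ) 1, 0 < κ p ∧ 0 < κfull p) ∧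
        AntitoneOn κ (Ioo 0 1) ∧ StrictAntiOn κfull (Ioo 0 1) ∧
        ∀ S : DensityPoint.Split,
          (∃ d, DensityPoint.IsOptimal (M.mse μ S) d) ∧
          (∃ d, DensityPoint.IsOptimal M.fullMse d) ∧
          ∀ T : DensityPoint.Pilot, T.Admissible rmax →
            (∀ ε : ℝ, 0 < ε → ε ≤ ε₀ →
              TendstoInDistribution (M.studentized S T ε) atTop (id : ℝ → ℝ) (fun _ => μ)
                (gaussianReal 0 1)) ∧
            (∀ d, DensityPoint.IsStationary (M.mse μ S) d →
              TendstoInMeasure μ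
                (fun n ω => M.mse μ S n (M.deltaHat S T 0 n ω) / M.mse μ S n (d n))
                atTop (fun _ => κ S.p₂)) ∧
            (∀ d, DensityPoint.IsStationary M.fullMse d →
              TendstoInMeasure μ
                (fun n ω => M.mse μ S n (M.deltaHat S T 0 n ω) / M.mse μ S n (d n))
                atTop (fun _ => κfull S.p₂)) ∧
            (∀ α ε : ℝ, 0 < α → α < 1 → 0 < ε →
              Tendsto (fun n => μ {ω | M.target ∈ M.confInt S T α ε n ω}) atTop (𝓝 1))) := by
  have hM : M.IsSampled μ := ⟨hK, hp, hOmeas, hOindep, hOlaw⟩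
  refine ⟨fun S => ⟨hM.gradConverges S, hM.a2 S, hM.a3 S, hM.a4 S, hM.a5 S, fun r₀ =>
    ⟨hM.a6 S r₀, hM.a7 S r₀, hM.a8 S r₀⟩⟩, fun hx hc hb hA1 => ?_⟩
  obtain ⟨A, B, γ, β, h⟩ := hM.exists_powerLaw hx hc hb hA1
  have hβ := h.β_pos
  have hr := h.rate_pos
  have hr1 := h.rate_lt_one
  have hc0 := h.optConst_pos
  -- The first constant makes the finite differences accurate. The second keeps `r + ε < 1` for
  -- every `ε ≤ ε₀`, as Lindeberg's condition requires.
  refine ⟨1 / (4 * (1 + β)), (1 - DensityPoint.PowerLaw.rate γ β) / 2, fun _ => 1,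
    DensityPoint.PowerLaw.fullRatio A B γ β, by positivity, by linarith,
    fun p hp => ⟨one_pos, h.fullRatio_pos hp.2⟩, antitoneOn_const, h.strictAntiOn_fullRatio,
    fun S => ⟨?_, h.exists_isOptimal tendsto_natCast_atTop_atTop, fun T hT =>
      ⟨fun ε hε hε1 => hM.tendstoInDistribution_studentized h hT hε (by linarith), fun d hd => ?_,
        fun d hd => ?_, fun α ε hα hα1 hε => hM.tendsto_measure_confInt h hT hα hα1 hε⟩⟩⟩
  · obtain ⟨d, hd⟩ := h.exists_isOptimal S.tendsto_m₃
    exact ⟨d, hd.congr ((hM.eventually_mse_eq S).mono fun n hn => hn.symm)⟩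
  · have h1 := hM.tendstoInMeasure_mse_div h hT hc0
      (h.tendsto_of_isStationary S.tendsto_m₃ (hd.congr (hM.eventually_mse_eq S)))
    rwa [div_self (h.risk_pos hc0).ne'] at h1
  -- The benchmark is tuned to `n` observations while the estimator averages `m₃ ~ (1 - p₂) n`; on
  -- the scale `m₃^r` its constant is multiplied by `(1 - p₂)^r`.
  · have h1 := (h.tendsto_of_isStationary tendsto_natCast_atTop_atTop hd).mul
      (S.tendsto_m₃_div.rpow_const (p := DensityPoint.PowerLaw.rate γ β) (Or.inr hr.le))
    refine hM.tendstoInMeasure_mse_div h hT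
      (mul_pos hc0 (Real.rpow_pos_of_pos (sub_pos.2 S.lt_one) _)) (h1.congr' ?_)
    filter_upwards [eventually_gt_atTop 0, S.tendsto_m₃.eventually_gt_atTop 0] with n hn hm
    have hn' : (0 : ℝ) < n := Nat.cast_pos.2 hn
    rw [mul_assoc, ← Real.mul_rpow hn'.le (by positivity), mul_div_cancel₀ _ hn'.ne']
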